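/- **Setting.** Let $n\ge 0$ and $S^n=\{x\in\mathbb R^{n+1}:\|x\|=1\}$. A triangulation $K$ of $S^n$ is a finite simplicial complex together with a homeomorphism of its underlying space onto $S^n$; its simplices are regarded as subsets of $S^n$. It is *symmetric* if $-\sigma\in K$ for every $\sigma\in K$. A *flag of hemispheres* is a sequence $H_0\subset\dots\subset H_n$ of subsets of $S^n$, with $H_d$ homeomorphic to a closed $d$-ball, such that $\partial H_d=\partial(-H_d)=H_d\cap -H_d=H_{d-1}\cup -H_{d-1}$ for $1\le d\le n$, $H_n\cup -H_n=S^n$, and $H_0,-H_0$ are antipodal points. $K$ is *aligned with* the flag if each $H_d$ is contained in the $d$-skeleton of $K$. The *carrier* of a simplex $\sigma$ is the smallest of the hemispheres $\pm H_d$ that contains it; the sign of the carrier is $+$ for $H_d$ and $-$ for $-H_d$. Let the vertices of $K$ be labelled by elements of $\{\pm1,\dots,\pm m\}$. A $d$-simplex is *alternating* if its labels are $\{\varepsilon k_0,-\varepsilon k_1,\varepsilon k_2,\dots,(-1)^d\varepsilon k_d\}$ with $1\le k_0<\dots<k_d$ and $\varepsilon\in\{1,-1\}$; $\varepsilon$ is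 its sign. A simplex is *almost-alternating* of sign $\varepsilon$ if it is not alternating but deleting some vertex leaves an alternating simplex of sign $\varepsilon$. **Theorem.** Let $K$ be a symmetric triangulation of $S^n$ that is aligned with a flag of hemispheres $H_0\subset\dots\subset H_n$. Suppose that the vertices of $K$ are labelled by $\{\pm1,\dots,\pm m\}$ so that (i) the labels of any two antipodal vertices sum to zero and (ii) the labels at the ends of any edge do not sum to zero. Then: 1. The number of positive alternating $n$-simplices is odd and equals the number of negative alternating $n$-simplices. In particular $m\ge n+1$. 2. There is a constructive procedure that finds an alternating $n$-simplex of each sign, namely the following. Let $G$ be the graph whose nodes are the simplices that, for some $d$ and some $\varepsilon$, have carrier $\varepsilon H_d$ and are either alternating $(d-1)$-simplices of sign $\varepsilon$, or almost-alternating $d$-simplices of sign $\varepsilon$, or alternating $d$-simplices (of any sign). Two nodes $\sigma,\tau$ are adjacent if one is a facet of the other, $\sigma\cap\tau$ is alternating, and the larger one $\sigma\cup\tau$ is, for some $d$, a $d$-simplex whose carrier is $\varepsilon H_d$, where $\varepsilon$ is the sign of $\sigma\cap\tau$. If $n\ge1$, every node of $G$ has degree $1$ or $2$, and the nodes of degree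 $1$ are exactly $H_0$, $-H_0$ and the alternating $n$-simplices. Start at $H_0$; while the current node is not an alternating $n$-simplex, move to a neighbour other than the previous node. Within at most as many moves as $K$ has simplices this stops at an alternating $n$-simplex; it and its antipode are alternating $n$-simplices of opposite signs. The labelled triangulation with its flag has a finite combinatorial description (a list of its simplices and of the simplices in each $H_d$, the antipodal map on vertices, and the labels), and the procedure is computable from any such description. -/

import Mathlib

open scoped Pointwise

namespace Fan

/-! ### Triangulated spheres -/

/-- The unit sphere `S^n` in `ℝ^(n+1)`. -/
abbrev Sphere (n : ℕ) : Type := Metric.sphere (0 : EuclideanSpace ℝ (Fin (n + 1))) 1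

/-- A triangulation of `S^n`: a finite simplicial complex in a real normed space together with a
homeomorphism of its underlying space onto `S^n` (the simplices on the sphere may be curved). -/
structure Triangulation (n : ℕ) (E : Type*) [NormedAddCommGroup E] [NormedSpace ℝ E] where
  complex : Geometry.SimplicialComplex ℝ E
  finite : complex.faces.Finite
  homeo : complex.space ≃ₜ Sphere n

namespace Triangulation

variable {n : ℕ} {E : Type*} [NormedAddCommGroup E] [NormedSpace ℝ E]

/-- The closed simplex of `S^n` that corresponds to the face with vertex set `s`. -/
def simplex (K : Triangulation n E) (s : Finset E) : Set (Sphere n) :=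
  {x | (K.homeo.symm x : E) ∈ convexHull ℝ (s : Set E)}

/-- The `d`-skeleton, as a subset of `S^n`. -/
def skeleton (K : Triangulation n E) (d : ℕ) : Set (Sphere n) :=
  {x | ∃ s ∈ K.complex.faces, s.card ≤ d + 1 ∧ x ∈ K.simplex s}

/-- Central symmetry: the antipodal set of every simplex of `K` is a simplex of `K`. -/
def IsSymmetric (K : Triangulation n E) : Prop :=
  ∀ s ∈ K.complex.faces, ∃ t ∈ K.complex.faces, K.simplex t = -K.simplex s

/-- Every vertex has a label in `{±1, …, ±m}`. -/
def HasLabelsUpTo (K : Triangulation n E) (label : E → ℤ) (m : ℕ) : Prop :=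
  ∀ v ∈ K.complex.vertices, 1 ≤ |label v| ∧ |label v| ≤ m

/-- The labels of any two antipodal vertices sum to zero. -/
def IsAntisymmetric (K : Triangulation n E) (label : E → ℤ) : Prop :=
  ∀ v ∈ K.complex.vertices, ∀ w ∈ K.complex.vertices,
    K.simplex {w} = -K.simplex {v} → label v + label w = 0

/-- No edge has labels that sum to zero. -/
def NoComplementaryEdge (K : Triangulation n E) (label : E → ℤ) : Prop :=
  ∀ s ∈ K.complex.faces, ∀ v ∈ s, ∀ w ∈ s, v ≠ w → label v + label w ≠ 0

end Triangulation

/-- A flag of hemispheres `H 0 ⊆ ⋯ ⊆ H n` of `S^n` (the values `H d` with `d > n` play no role).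
Each `H d` is homeomorphic to the closed `d`-ball, and for `1 ≤ d ≤ n` the homeomorphism carries
the boundary sphere of the ball onto `H d ∩ -H d = H (d-1) ∪ -H (d-1)`. -/
structure IsHemisphereFlag {n : ℕ} (H : ℕ → Set (Sphere n)) : Prop where
  mono : ∀ d, d + 1 ≤ n → H d ⊆ H (d + 1)
  ball : ∀ d ≤ n, ∃ h : Metric.closedBall (0 : EuclideanSpace ℝ (Fin d)) 1 ≃ₜ H d,
    1 ≤ d → {y | ∃ x : Metric.closedBall (0 : EuclideanSpace ℝ (Fin d)) 1,
      ‖(x : EuclideanSpace ℝ (Fin d))‖ = 1 ∧ (h x : Sphere n) = y} = H d ∩ -H d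
  inter : ∀ d, d + 1 ≤ n → H (d + 1) ∩ -H (d + 1) = H d ∪ -H d
  cover : H n ∪ -H n = Set.univ

/-- The flag `H` is a flag of hemispheres with `H d` contained in the `d`-skeleton of `K`. -/
def Triangulation.IsAlignedWith {n : ℕ} {E : Type*} [NormedAddCommGroup E] [NormedSpace ℝ E]
    (K : Triangulation n E) (H : ℕ → Set (Sphere n)) : Prop :=
  IsHemisphereFlag H ∧ ∀ d ≤ n, H d ⊆ K.skeleton d

/-! ### Alternating simplices -/

/-- `s` is an alternating simplex of sign `ε`: its labels are distinct in magnitude, and the label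
that has exactly `i` labels of smaller magnitude below it has sign `ε * (-1)^i`. -/
def IsAlternating {V : Type*} (label : V → ℤ) (ε : ℤˣ) (s : Finset V) : Prop :=
  s.Nonempty ∧ (∀ v ∈ s, ∀ w ∈ s, |label v| = |label w| → v = w) ∧
    ∀ v ∈ s, (label v).sign = (ε : ℤ) * (-1) ^ (s.filter fun w => |label w| < |label v|).card

instance {V : Type*} [DecidableEq V] (label : V → ℤ) (ε : ℤˣ) (s : Finset V) :
    Decidable (IsAlternating label ε s) := by
  unfold IsAlternating; infer_instance

/-- `s` is almost-alternating of sign `ε`: it is not alternating, but deleting some vertex gives an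
alternating simplex of sign `ε`. -/
def IsAlmostAlternating {V : Type*} [DecidableEq V] (label : V → ℤ) (ε : ℤˣ) (s : Finset V) :
    Prop :=
  (∀ δ : ℤˣ, ¬ IsAlternating label δ s) ∧ ∃ v ∈ s, IsAlternating label ε (s.erase v)

instance {V : Type*} [DecidableEq V] (label : V → ℤ) (ε : ℤˣ) (s : Finset V) :
    Decidable (IsAlmostAlternating label ε s) := by
  unfold IsAlmostAlternating; infer_instance

/-- The alternating `n`-simplices of sign `ε` of a labelled triangulation of `S^n`. -/
def Triangulation.alternating {n : ℕ} {E : Type*} [NormedAddCommGroup E] [NormedSpace ℝ E]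
    (K : Triangulation n E) (label : E → ℤ) (ε : ℤˣ) : Set (Finset E) :=
  {s | s ∈ K.complex.faces ∧ s.card = n + 1 ∧ IsAlternating label ε s}

/-! ### The path-following procedure

Everything in this part is computable. -/

/-- The finite input of the procedure: lists of the simplices of `K` and of the simplices that lie
in each `H d`, the antipodal map on vertices, and the labels. -/
structure Input (V : Type*) where
  faces : List (Finset V)
  hemi : ℕ → List (Finset V)
  antipode : V → V
  label : V → ℤ

namespace Input

variable {V : Type*} [DecidableEq V]

/-- The simplex `s` lies in `H d` (for `ε = 1`) or in `-H d` (for `ε = -1`). -/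
def LiesIn (D : Input V) (ε : ℤˣ) (d : ℕ) (s : Finset V) : Prop :=
  (if ε = 1 then s else s.image D.antipode) ∈ D.hemi d

instance (D : Input V) (ε : ℤˣ) (d : ℕ) (s : Finset V) : Decidable (D.LiesIn ε d s) := by
  unfold LiesIn; infer_instance

/-- The carrier hemisphere of `s` (the smallest one that contains `s`) is `ε H d`. -/
def HasCarrier (D : Input V) (ε : ℤˣ) (d : ℕ) (s : Finset V) : Prop :=
  D.LiesIn ε d s ∧ ∀ c < d, ∀ δ : ℤˣ, ¬ D.LiesIn δ c s

instance (D : Input V) (ε : ℤˣ) (d : ℕ) (s : Finset V) : Decidable (D.HasCarrier ε d s) := by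
  unfold HasCarrier; infer_instance

/-- The nodes: simplices with carrier `ε H d` that are alternating `(d-1)`-simplices of sign `ε`,
or almost-alternating `d`-simplices of sign `ε`, or alternating `d`-simplices of any sign. -/
def IsNode (D : Input V) (n : ℕ) (s : Finset V) : Prop :=
  s ∈ D.faces ∧ ∃ d < n + 1, ∃ ε : ℤˣ, D.HasCarrier ε d s ∧
    ((s.card = d ∧ IsAlternating D.label ε s) ∨
      (s.card = d + 1 ∧ IsAlmostAlternating D.label ε s) ∨
      (s.card = d + 1 ∧ ∃ δ : ℤˣ, IsAlternating D.label δ s))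

instance (D : Input V) (n : ℕ) (s : Finset V) : Decidable (D.IsNode n s) := by
  unfold IsNode; infer_instance

/-- Adjacency of nodes: one is a facet of the other, the smaller one `s ∩ t` is alternating, the
larger one `s ∪ t` is a `d`-simplex with carrier `ε H d`, and `ε` is the sign of `s ∩ t`. -/
def Adj (D : Input V) (n : ℕ) (s t : Finset V) : Prop :=
  D.IsNode n s ∧ D.IsNode n t ∧
    ((s ⊆ t ∧ t.card = s.card + 1) ∨ (t ⊆ s ∧ s.card = t.card + 1)) ∧
    ∃ d < n + 1, ∃ ε : ℤˣ, IsAlternating D.label ε (s ∩ t) ∧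
      (s ∪ t).card = d + 1 ∧ D.HasCarrier ε d (s ∪ t)

instance (D : Input V) (n : ℕ) (s t : Finset V) : Decidable (D.Adj n s t) := by
  unfold Adj; infer_instance

/-- `s` is an alternating `n`-simplex, of either sign. -/
def IsGoal (D : Input V) (n : ℕ) (s : Finset V) : Prop :=
  s.card = n + 1 ∧ ∃ ε : ℤˣ, IsAlternating D.label ε s

instance (D : Input V) (n : ℕ) (s : Finset V) : Decidable (D.IsGoal n s) := by
  unfold IsGoal; infer_instance

/-- Follow the path: stop at an alternating `n`-simplex; otherwise move from the current node to a
neighbour other than the previous node. At most `k` moves are made. -/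
def follow (D : Input V) (n : ℕ) : (k : ℕ) → (previous : Option (Finset V)) →
    (current : Finset V) → Option (Finset V)
  | 0, _, s => if D.IsGoal n s then some s else none
  | k + 1, p, s =>
    if D.IsGoal n s then some s
    else
      match D.faces.find? fun t => decide (D.Adj n s t ∧ p ≠ some t) with
      | none => none
      | some t => D.follow n k (some s) t

/-- The procedure: follow the path from `H 0`, with at most as many moves as there are listed
simplices, and return the simplex found and its antipode, the positive one first. -/
def search (D : Input V) (n : ℕ) : Option (Finset V × Finset V) :=
  match (D.hemi 0).head? with
  | none => none
  | some start =>
    match D.follow n D.faces.length none start with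
    | none => none
    | some s =>
      if IsAlternating D.label 1 s then some (s, s.image D.antipode)
      else some (s.image D.antipode, s)

/-- `D` describes the labelled triangulation `K` with the flag `H`, where `e` is an enumeration of
the vertices of `K` by `V`. -/
structure Describes {n : ℕ} {E : Type*} [NormedAddCommGroup E] [NormedSpace ℝ E]
    (D : Input V) (K : Triangulation n E) (H : ℕ → Set (Sphere n)) (label : E → ℤ)
    (e : V ↪ E) : Prop where
  range_eq : Set.range e = K.complex.vertices
  faces_iff : ∀ s, s ∈ D.faces ↔ s.map e ∈ K.complex.faces
  hemi_iff : ∀ d ≤ n, ∀ s, s ∈ D.hemi d ↔ s ∈ D.faces ∧ K.simplex (s.map e) ⊆ H d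
  antipode_eq : ∀ v, K.simplex {e (D.antipode v)} = -K.simplex {e v}
  label_eq : ∀ v, D.label v = label (e v)

end Input

end Fan

/-!
The theorem has a topological and a combinatorial half, joined by the predicate
`Fan.Input.IsFlagged`, which lists the combinatorial properties of a labelled triangulation that the
argument needs.

The topological half (`Fan.Input.Describes.isFlagged`) has to show that a hemisphere `H d`, known
only as a homeomorphic image of a ball inside the `d`-skeleton, is triangulated by the `d`-simplices
in it as a pseudomanifold: a `(d-1)`-simplex of `H d` is a facet of exactly two of them, or of
exactly one if it lies in the boundary `H (d-1) ∪ -H (d-1)`. This is local, and rests on invariance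
of domain (`Fan.image_mem_nhds_of_continuousOn_of_injOn`). A `d`-simplex with an interior point in
`H d` lies in `H d` because the trace of `H d` on its interior is open and closed. Around a
`(d-1)`-simplex, one `d`-simplex at most would embed an open set of `ℝ^d` in a half-space with a
boundary point in the image; two of them already fill a neighbourhood in `H d`, which excludes a
third one and excludes boundary points. All this is done in barycentric coordinates, where the
triangulated sphere is a subset of `V → ℝ`.

Invariance of domain follows from the fact that `x ↦ x + g x` has a zero when `g` is continuous with
compact support (`Fan.exists_add_eq_zero_of_continuous`). For smooth `g` the integral of
`(1 - c ‖x + t • g x‖ ^ 2) ^ k` against the Jacobian of `x ↦ x + t • g x` is a polynomial in `t`. It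
is constant for small `t`, where that map is a bijection of a ball, hence constant; without a zero,
its value at `t = 1` would be too small for large `k`.

The combinatorial half consists of three arguments. The degrees (`Fan.Input.IsFlagged.degree`) come
from the pseudomanifold property and from counting alternating facets: an alternating simplex has
one of each sign, and any other simplex that has one of sign `ε` has exactly two. The path from
`H 0` visits no node twice, as all degrees are at most two, and it cannot end at `-H 0`, because the
antipodal map would reverse it and fix its middle node or swap the ends of its middle edge; so it
ends at an alternating `n`-simplex (`Fan.Input.IsFlagged.exists_follow_eq_some`). The parity of the
number of alternating `d`-simplices in `H d` does not depend on `d`, by counting modulo two the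
pairs of a `d`-simplex of `H d` and a positive alternating facet of it
(`Fan.Input.IsFlagged.odd_card_hemiAlternating`).
-/

namespace Fan

/-! ### Invariance of domain -/

section InvarianceOfDomain

open MeasureTheory Metric Set Filter Topology

section Smooth

variable {E : Type*} [NormedAddCommGroup E] [InnerProductSpace ℝ E]

lemma injective_add_smul_of_lipschitz {g : E → E} {C : NNReal} (hg : LipschitzWith C g)
    {t : ℝ} (ht : 0 ≤ t) (htC : t * C < 1) : Function.Injective fun x => x + t • g x := by
  intro x y hxy
  have h1 : x - y = t • (g y - g x) := by
    have : x + t • g x = y + t • g y := hxy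
    rw [smul_sub, sub_eq_sub_iff_add_eq_add, this, add_comm]
  have h2 : ‖x - y‖ ≤ t * C * ‖x - y‖ := by
    calc ‖x - y‖ = t * ‖g y - g x‖ := by rw [h1, norm_smul, Real.norm_of_nonneg ht]
      _ ≤ t * (C * ‖y - x‖) := by gcongr; exact hg.norm_sub_le y x
      _ = t * C * ‖x - y‖ := by rw [norm_sub_rev]; ring
  have h3 : ‖x - y‖ = 0 := by
    by_contra h
    have : 0 < ‖x - y‖ := lt_of_le_of_ne (norm_nonneg _) (Ne.symm h)
    nlinarith
  exact sub_eq_zero.1 (norm_eq_zero.1 h3)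

/-- Surjectivity comes from the contraction principle, applied to `x ↦ y - t • g x`. -/
lemma image_closedBall_add_smul_of_lipschitz [CompleteSpace E] {g : E → E} {C : NNReal}
    (hg : LipschitzWith C g) {R t : ℝ} (hR : ∀ x, R < ‖x‖ → g x = 0) (ht : 0 ≤ t) (htC : t * C < 1) :
    (fun x => x + t • g x) '' closedBall 0 R = closedBall 0 R := by
  have hinj := injective_add_smul_of_lipschitz hg ht htC
  apply Subset.antisymm
  · rintro _ ⟨x, hx, rfl⟩
    by_contra hfx
    have hfx' : R < ‖x + t • g x‖ := by simpa using hfx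
    have : x + t • g x = x := hinj (by simp [hR _ hfx'])
    exact hfx (by simpa only [this] using hx)
  · intro y hy
    have hc : ContractingWith (t.toNNReal * C) fun x => y - t • g x := by
      refine ⟨?_, LipschitzWith.of_dist_le_mul fun x z => ?_⟩
      · rw [← NNReal.coe_lt_coe, NNReal.coe_mul, Real.coe_toNNReal t ht]
        exact htC
      rw [dist_eq_norm, dist_eq_norm, sub_sub_sub_cancel_left, ← smul_sub, norm_smul,
        Real.norm_of_nonneg ht, NNReal.coe_mul, Real.coe_toNNReal t ht, mul_assoc,
        norm_sub_rev x z]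
      exact mul_le_mul_of_nonneg_left (hg.norm_sub_le z x) ht
    obtain ⟨x, hx⟩ : ∃ x, y - t • g x = x := ⟨_, hc.fixedPoint_isFixedPt⟩
    refine ⟨x, ?_, by simp only; nth_rewrite 1 [← hx]; abel⟩
    by_contra hxR
    have : g x = 0 := hR x (by simpa using hxR)
    rw [this, smul_zero, sub_zero] at hx
    exact hxR (hx ▸ hy)

/-- Evaluation of the coefficients at the point `x` and of the variable at `t`. -/
noncomputable def evalCoeffAt {X : Type*} [TopologicalSpace X] (t : ℝ) (x : X) :
    Polynomial C(X, ℝ) →+* ℝ :=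
  Polynomial.eval₂RingHom ((Pi.evalRingHom (fun _ : X => ℝ) x).comp ContinuousMap.coeFnRingHom) t

lemma evalCoeffAt_C {X : Type*} [TopologicalSpace X] (t : ℝ) (x : X) (c : C(X, ℝ)) :
    evalCoeffAt t x (Polynomial.C c) = c x := by simp [evalCoeffAt]

lemma evalCoeffAt_X {X : Type*} [TopologicalSpace X] (t : ℝ) (x : X) :
    evalCoeffAt t x Polynomial.X = t := by simp [evalCoeffAt]

lemma exists_evalCoeffAt_eq_pow {g : E → E} (hg : Continuous g) (c : ℝ) (k : ℕ) :
    ∃ P : Polynomial C(E, ℝ), ∀ t x,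
      evalCoeffAt t x P = (1 - c * ‖x + t • g x‖ ^ 2) ^ k := by
  let a₀ : C(E, ℝ) := ⟨fun x => 1 - c * ‖x‖ ^ 2, by fun_prop⟩
  let a₁ : C(E, ℝ) := ⟨fun x => -(2 * c * inner ℝ x (g x)), by fun_prop⟩
  let a₂ : C(E, ℝ) := ⟨fun x => -(c * ‖g x‖ ^ 2), by fun_prop⟩
  refine ⟨(Polynomial.C a₀ + Polynomial.C a₁ * Polynomial.X +
    Polynomial.C a₂ * Polynomial.X ^ 2) ^ k, fun t x => ?_⟩
  simp only [map_pow, map_add, map_mul, evalCoeffAt_C, evalCoeffAt_X, a₀, a₁, a₂,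
    ContinuousMap.coe_mk]
  rw [norm_add_sq_real, inner_smul_right, norm_smul, mul_pow, Real.norm_eq_abs, sq_abs]
  ring

variable [FiniteDimensional ℝ E]

/-- The determinant of `1 + t • A x`, for a continuous family `A` of endomorphisms, is polynomial
in `t` with coefficients continuous in `x`. -/
lemma exists_evalCoeffAt_eq_det {A : E → E →L[ℝ] E} (hA : Continuous A) :
    ∃ P : Polynomial C(E, ℝ), ∀ t x,
      evalCoeffAt t x P = (ContinuousLinearMap.id ℝ E + t • A x).det := by
  let b := Module.finBasis ℝ E
  have hcont : ∀ i j, Continuous fun x => LinearMap.toMatrix b b (A x : E →ₗ[ℝ] E) i j := by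
    intro i j
    simp only [LinearMap.toMatrix_apply, ContinuousLinearMap.coe_coe]
    have h1 : Continuous fun x => A x (b j) := hA.clm_apply continuous_const
    exact (LinearMap.continuous_of_finiteDimensional (b.coord i)).comp h1
  let M : Matrix (Fin (Module.finrank ℝ E)) (Fin (Module.finrank ℝ E)) (Polynomial C(E, ℝ)) :=
    1 + Matrix.of fun i j => Polynomial.X * Polynomial.C ⟨_, hcont i j⟩
  refine ⟨M.det, fun t x => ?_⟩
  rw [RingHom.map_det, ContinuousLinearMap.det, ← LinearMap.det_toMatrix b]
  congr 1
  ext i j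
  simp only [M, map_add, map_one, Matrix.add_apply, RingHom.mapMatrix_apply, Matrix.map_apply,
    Matrix.of_apply, map_mul, evalCoeffAt_C, evalCoeffAt_X, ContinuousLinearMap.toLinearMap_add,
    ContinuousLinearMap.toLinearMap_smul, ContinuousLinearMap.coe_id, LinearMap.toMatrix_id,
    map_smul, Matrix.smul_apply, ContinuousMap.coe_mk, smul_eq_mul]

variable [MeasurableSpace E] [BorelSpace E]

lemma exists_polynomial_setIntegral_evalCoeffAt {X : Type*} [TopologicalSpace X]
    [MeasurableSpace X] [OpensMeasurableSpace X] [T2Space X] (μ : Measure X)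
    [IsFiniteMeasureOnCompacts μ]
    {K : Set X} (hK : IsCompact K) (P : Polynomial C(X, ℝ)) :
    ∃ Q : Polynomial ℝ, ∀ t, ∫ x in K, evalCoeffAt t x P ∂μ = Q.eval t := by
  refine ⟨∑ i ∈ Finset.range (P.natDegree + 1),
    Polynomial.C (∫ x in K, P.coeff i x ∂μ) * Polynomial.X ^ i, fun t => ?_⟩
  have : ∀ x, evalCoeffAt t x P = ∑ i ∈ Finset.range (P.natDegree + 1), P.coeff i x * t ^ i := by
    intro x; simp [evalCoeffAt, Polynomial.eval₂_eq_sum_range]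
  simp_rw [this]
  rw [integral_finsetSum _ fun i _ => ?_]
  · simp [Polynomial.eval_finsetSum, integral_mul_const]
  · exact (((P.coeff i).continuous.continuousOn).integrableOn_compact hK).mul_const _

/-- If `g` is continuously differentiable and vanishes outside a ball, the change of variables
formula for `x ↦ x + g x` and the test function `(1 - c ‖·‖ ^ 2) ^ k` holds, with signed Jacobian,
even if that map is not injective: for `x ↦ x + t • g x` both sides are polynomial in `t`, and for
small `t` the map is a bijection of the ball. -/
lemma setIntegral_det_mul_pow_eq (μ : Measure E) [μ.IsAddHaarMeasure] {g : E → E}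
    (hg : ContDiff ℝ 1 g) (hgc : HasCompactSupport g) {R : ℝ} (hR : ∀ x, R < ‖x‖ → g x = 0)
    (c : ℝ) (k : ℕ) :
    ∫ x in closedBall 0 R, (ContinuousLinearMap.id ℝ E + fderiv ℝ g x).det *
      (1 - c * ‖x + g x‖ ^ 2) ^ k ∂μ = ∫ x in closedBall 0 R, (1 - c * ‖x‖ ^ 2) ^ k ∂μ := by
  have hdg : Continuous (fderiv ℝ g) := hg.continuous_fderiv one_ne_zero
  obtain ⟨P₁, hP₁⟩ := exists_evalCoeffAt_eq_det hdg
  obtain ⟨P₂, hP₂⟩ := exists_evalCoeffAt_eq_pow hg.continuous c k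
  obtain ⟨Q, hQ⟩ := exists_polynomial_setIntegral_evalCoeffAt μ
    (isCompact_closedBall (0 : E) R) (P₁ * P₂)
  simp only [map_mul, hP₁, hP₂] at hQ
  obtain ⟨C, hC⟩ := ContDiff.lipschitzWith_of_hasCompactSupport hgc hg one_ne_zero
  -- a uniform bound on `t` below which the Jacobian is positive
  obtain ⟨δ, hδ, hdet⟩ : ∃ δ > 0, ∀ A : E →L[ℝ] E, ‖A‖ < δ →
      0 < (ContinuousLinearMap.id ℝ E + A).det := by
    have hcont : Continuous fun A : E →L[ℝ] E => (ContinuousLinearMap.id ℝ E + A).det :=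
      ContinuousLinearMap.continuous_det.comp (by fun_prop)
    have h0 : 0 < (ContinuousLinearMap.id ℝ E + (0 : E →L[ℝ] E)).det := by
      simp [ContinuousLinearMap.det]
    obtain ⟨δ, hδ, h⟩ := Metric.eventually_nhds_iff.1 (hcont.continuousAt.eventually_const_lt h0)
    exact ⟨δ, hδ, fun A hA => h (by simpa using hA)⟩
  have hbound : ∀ x, ‖fderiv ℝ g x‖ ≤ C := fun x => norm_fderiv_le_of_lipschitz ℝ hC
  obtain ⟨τ, hτ, hτ1, hτ2⟩ : ∃ τ : ℝ, 0 < τ ∧ τ * C < 1 ∧ τ * C < δ := by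
    refine ⟨min 1 δ / (C + 1), by positivity, ?_, ?_⟩ <;>
    · rw [div_mul_eq_mul_div, div_lt_iff₀ (by positivity)]
      have := min_le_left 1 δ
      have := min_le_right 1 δ
      have : 0 < min 1 δ := by positivity
      have := C.coe_nonneg
      nlinarith
  have hsmall : ∀ t ∈ Ioo 0 τ, Q.eval t = ∫ x in closedBall 0 R, (1 - c * ‖x‖ ^ 2) ^ k ∂μ := by
    rintro t ⟨ht0, htτ⟩
    have htC : t * C ≤ τ * C := by gcongr
    have hinj := injective_add_smul_of_lipschitz hC ht0.le (htC.trans_lt hτ1)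
    rw [← hQ]
    conv_rhs => rw [← image_closedBall_add_smul_of_lipschitz hC hR ht0.le (htC.trans_lt hτ1)]
    rw [integral_image_eq_integral_abs_det_fderiv_smul μ measurableSet_closedBall
      (f' := fun x => ContinuousLinearMap.id ℝ E + t • fderiv ℝ g x) (fun x _ => ?_) hinj.injOn]
    · refine setIntegral_congr_fun measurableSet_closedBall fun x _ => ?_
      simp only [smul_eq_mul]
      rw [abs_of_pos (hdet _ ?_)]
      rw [norm_smul, Real.norm_of_nonneg ht0.le]
      exact (mul_le_mul_of_nonneg_left (hbound x) ht0.le).trans_lt (htC.trans_lt hτ2)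
    · exact ((hasFDerivAt_id x).add
        (((hg.differentiable one_ne_zero) x).hasFDerivAt.const_smul t)).hasFDerivWithinAt
  -- a polynomial that is constant on an interval is constant
  have hconst : Q = Polynomial.C (∫ x in closedBall 0 R, (1 - c * ‖x‖ ^ 2) ^ k ∂μ) :=
    Polynomial.eq_of_infinite_eval_eq _ _ ((Ioo_infinite hτ).mono fun t ht => by
      simp [hsmall t ht])
  have h1 := hQ 1
  rw [hconst] at h1
  simpa using h1

/-- Otherwise `1 - c ‖·‖ ^ 2` is at most `q` on the image of the ball but exceeds some `p > q` near
the origin, and the change of variables formula for its `k`-th power fails for large `k`. -/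
lemma exists_add_eq_zero_of_contDiff {g : E → E} (hg : ContDiff ℝ 1 g)
    (hgc : HasCompactSupport g) : ∃ x, x + g x = 0 := by
  by_contra! hne
  let μ : Measure E := Measure.addHaar
  obtain ⟨R, hR0, hR⟩ : ∃ R : ℝ, 0 < R ∧ ∀ x, R < ‖x‖ → g x = 0 := by
    obtain ⟨R, hR⟩ := hgc.isBounded.subset_closedBall (0 : E)
    refine ⟨max R 1, by positivity, fun x hx => image_eq_zero_of_notMem_tsupport fun h => ?_⟩
    have := hR h
    simp only [mem_closedBall, dist_zero_right] at this
    exact absurd (le_max_left R 1) (not_le.2 (hx.trans_le this))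
  have hfc : Continuous fun x => x + g x := continuous_id.add hg.continuous
  obtain ⟨x₀, -, hx₀⟩ := (isCompact_closedBall (0 : E) R).exists_isMinOn
    ⟨0, by simpa using hR0.le⟩ hfc.norm.continuousOn
  obtain ⟨δ, hδ, hδR, hδf⟩ : ∃ δ : ℝ, 0 < δ ∧ δ ≤ R ∧ ∀ x ∈ closedBall (0 : E) R,
      δ ≤ ‖x + g x‖ :=
    ⟨min R ‖x₀ + g x₀‖, lt_min hR0 (norm_pos_iff.2 (hne x₀)), min_le_left _ _, fun x hx =>
      (min_le_right _ _).trans (hx₀ hx)⟩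
  obtain ⟨N, hN⟩ := (isCompact_closedBall (0 : E) R).exists_bound_of_continuousOn
    hfc.continuousOn
  -- `c` is so small that `1 - c ‖·‖ ^ 2` is nonnegative on the ball and on its image
  obtain ⟨c, hc, hcR, hcN⟩ : ∃ c : ℝ, 0 < c ∧ c * R ^ 2 ≤ 1 ∧ c * N ^ 2 ≤ 1 := by
    refine ⟨1 / (R ^ 2 + N ^ 2), by positivity, ?_, ?_⟩ <;>
    · rw [div_mul_eq_mul_div, div_le_one (by positivity)]
      nlinarith [sq_nonneg N, sq_nonneg R]
  have hδ1 : c * δ ^ 2 ≤ 1 := le_trans (by gcongr) hcR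
  set q := 1 - c * δ ^ 2 with hq
  set p := 1 - c * (δ / 2) ^ 2 with hp
  have hcδ : 0 < c * δ ^ 2 := by positivity
  have hq0 : 0 ≤ q := by linarith
  have hqp : q < p := by rw [hq, hp]; nlinarith
  have hp0 : 0 < p := hq0.trans_lt hqp
  have hdg : Continuous (fderiv ℝ g) := hg.continuous_fderiv one_ne_zero
  have hdetc : Continuous fun x => (ContinuousLinearMap.id ℝ E + fderiv ℝ g x).det :=
    ContinuousLinearMap.continuous_det.comp (by fun_prop)
  set A := ∫ x in closedBall 0 R, |(ContinuousLinearMap.id ℝ E + fderiv ℝ g x).det| ∂μ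
  set v := μ.real (closedBall (0 : E) (δ / 2))
  have hv : 0 < v := ENNReal.toReal_pos (measure_closedBall_pos μ _ (by positivity)).ne'
    measure_closedBall_lt_top.ne
  have hkey : ∀ k : ℕ, v * p ^ k ≤ A * q ^ k := by
    intro k
    have hcf : Continuous fun x : E => (1 - c * ‖x‖ ^ 2) ^ k := by fun_prop
    calc v * p ^ k = ∫ _ in closedBall (0 : E) (δ / 2), p ^ k ∂μ := by simp [v]
      _ ≤ ∫ x in closedBall (0 : E) (δ / 2), (1 - c * ‖x‖ ^ 2) ^ k ∂μ := by
          refine setIntegral_mono_on ?_ ?_ measurableSet_closedBall fun x hx => ?_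
          · exact continuousOn_const.integrableOn_compact (isCompact_closedBall _ _)
          · exact hcf.continuousOn.integrableOn_compact (isCompact_closedBall _ _)
          · have : ‖x‖ ≤ δ / 2 := by simpa using hx
            rw [hp]
            gcongr
      _ ≤ ∫ x in closedBall (0 : E) R, (1 - c * ‖x‖ ^ 2) ^ k ∂μ := by
          refine setIntegral_mono_set
            (hcf.continuousOn.integrableOn_compact (isCompact_closedBall _ _)) ?_ ?_
          · filter_upwards [ae_restrict_mem measurableSet_closedBall] with x hx
            have h1 : ‖x‖ ≤ R := by simpa using hx
            have h2 : c * ‖x‖ ^ 2 ≤ c * R ^ 2 := by gcongr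
            exact pow_nonneg (by linarith) _
          · exact (closedBall_subset_closedBall (by linarith)).eventuallyLE
      _ = ∫ x in closedBall 0 R, (ContinuousLinearMap.id ℝ E + fderiv ℝ g x).det *
            (1 - c * ‖x + g x‖ ^ 2) ^ k ∂μ := (setIntegral_det_mul_pow_eq μ hg hgc hR c k).symm
      _ ≤ ∫ x in closedBall 0 R, |(ContinuousLinearMap.id ℝ E + fderiv ℝ g x).det| * q ^ k ∂μ := by
          refine setIntegral_mono_on ?_ ?_ measurableSet_closedBall fun x hx => ?_
          · refine ContinuousOn.integrableOn_compact (isCompact_closedBall _ _)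
              (Continuous.continuousOn ?_)
            exact hdetc.mul (by fun_prop)
          · exact ((hdetc.abs.mul continuous_const).continuousOn).integrableOn_compact
              (isCompact_closedBall _ _)
          · have h1 : ‖x + g x‖ ≤ N := hN x hx
            have h2 : c * ‖x + g x‖ ^ 2 ≤ c * N ^ 2 := by gcongr
            have h3 : δ ≤ ‖x + g x‖ := hδf x hx
            have h4 : 0 ≤ 1 - c * ‖x + g x‖ ^ 2 := by linarith
            calc _ ≤ |(ContinuousLinearMap.id ℝ E + fderiv ℝ g x).det| *
                  (1 - c * ‖x + g x‖ ^ 2) ^ k := by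
                    gcongr
                    exact le_abs_self _
              _ ≤ _ := by rw [hq]; gcongr
      _ = A * q ^ k := by rw [integral_mul_const]
  have hlim : Tendsto (fun k : ℕ => A * (q / p) ^ k) atTop (𝓝 (A * 0)) :=
    (tendsto_pow_atTop_nhds_zero_of_lt_one (by positivity) ((div_lt_one hp0).2 hqp)).const_mul A
  rw [mul_zero] at hlim
  refine absurd (ge_of_tendsto' hlim fun k => ?_) (not_le.2 hv)
  rw [div_pow, ← mul_div_assoc, le_div_iff₀ (by positivity)]
  exact hkey k

end Smooth

lemma exists_add_eq_zero_of_continuous {E : Type*} [NormedAddCommGroup E] [InnerProductSpace ℝ E]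
    [FiniteDimensional ℝ E] {g : E → E} (hg : Continuous g) (hgc : HasCompactSupport g) :
    ∃ x, x + g x = 0 := by
  borelize E
  by_contra! hne
  obtain ⟨R, hR⟩ := hgc.isBounded.subset_closedBall (0 : E)
  obtain ⟨ε, hε, hεf⟩ := (isCompact_closedBall (0 : E) R).exists_forall_le'
    (continuous_id.add hg).norm.continuousOn (a := 0) fun x _ => norm_pos_iff.2 (hne x)
  obtain ⟨g', hg', hdist, hsupp⟩ := hg.exists_contDiff_approx 1 (ε := fun _ => ε)
    continuous_const fun _ => hε
  have hgc' : HasCompactSupport g' := hgc.mono hsupp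
  obtain ⟨x, hx⟩ := exists_add_eq_zero_of_contDiff hg' hgc'
  by_cases hxR : x ∈ closedBall 0 R
  · have h1 : ε ≤ ‖x + g x‖ := hεf x hxR
    have h2 := hdist x
    rw [dist_comm, dist_eq_norm] at h2
    have h3 : x + g x = g x - g' x := by
      rw [eq_sub_iff_add_eq, add_right_comm, hx, zero_add]
    rw [h3] at h1
    exact absurd h2 (not_lt.2 h1)
  · have h1 : g x = 0 := image_eq_zero_of_notMem_tsupport fun h => hxR (hR h)
    have h2 : g' x = 0 := by
      by_contra h
      exact hsupp h h1
    rw [h2, add_zero] at hx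
    exact hne x (by rw [h1, hx, add_zero])

/-- The inverse `G` of `f` is approximated by a smooth map `P`. If points `c` outside the image lay
arbitrarily close to `f 0`, then `P`, precomposed with the radial push away from `c`, would have no
zero on the image, although it stays close to `G` there. -/
lemma image_closedBall_mem_nhds {E : Type*} [NormedAddCommGroup E] [InnerProductSpace ℝ E]
    [FiniteDimensional ℝ E] {f : E → E} (hf : ContinuousOn f (closedBall 0 1))
    (hinj : InjOn f (closedBall 0 1)) : f '' closedBall 0 1 ∈ 𝓝 (f 0) := by
  borelize E
  by_contra hnhds
  have : CompactSpace (closedBall (0 : E) 1) :=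
    isCompact_iff_compactSpace.1 (isCompact_closedBall _ _)
  have hKc : IsCompact (f '' closedBall 0 1) := (isCompact_closedBall _ _).image_of_continuousOn hf
  have : TietzeExtension E := TietzeExtension.of_tvs ℝ
  have hcl : IsClosedEmbedding fun x : closedBall (0 : E) 1 => f x :=
    (continuousOn_iff_continuous_domRestrict.1 hf).isClosedEmbedding (injOn_iff_injective.1 hinj)
  obtain ⟨G, hG⟩ := ContinuousMap.exists_extension' hcl ⟨Subtype.val, continuous_subtype_val⟩
  have hGf : ∀ x ∈ closedBall (0 : E) 1, G (f x) = x := fun x hx => congrFun hG ⟨x, hx⟩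
  have h0 : (0 : E) ∈ closedBall 0 1 := by simp
  obtain ⟨δ, hδ, hGδ⟩ : ∃ δ > 0, ∀ y, dist y (f 0) < 3 * δ → ‖G y‖ < 1 / 10 := by
    obtain ⟨δ, hδ, h⟩ := Metric.continuousAt_iff.1 G.continuous.continuousAt (1 / 10)
      (by norm_num : (0 : ℝ) < 1 / 10)
    refine ⟨δ / 3, by positivity, fun y hy => ?_⟩
    simpa [hGf 0 h0] using h (show dist y (f 0) < δ by linarith)
  obtain ⟨c, hcδ, hc⟩ : ∃ c, dist c (f 0) < δ ∧ c ∉ f '' closedBall 0 1 := by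
    by_contra! h
    exact hnhds (Filter.mem_of_superset (ball_mem_nhds _ hδ) h)
  have hG1 : ∀ x ∈ closedBall (0 : E) 1, δ ≤ ‖f x - c‖ → G (f x) ≠ 0 := by
    intro x hx hxc hGx
    rw [hGf x hx] at hGx
    rw [hGx, ← dist_eq_norm, dist_comm] at hxc
    exact absurd hcδ (not_lt.2 hxc)
  obtain ⟨ε, hε, hε1, hGε⟩ : ∃ ε > 0, ε ≤ 1 / 10 ∧
      ∀ x ∈ closedBall (0 : E) 1, δ ≤ ‖f x - c‖ → ε ≤ ‖G (f x)‖ := by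
    have hS : IsCompact (f '' closedBall 0 1 ∩ {y | δ ≤ ‖y - c‖}) :=
      hKc.inter_right (isClosed_le continuous_const (by fun_prop))
    obtain ⟨ε, hε, h⟩ := hS.exists_forall_le' G.continuous.norm.continuousOn (a := 0) (by
      rintro _ ⟨⟨x, hx, rfl⟩, hxc⟩
      exact norm_pos_iff.2 (hG1 x hx hxc))
    exact ⟨min ε (1 / 10), lt_min hε (by norm_num), min_le_right _ _, fun x hx hxc =>
      (min_le_left _ _).trans (h _ ⟨mem_image_of_mem f hx, hxc⟩)⟩
  -- the smooth approximation; its image of the sphere around `c` is a null set, so that a small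
  -- translation makes it nonzero there
  obtain ⟨P, hP, hPsphere, hPG⟩ : ∃ P : E → E, Continuous P ∧
      (∀ y ∈ sphere c δ, P y ≠ 0) ∧ ∀ y, ‖P y - G y‖ < ε := by
    obtain ⟨P, hP, hPG, -⟩ := G.continuous.exists_contDiff_approx 1 (ε := fun _ => ε / 2)
      continuous_const fun _ => by positivity
    have hnull : Measure.addHaar (P '' sphere c δ) = 0 :=
      addHaar_image_eq_zero_of_differentiableOn_of_addHaar_eq_zero _
        (hP.differentiable one_ne_zero).differentiableOn
        (Measure.addHaar_sphere_of_ne_zero _ _ hδ.ne')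
    obtain ⟨w, hw, hwP⟩ : ∃ w ∈ ball (0 : E) (ε / 2), w ∉ P '' sphere c δ := by
      by_contra! h
      exact (measure_ball_pos Measure.addHaar (0 : E) (by positivity : 0 < ε / 2)).ne'
        (measure_mono_null h hnull)
    refine ⟨fun y => P y - w, hP.continuous.sub continuous_const,
      fun y hy h => hwP ⟨y, hy, sub_eq_zero.1 h⟩, fun y => ?_⟩
    have h1 : ‖P y - G y‖ < ε / 2 := by simpa [dist_eq_norm] using hPG y
    have h2 : ‖w‖ < ε / 2 := by simpa using hw
    calc ‖P y - w - G y‖ = ‖(P y - G y) - w‖ := by congr 1; abel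
      _ ≤ ‖P y - G y‖ + ‖w‖ := norm_sub_le _ _
      _ < ε := by linarith
  -- `Φ` pushes the ball around `c` out to its boundary sphere
  let Φ : E → E := fun y => c + max (δ / ‖y - c‖) 1 • (y - c)
  have hfc : ∀ x ∈ closedBall (0 : E) 1, 0 < ‖f x - c‖ := fun x hx =>
    norm_pos_iff.2 (sub_ne_zero.2 fun h => hc ⟨x, hx, h⟩)
  have hΦ_far : ∀ y, 0 < ‖y - c‖ → δ ≤ ‖y - c‖ → Φ y = y := by
    intro y hy h
    simp [Φ, max_eq_right ((div_le_one hy).2 h)]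
  have hΦ_near : ∀ y, 0 < ‖y - c‖ → ‖y - c‖ ≤ δ → ‖Φ y - c‖ = δ := by
    intro y hy h
    simp only [Φ, max_eq_left ((one_le_div hy).2 h), add_sub_cancel_left, norm_smul, norm_div,
      norm_norm, Real.norm_of_nonneg hδ.le]
    exact div_mul_cancel₀ _ hy.ne'
  have hPΦ : ∀ x ∈ closedBall (0 : E) 1, P (Φ (f x)) ≠ 0 := by
    intro x hx h
    rcases le_total δ ‖f x - c‖ with hle | hle
    · rw [hΦ_far _ (hfc x hx) hle] at h
      have h1 := hPG (f x)
      rw [h, zero_sub, norm_neg] at h1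
      exact absurd h1 (not_lt.2 (hGε x hx hle))
    · exact hPsphere _ (by rw [mem_sphere, dist_eq_norm, hΦ_near _ (hfc x hx) hle]) h
  have hclose : ∀ x ∈ closedBall (0 : E) 1, ‖P (Φ (f x)) - x‖ ≤ 3 / 10 := by
    intro x hx
    rcases le_total δ ‖f x - c‖ with hle | hle
    · rw [hΦ_far _ (hfc x hx) hle]
      nth_rewrite 2 [← hGf x hx]
      linarith [hPG (f x)]
    · have h1 : ‖G (f x)‖ < 1 / 10 := hGδ _ (by
        have := dist_triangle (f x) c (f 0)
        rw [dist_eq_norm (f x) c] at this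
        linarith)
      have h2 : ‖G (Φ (f x))‖ < 1 / 10 := hGδ _ (by
        have := dist_triangle (Φ (f x)) c (f 0)
        rw [dist_eq_norm _ c, hΦ_near _ (hfc x hx) hle] at this
        linarith)
      rw [hGf x hx] at h1
      have h3 := hPG (Φ (f x))
      calc ‖P (Φ (f x)) - x‖ = ‖(P (Φ (f x)) - G (Φ (f x))) + G (Φ (f x)) - x‖ := by congr 1; abel
        _ ≤ ‖(P (Φ (f x)) - G (Φ (f x))) + G (Φ (f x))‖ + ‖x‖ := norm_sub_le _ _
        _ ≤ ‖P (Φ (f x)) - G (Φ (f x))‖ + ‖G (Φ (f x))‖ + ‖x‖ := by gcongr; exact norm_add_le _ _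
        _ ≤ 3 / 10 := by linarith
  -- `ρ` retracts the space onto the unit ball; `χ` cuts off outside of it, and equals one for
  -- `‖x‖ ≤ 1 / 2`, hence at every solution of `x + g x = 0` below, where `‖x‖ ≤ 3 / 10`
  let ρ : E → E := fun x => (max 1 ‖x‖)⁻¹ • x
  let χ : E → ℝ := fun x => max 0 (min 1 (2 - 2 * ‖x‖))
  have hpos : ∀ x : E, 0 < max 1 ‖x‖ := fun x => lt_max_of_lt_left one_pos
  have hρmem : ∀ x, ρ x ∈ closedBall (0 : E) 1 := by
    intro x
    simp only [ρ, mem_closedBall, dist_zero_right, norm_smul, norm_inv,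
      Real.norm_of_nonneg (hpos x).le]
    rw [inv_mul_le_one₀ (hpos x)]
    exact le_max_right _ _
  have hρc : Continuous ρ :=
    ((continuous_const.max continuous_norm).inv₀ fun x => (hpos x).ne').smul continuous_id
  have hχc : Continuous χ := by fun_prop
  have hfρ : Continuous fun x => f (ρ x) := hf.comp_continuous hρc hρmem
  have hΦρ : Continuous fun x => Φ (f (ρ x)) :=
    continuous_const.add ((((continuous_const.div (hfρ.sub continuous_const).norm
      fun x => (hfc _ (hρmem x)).ne').max continuous_const)).smul (hfρ.sub continuous_const))
  let g : E → E := fun x => χ x • (P (Φ (f (ρ x))) - ρ x)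
  have hgc : Continuous g := hχc.smul ((hP.comp hΦρ).sub hρc)
  have hgs : HasCompactSupport g := by
    refine HasCompactSupport.of_support_subset_isCompact (isCompact_closedBall (0 : E) 1)
      fun x hx => ?_
    by_contra hx1
    have hx2 : 1 < ‖x‖ := by simpa using hx1
    refine hx ?_
    have : χ x = 0 := max_eq_left ((min_le_right _ _).trans (by linarith))
    simp [g, this]
  obtain ⟨x, hx⟩ := exists_add_eq_zero_of_continuous hgc hgs
  have hχ0 : 0 ≤ χ x := le_max_left _ _
  have hχ1 : χ x ≤ 1 := max_le zero_le_one (min_le_left _ _)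
  have hxs : ‖x‖ ≤ 3 / 10 := by
    rw [eq_neg_of_add_eq_zero_left hx, norm_neg, norm_smul, Real.norm_of_nonneg hχ0]
    have := hclose _ (hρmem x)
    nlinarith [norm_nonneg (P (Φ (f (ρ x))) - ρ x)]
  have hχx : χ x = 1 := by
    simp only [χ]
    rw [min_eq_left (by linarith), max_eq_right zero_le_one]
  have hρx : ρ x = x := by
    simp only [ρ]
    rw [max_eq_left (by linarith), inv_one, one_smul]
  simp only [g, hχx, hρx, one_smul, add_sub_cancel] at hx
  exact hPΦ x (by simpa using hxs.trans (by norm_num)) hx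

/-- **Invariance of domain**: a continuous injective map between finite-dimensional real vector
spaces of equal dimension maps neighbourhoods to neighbourhoods. -/
theorem image_mem_nhds_of_continuousOn_of_injOn {E F : Type*}
    [NormedAddCommGroup E] [NormedSpace ℝ E] [FiniteDimensional ℝ E]
    [NormedAddCommGroup F] [NormedSpace ℝ F] [FiniteDimensional ℝ F]
    (hdim : Module.finrank ℝ E = Module.finrank ℝ F) {f : E → F} {s : Set E} {a : E}
    (hs : s ∈ 𝓝 a) (hf : ContinuousOn f s) (hinj : InjOn f s) : f '' s ∈ 𝓝 (f a) := by
  let X := EuclideanSpace ℝ (Fin (Module.finrank ℝ E))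
  let e : X ≃L[ℝ] E := ContinuousLinearEquiv.ofFinrankEq (by simp [X])
  let e' : F ≃L[ℝ] X := ContinuousLinearEquiv.ofFinrankEq (by simp [X, hdim])
  obtain ⟨r, hr, hrs⟩ : ∃ r > 0, closedBall (0 : X) r ⊆ (fun x => a + e x) ⁻¹' s := by
    have hc : Continuous fun x : X => a + e x := by fun_prop
    exact Metric.nhds_basis_closedBall.mem_iff.1 (hc.continuousAt.preimage_mem_nhds (by simpa))
  let φ : X → E := fun x => a + e (r • x)
  have hφs : MapsTo φ (closedBall 0 1) s := by
    intro x hx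
    refine hrs ?_
    have : ‖x‖ ≤ 1 := by simpa using hx
    simp only [mem_closedBall, dist_zero_right, norm_smul, Real.norm_of_nonneg hr.le]
    nlinarith
  have hφc : Continuous φ := by fun_prop
  have hφi : Function.Injective φ := fun x y h =>
    smul_right_injective X hr.ne' (e.injective (add_left_cancel h))
  have h1 : (fun x => e' (f (φ x))) '' closedBall 0 1 ∈ 𝓝 (e' (f (φ 0))) :=
    image_closedBall_mem_nhds
      (e'.continuous.comp_continuousOn (hf.comp hφc.continuousOn hφs))
      (e'.injective.comp_injOn (hinj.comp hφi.injOn hφs))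
  have h2 : φ 0 = a := by simp [φ]
  rw [h2] at h1
  refine Filter.mem_of_superset (e'.continuous.continuousAt.preimage_mem_nhds h1) ?_
  rintro y ⟨x, hx, hxy⟩
  exact ⟨φ x, hφs hx, e'.injective hxy⟩

end InvarianceOfDomain

/-! ### Balls in the skeleton of a simplex -/

section SimplicialBall

open MeasureTheory Metric Set Filter Topology

variable {V : Type*}

lemma isOpen_openStar (s : Finset V) : IsOpen {w : V → ℝ | ∀ v ∈ s, 0 < w v} := by
  have : {w : V → ℝ | ∀ v ∈ s, 0 < w v} = ⋂ v ∈ s, {w | 0 < w v} := by ext; simp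
  rw [this]
  exact isOpen_biInter_finset fun v _ => isOpen_lt continuous_const (continuous_apply v)

/-- Two `d`-simplices glued along the `(d-1)`-simplex `s`, parametrized near a point `w` of `s` by
the weights of the vertices of `s`; the sum of the displacements `u` measures, with sign, how far
the point is from `s`. The term subtracted on `s` makes the weights add up to one. -/
noncomputable def gluedSimplices [DecidableEq V] (s : Finset V) (v₁ v₂ : V) (w : V → ℝ)
    (u : s → ℝ) : V → ℝ := fun v =>
  if hv : v ∈ s then w v + u ⟨v, hv⟩ - (∑ i, u i + |∑ i, u i|) / s.card
  else if v = v₁ then max (∑ i, u i) 0 else if v = v₂ then max (-∑ i, u i) 0 else 0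

lemma continuous_gluedSimplices [DecidableEq V] (s : Finset V) (v₁ v₂ : V) (w : V → ℝ) :
    Continuous (gluedSimplices s v₁ v₂ w) := by
  refine continuous_pi fun v => ?_
  unfold gluedSimplices
  split_ifs <;> fun_prop

lemma gluedSimplices_injective [DecidableEq V] {s : Finset V} {v₁ v₂ : V}
    (hv₁ : v₁ ∉ s) (hv₂ : v₂ ∉ s) (hne : v₁ ≠ v₂) (w : V → ℝ) :
    Function.Injective (gluedSimplices s v₁ v₂ w) := by
  intro u u' huu
  have h1 : max (∑ i, u i) 0 = max (∑ i, u' i) 0 := by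
    simpa [gluedSimplices, hv₁] using congrFun huu v₁
  have h2 : max (-∑ i, u i) 0 = max (-∑ i, u' i) 0 := by
    simpa [gluedSimplices, hv₂, hne.symm] using congrFun huu v₂
  have h3 : ∑ i, u i = ∑ i, u' i := by grind
  ext ⟨v, hv⟩
  have := congrFun huu v
  simp only [gluedSimplices, hv, dif_pos, h3] at this
  linarith

variable [Fintype V]

/-- The closed simplex with vertex set `t`, in barycentric coordinates. -/
def stdFace (t : Finset V) : Set (V → ℝ) :=
  {w | (∀ v, 0 ≤ w v) ∧ ∑ v, w v = 1 ∧ ∀ v ∉ t, w v = 0}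

lemma stdFace_mono {s t : Finset V} (h : s ⊆ t) : stdFace s ⊆ stdFace t :=
  fun _ hw => ⟨hw.1, hw.2.1, fun v hv => hw.2.2 v fun h' => hv (h h')⟩

lemma convex_stdFace (t : Finset V) : Convex ℝ (stdFace t) := by
  intro w hw w' hw' a b ha hb hab
  refine ⟨fun v => ?_, ?_, fun v hv => ?_⟩
  · simp only [Pi.add_apply, Pi.smul_apply, smul_eq_mul]
    exact add_nonneg (mul_nonneg ha (hw.1 v)) (mul_nonneg hb (hw'.1 v))
  · simp [Finset.sum_add_distrib, ← Finset.mul_sum, hw.2.1, hw'.2.1, hab]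
  · simp [hw.2.2 v hv, hw'.2.2 v hv]

lemma sum_eq_one_of_mem_stdFace {t : Finset V} {w : V → ℝ} (hw : w ∈ stdFace t) :
    ∑ v ∈ t, w v = 1 := by
  rw [← hw.2.1]
  exact Finset.sum_subset (Finset.subset_univ t) fun v _ hv => hw.2.2 v hv

/-- A point of a simplex is determined by all but one of its barycentric coordinates. -/
lemma eq_of_eqOn_of_mem_stdFace {s t : Finset V} {w w' : V → ℝ} (hw : w ∈ stdFace t)
    (hw' : w' ∈ stdFace t) (h : ∀ v ∈ s, w v = w' v)
    (hst : ∀ v ∈ t, v ∉ s → ∀ v' ∈ t, v' ∉ s → v = v') : w = w' := by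
  classical
  ext v
  by_cases hvt : v ∈ t
  · by_cases hvs : v ∈ s
    · exact h v hvs
    · have h1 := Finset.add_sum_erase t w hvt
      have h2 := Finset.add_sum_erase t w' hvt
      rw [sum_eq_one_of_mem_stdFace hw] at h1
      rw [sum_eq_one_of_mem_stdFace hw'] at h2
      have h3 : ∑ x ∈ t.erase v, w x = ∑ x ∈ t.erase v, w' x := by
        refine Finset.sum_congr rfl fun x hx => h x ?_
        by_contra hxs
        exact (Finset.ne_of_mem_erase hx) (hst x (Finset.mem_of_mem_erase hx) hxs v hvt hvs)
      linarith
  · rw [hw.2.2 v hvt, hw'.2.2 v hvt]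

lemma sum_gluedSimplices [DecidableEq V] {s : Finset V} (hs : s.Nonempty) {v₁ v₂ : V}
    (hv₁ : v₁ ∉ s) (hv₂ : v₂ ∉ s) (hne : v₁ ≠ v₂) {w : V → ℝ} (hw : w ∈ stdFace s) (u : s → ℝ) :
    ∑ v, gluedSimplices s v₁ v₂ w u v = 1 := by
  have hcard : (s.card : ℝ) ≠ 0 := by exact_mod_cast hs.card_pos.ne'
  have h1 : ∑ v ∈ s, gluedSimplices s v₁ v₂ w u v = 1 - |∑ i, u i| := by
    rw [← Finset.sum_attach]
    have : ∀ v : s, gluedSimplices s v₁ v₂ w u v =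
        w v + u v - (∑ i, u i + |∑ i, u i|) / s.card := by
      intro v; simp [gluedSimplices]
    simp_rw [this, Finset.sum_sub_distrib, Finset.sum_add_distrib]
    rw [Finset.sum_attach s w, sum_eq_one_of_mem_stdFace hw, Finset.sum_const, Finset.card_attach,
      nsmul_eq_mul, mul_div_cancel₀ _ hcard, Finset.univ_eq_attach]
    ring
  have h2 : ∑ v, gluedSimplices s v₁ v₂ w u v =
      ∑ v ∈ insert v₁ (insert v₂ s), gluedSimplices s v₁ v₂ w u v := by
    refine (Finset.sum_subset (Finset.subset_univ _) fun v _ hv => ?_).symm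
    simp only [Finset.mem_insert, not_or] at hv
    simp [gluedSimplices, hv]
  rw [h2, Finset.sum_insert (by simp [hv₁, hne]), Finset.sum_insert hv₂, h1]
  simp only [gluedSimplices, hv₁, hv₂, hne.symm, dif_neg, not_false_eq_true, if_true, if_false]
  rcases le_total 0 (∑ i, u i) with h | h
  · rw [max_eq_left h, max_eq_right (by linarith), abs_of_nonneg h]; ring
  · rw [max_eq_right h, max_eq_left (by linarith), abs_of_nonpos h]; ring

variable {X : Type*} [NormedAddCommGroup X]

lemma mem_closedBall_of_norm_lt {x : X} (hx : ‖x‖ < 1) : x ∈ closedBall (0 : X) 1 := by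
  simpa using hx.le

variable [NormedSpace ℝ X]

/-- A parametrized `d`-ball in the `d`-skeleton of the standard simplex on `V`, whose boundary
sphere lies in the `(d-1)`-skeleton. -/
structure IsSimplicialBall (d : ℕ) (h : X → V → ℝ) : Prop where
  finrank_eq : Module.finrank ℝ X = d
  continuousOn : ContinuousOn h (closedBall 0 1)
  injOn : InjOn h (closedBall 0 1)
  skeleton : ∀ x ∈ closedBall (0 : X) 1, ∃ t : Finset V, t.card ≤ d + 1 ∧ h x ∈ stdFace t
  boundary : ∀ x : X, ‖x‖ = 1 → ∃ t : Finset V, t.card ≤ d ∧ h x ∈ stdFace t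

lemma subset_of_pos_of_mem_stdFace {s t : Finset V} {w : V → ℝ} (hw : w ∈ stdFace t)
    (hs : ∀ v ∈ s, 0 < w v) : s ⊆ t := by
  intro v hv
  by_contra hvt
  exact (hs v hv).ne' (hw.2.2 v hvt)

lemma continuousOn_invFunOn_of_isCompact {A B : Type*} [TopologicalSpace A] [TopologicalSpace B]
    [T2Space B] [Nonempty A] {f : A → B} {K : Set A} (hK : IsCompact K) (hf : ContinuousOn f K)
    (hinj : InjOn f K) : ContinuousOn (Function.invFunOn f K) (f '' K) := by
  rw [continuousOn_iff_isClosed]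
  intro C hC
  refine ⟨f '' (K ∩ C), ((hK.inter_right hC).image_of_continuousOn
    (hf.mono inter_subset_left)).isClosed, ?_⟩
  ext y
  constructor
  · rintro ⟨h, x, hx, rfl⟩
    rw [mem_preimage, hinj.leftInvOn_invFunOn hx] at h
    exact ⟨⟨x, ⟨hx, h⟩, rfl⟩, x, hx, rfl⟩
  · rintro ⟨⟨x, ⟨hx, hxC⟩, rfl⟩, -⟩
    refine ⟨?_, x, hx, rfl⟩
    rw [mem_preimage, hinj.leftInvOn_invFunOn hx]
    exact hxC

namespace IsSimplicialBall

variable {d : ℕ} {h : X → V → ℝ}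

lemma norm_lt_one (H : IsSimplicialBall d h) {x : X} (hx : x ∈ closedBall (0 : X) 1)
    {t : Finset V} (ht : t.card = d + 1) (hpos : ∀ v ∈ t, 0 < h x v) : ‖x‖ < 1 := by
  refine lt_of_le_of_ne (by simpa using hx) fun hx1 => ?_
  obtain ⟨t', ht', hxt'⟩ := H.boundary x hx1
  have := Finset.card_le_card (subset_of_pos_of_mem_stdFace hxt' hpos)
  omega

lemma eventually_openStar (H : IsSimplicialBall d h) {x : X} (hx : ‖x‖ < 1) {s : Finset V}
    (hpos : ∀ v ∈ s, 0 < h x v) : {y | ‖y‖ < 1 ∧ ∀ v ∈ s, 0 < h y v} ∈ 𝓝 x := by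
  have h1 : ball (0 : X) 1 ∈ 𝓝 x := isOpen_ball.mem_nhds (by simpa using hx)
  have h2 : ContinuousAt h x :=
    H.continuousOn.continuousAt (Filter.mem_of_superset h1 ball_subset_closedBall)
  filter_upwards [h1, h2.preimage_mem_nhds ((isOpen_openStar s).mem_nhds hpos)] with y hy hy'
  exact ⟨by simpa using hy, hy'⟩

variable [FiniteDimensional ℝ X]

/-- Invariance of domain, in the `d` coordinates given by the vertices of `s`. -/
lemma image_coordinates_mem_nhds (H : IsSimplicialBall d h) {x : X} {s : Finset V}
    (hs : s.card = d) {N : Set X} (hN : N ∈ 𝓝 x) (hNb : N ⊆ closedBall 0 1)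
    (hNinj : ∀ y ∈ N, ∀ z ∈ N, (∀ v ∈ s, h y v = h z v) → h y = h z) :
    (fun y (v : s) => h y v) '' N ∈ 𝓝 (fun v : s => h x v) := by
  refine image_mem_nhds_of_continuousOn_of_injOn (f := fun y (v : s) => h y v)
    (by simp [H.finrank_eq, hs]) hN ?_ ?_
  · exact continuousOn_pi.2 fun v =>
      (continuous_apply (v : V)).comp_continuousOn (H.continuousOn.mono hNb)
  · intro y hy z hz hyz
    exact H.injOn (hNb hy) (hNb hz) (hNinj y hy z hz fun v hv => congrFun hyz ⟨v, hv⟩)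

/-- The ball contains every `d`-simplex of which it contains an interior point: by invariance of
domain its trace on the open simplex is open as well as closed. -/
lemma stdFace_subset (H : IsSimplicialBall d h) {x : X} (hx : x ∈ closedBall (0 : X) 1)
    {t : Finset V} (ht : t.card = d + 1) (hxt : h x ∈ stdFace t) (hpos : ∀ v ∈ t, 0 < h x v) :
    stdFace t ⊆ h '' closedBall 0 1 := by
  classical
  -- the trace on the open simplex is open
  have hopen : ∀ y ∈ closedBall (0 : X) 1, (∀ v ∈ t, 0 < h y v) →
      ∃ N ∈ 𝓝 (h y), ∀ w ∈ N, w ∈ stdFace t → w ∈ h '' closedBall 0 1 := by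
    intro y hy hypos
    obtain ⟨v₀, hv₀⟩ : t.Nonempty := Finset.card_pos.1 (by omega)
    have hy1 := H.norm_lt_one hy ht hypos
    have hface : ∀ z, ‖z‖ < 1 ∧ (∀ v ∈ t, 0 < h z v) → h z ∈ stdFace t := by
      rintro z ⟨hz, hzpos⟩
      obtain ⟨t', ht', hzt'⟩ := H.skeleton z (mem_closedBall_of_norm_lt hz)
      rwa [Finset.eq_of_subset_of_card_le (subset_of_pos_of_mem_stdFace hzt' hzpos) (by omega)]
    have hone : ∀ v ∈ t, v ∉ t.erase v₀ → ∀ v' ∈ t, v' ∉ t.erase v₀ → v = v' := by grind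
    have := H.image_coordinates_mem_nhds (s := t.erase v₀)
      (by rw [Finset.card_erase_of_mem hv₀, ht]; rfl) (H.eventually_openStar hy1 hypos)
      (fun z hz => mem_closedBall_of_norm_lt hz.1)
      fun z hz z' hz' heq => eq_of_eqOn_of_mem_stdFace (hface z hz) (hface z' hz') heq hone
    have hcont : Continuous fun (w : V → ℝ) (v : t.erase v₀) => w v := by fun_prop
    refine ⟨_, hcont.continuousAt.preimage_mem_nhds this, ?_⟩
    rintro w ⟨z, hz, hzw⟩ hw
    refine ⟨z, mem_closedBall_of_norm_lt hz.1, ?_⟩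
    exact eq_of_eqOn_of_mem_stdFace (hface z hz) hw
      (fun v hv => congrFun hzw ⟨v, hv⟩) hone
  have hcl : IsClosed (h '' closedBall 0 1) :=
    ((isCompact_closedBall _ _).image_of_continuousOn H.continuousOn).isClosed
  intro w hw
  -- on the segment from `h x` to `w`, all points but possibly the last are in the open simplex
  let γ : ℝ → V → ℝ := fun τ => (1 - τ) • h x + τ • w
  have hγ : Continuous γ := by fun_prop
  have hsub : Icc (0 : ℝ) 1 ⊆ γ ⁻¹' (h '' closedBall 0 1) := by
    refine ((hcl.preimage hγ).inter isClosed_Icc).Icc_subset_of_forall_mem_nhdsWithin ?_ ?_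
    · exact ⟨x, hx, by simp [γ]⟩
    · rintro τ ⟨⟨y, hy, hyτ⟩, hτ0, hτ1⟩
      have hypos : ∀ v ∈ t, 0 < h y v := by
        intro v hv
        rw [hyτ]
        simp only [γ, Pi.add_apply, Pi.smul_apply, smul_eq_mul]
        exact add_pos_of_pos_of_nonneg (mul_pos (by linarith) (hpos v hv))
          (mul_nonneg hτ0 (hw.1 v))
      obtain ⟨N, hN, hNt⟩ := hopen y hy hypos
      rw [hyτ] at hN
      filter_upwards [mem_nhdsWithin_of_mem_nhds (hγ.continuousAt.preimage_mem_nhds hN),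
        Ioo_mem_nhdsGT hτ1] with σ hσ hσ'
      exact hNt _ hσ (convex_stdFace t hxt hw (by linarith [hσ'.2]) (by linarith [hσ'.1])
        (by ring))
  simpa [γ] using hsub (right_mem_Icc.2 zero_le_one)

lemma eq_or_exists_insert [DecidableEq V] (H : IsSimplicialBall d h) {x : X}
    (hx : x ∈ closedBall (0 : X) 1) {s : Finset V} (hs : s.card = d)
    (hpos : ∀ v ∈ s, 0 < h x v) :
    h x ∈ stdFace s ∨ ∃ v ∉ s, h x ∈ stdFace (insert v s) ∧
      stdFace (insert v s) ⊆ h '' closedBall 0 1 := by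
  obtain ⟨t, ht, hxt⟩ := H.skeleton x hx
  have hst := subset_of_pos_of_mem_stdFace hxt hpos
  by_cases hxs : h x ∈ stdFace s
  · exact Or.inl hxs
  right
  obtain ⟨v, hvs, hv⟩ : ∃ v ∉ s, h x v ≠ 0 := by
    by_contra! hc
    exact hxs ⟨hxt.1, hxt.2.1, hc⟩
  have hvt : v ∈ t := by
    by_contra hvt
    exact hv (hxt.2.2 v hvt)
  have hins : insert v s = t := Finset.eq_of_subset_of_card_le
    (Finset.insert_subset hvt hst) (by rw [Finset.card_insert_of_notMem hvs]; omega)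
  refine ⟨v, hvs, hins ▸ hxt, H.stdFace_subset hx ?_ (hins ▸ hxt) ?_⟩
  · rw [Finset.card_insert_of_notMem hvs, hs]
  · intro u hu
    rcases Finset.mem_insert.1 hu with rfl | hu
    · exact lt_of_le_of_ne (hxt.1 _) hv.symm
    · exact hpos u hu

/-- With at most one `d`-simplex of the ball around a `(d-1)`-simplex `s`, a neighbourhood of an
interior point would be embedded in a half-space, with the point on the boundary. -/
lemma exists_two_insert [DecidableEq V] (H : IsSimplicialBall d h) {x : X} (hx : ‖x‖ < 1)
    {s : Finset V} (hs : s.card = d) (hxs : h x ∈ stdFace s) (hpos : ∀ v ∈ s, 0 < h x v) :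
    ∃ v₁ ∉ s, ∃ v₂ ∉ s, v₁ ≠ v₂ ∧ stdFace (insert v₁ s) ⊆ h '' closedBall 0 1 ∧
      stdFace (insert v₂ s) ⊆ h '' closedBall 0 1 := by
  by_contra! hc
  have hface : ∀ y, ‖y‖ < 1 ∧ (∀ v ∈ s, 0 < h y v) → ∀ v ∉ s, h y v ≠ 0 →
      h y ∈ stdFace (insert v s) ∧ stdFace (insert v s) ⊆ h '' closedBall 0 1 := by
    rintro y ⟨hy, hypos⟩ v hvs hv
    rcases H.eq_or_exists_insert (mem_closedBall_of_norm_lt hy) hs hypos with h1 | ⟨u, hu, h1⟩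
    · exact absurd (h1.2.2 v hvs) hv
    · have : u = v := by
        by_contra huv
        exact hv (h1.1.2.2 v (by simp [hvs, Ne.symm huv]))
      exact this ▸ h1
  have himg := H.image_coordinates_mem_nhds hs (H.eventually_openStar hx hpos)
    (fun z hz => mem_closedBall_of_norm_lt hz.1) (by
      intro y hy z hz hyz
      have hmem : ∀ y', ‖y'‖ < 1 ∧ (∀ v ∈ s, 0 < h y' v) → h y' ∈ stdFace
          (Finset.univ.filter fun v => h y' v ≠ 0) := by
        intro y' hy'
        obtain ⟨t, -, ht⟩ := H.skeleton y' (mem_closedBall_of_norm_lt hy'.1)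
        exact ⟨ht.1, ht.2.1, fun v hv => by simpa using hv⟩
      refine eq_of_eqOn_of_mem_stdFace (stdFace_mono Finset.subset_union_left (hmem y hy))
        (stdFace_mono Finset.subset_union_right (hmem z hz)) hyz ?_
      have hall : ∀ v ∈ (Finset.univ.filter fun v => h y v ≠ 0) ∪
          (Finset.univ.filter fun v => h z v ≠ 0), v ∉ s →
          stdFace (insert v s) ⊆ h '' closedBall 0 1 := by
        intro v hv hvs
        rcases Finset.mem_union.1 hv with hv | hv
        · exact (hface y hy v hvs (by simpa using hv)).2
        · exact (hface z hz v hvs (by simpa using hv)).2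
      intro v hv hvs v' hv' hvs'
      by_contra hne
      exact hc v hvs v' hvs' hne (hall v hv hvs) (hall v' hv' hvs'))
  -- on the ball the coordinates in `s` add up to at most one, with equality at `h x`, so that they
  -- cannot fill a neighbourhood
  have hcont : Continuous fun (ε : ℝ) (v : s) => h x v + ε := by fun_prop
  have hev := hcont.continuousAt.preimage_mem_nhds (x := 0) (by simpa using himg)
  obtain ⟨ε, ⟨y, hy, hyε⟩, hε⟩ := Filter.nonempty_of_mem
    (inter_mem (mem_nhdsWithin_of_mem_nhds hev) (self_mem_nhdsWithin (s := Ioi (0 : ℝ))))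
  obtain ⟨t, -, hyt⟩ := H.skeleton y (mem_closedBall_of_norm_lt hy.1)
  have h1 : ∑ v ∈ s, h y v ≤ 1 := by
    rw [← hyt.2.1]
    exact Finset.sum_le_univ_sum_of_nonneg hyt.1
  have h2 : ∑ v ∈ s, h y v = 1 + s.card * ε := by
    rw [← sum_eq_one_of_mem_stdFace hxs, ← nsmul_eq_mul, ← Finset.sum_const,
      ← Finset.sum_add_distrib]
    exact Finset.sum_congr rfl fun v hv => congrFun hyε ⟨v, hv⟩
  have h3 : 0 < s.card := by
    rw [Finset.card_pos]
    by_contra hne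
    have := sum_eq_one_of_mem_stdFace hxs
    simp [Finset.not_nonempty_iff_eq_empty.1 hne] at this
  have h4 : (0 : ℝ) < s.card * ε := mul_pos (by exact_mod_cast h3) hε
  linarith

/-- Two `d`-simplices of the ball that meet in a `(d-1)`-simplex fill a neighbourhood of each
interior point of that simplex, by invariance of domain. -/
lemma norm_lt_one_and_eq_or_eq [DecidableEq V] (H : IsSimplicialBall d h) {x : X}
    (hx : x ∈ closedBall (0 : X) 1) {s : Finset V} (hs : s.card = d) (hxs : h x ∈ stdFace s)
    (hpos : ∀ v ∈ s, 0 < h x v) {v₁ v₂ : V} (hv₁ : v₁ ∉ s) (hv₂ : v₂ ∉ s) (hne : v₁ ≠ v₂)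
    (h₁ : stdFace (insert v₁ s) ⊆ h '' closedBall 0 1)
    (h₂ : stdFace (insert v₂ s) ⊆ h '' closedBall 0 1) :
    ‖x‖ < 1 ∧ ∀ v ∉ s, stdFace (insert v s) ⊆ h '' closedBall 0 1 → v = v₁ ∨ v = v₂ := by
  have hsne : s.Nonempty := by
    by_contra hne
    have := sum_eq_one_of_mem_stdFace hxs
    simp [Finset.not_nonempty_iff_eq_empty.1 hne] at this
  set Φ := gluedSimplices s v₁ v₂ (h x) with hΦ
  have hΦc : Continuous Φ := continuous_gluedSimplices s v₁ v₂ (h x)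
  have hΦ0 : Φ 0 = h x := by
    ext v
    by_cases hv : v ∈ s
    · simp [hΦ, gluedSimplices, hv]
    · simp [hΦ, gluedSimplices, hv, hxs.2.2 v hv]
  have hN : Φ ⁻¹' {w | ∀ v ∈ s, 0 < w v} ∈ 𝓝 0 :=
    hΦc.continuousAt.preimage_mem_nhds ((isOpen_openStar s).mem_nhds (by rw [hΦ0]; exact hpos))
  have hΦB : ∀ u ∈ Φ ⁻¹' {w | ∀ v ∈ s, 0 < w v}, Φ u ∈ h '' closedBall 0 1 := by
    intro u hu
    have hsum := sum_gluedSimplices hsne hv₁ hv₂ hne hxs u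
    have hnn : ∀ v, 0 ≤ Φ u v := by
      intro v
      by_cases hv : v ∈ s
      · exact (hu v hv).le
      · simp only [hΦ, gluedSimplices, hv, dif_neg, not_false_eq_true]
        split_ifs <;> simp
    rcases le_total 0 (∑ i, u i) with hτ | hτ
    · refine h₁ ⟨hnn, hsum, fun v hv => ?_⟩
      simp only [Finset.mem_insert, not_or] at hv
      simp only [hΦ, gluedSimplices, hv, dif_neg, if_false, not_false_eq_true]
      rw [max_eq_right (by linarith), ite_self]
    · refine h₂ ⟨hnn, hsum, fun v hv => ?_⟩
      simp only [Finset.mem_insert, not_or] at hv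
      simp only [hΦ, gluedSimplices, hv, dif_neg, if_false, not_false_eq_true]
      rw [max_eq_right hτ, ite_self]
  set k := Function.invFunOn h (closedBall (0 : X) 1)
  have hkc : ContinuousOn k (h '' closedBall 0 1) :=
    continuousOn_invFunOn_of_isCompact (isCompact_closedBall _ _) H.continuousOn H.injOn
  have hkx : k (h x) = x := H.injOn.leftInvOn_invFunOn hx
  have hkinj : InjOn k (h '' closedBall 0 1) := Function.invFunOn_injOn_image _ _
  have himg := image_mem_nhds_of_continuousOn_of_injOn (by simp [H.finrank_eq, hs]) hN
    (hkc.comp hΦc.continuousOn hΦB)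
    (hkinj.comp (gluedSimplices_injective hv₁ hv₂ hne (h x)).injOn hΦB)
  rw [Function.comp_apply, hΦ0, hkx] at himg
  constructor
  · have hsub : (k ∘ Φ) '' (Φ ⁻¹' {w | ∀ v ∈ s, 0 < w v}) ⊆ closedBall 0 1 := by
      rintro _ ⟨u, hu, rfl⟩
      exact Function.invFunOn_mem (hΦB u hu)
    have := mem_interior_iff_mem_nhds.2 (Filter.mem_of_superset himg hsub)
    rw [interior_closedBall _ one_ne_zero] at this
    simpa using this
  · intro v hv hvB
    by_contra! hvne
    -- points of a third simplex arbitrarily close to `h x` would lie in one of the first two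
    let γ : ℝ → V → ℝ := fun ε => (1 - ε) • h x + ε • Pi.single v 1
    have hγc : Continuous γ := by fun_prop
    have hγ0 : γ 0 = h x := by simp [γ]
    have hsingle : (Pi.single v 1 : V → ℝ) ∈ stdFace (insert v s) := by
      refine ⟨fun u => ?_, by simp, fun u hu => ?_⟩
      · by_cases huv : u = v
        · subst huv; simp
        · simp [huv]
      · have : u ≠ v := fun h => hu (by simp [h])
        simp [this]
    have hγB : ∀ ε ∈ Icc (0 : ℝ) 1, γ ε ∈ h '' closedBall 0 1 := fun ε hε =>
      hvB (convex_stdFace _ (stdFace_mono (Finset.subset_insert v s) hxs) hsingle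
        (by linarith [hε.2]) hε.1 (by ring))
    have hkγ : ContinuousWithinAt (k ∘ γ) (Icc 0 1) 0 :=
      (hkc.comp hγc.continuousOn hγB) 0 (by simp)
    have hev := hkγ.preimage_mem_nhdsWithin (t := (k ∘ Φ) '' (Φ ⁻¹' {w | ∀ v ∈ s, 0 < w v}))
      (by rw [Function.comp_apply, hγ0, hkx]; exact himg)
    have hev' : (k ∘ γ) ⁻¹' ((k ∘ Φ) '' (Φ ⁻¹' {w | ∀ v ∈ s, 0 < w v})) ∈ 𝓝[>] (0 : ℝ) := by
      rw [← nhdsWithin_Ioc_eq_nhdsGT one_pos]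
      exact nhdsWithin_mono _ Ioc_subset_Icc_self hev
    obtain ⟨ε, ⟨u, hu, huε⟩, hε⟩ :=
      Filter.nonempty_of_mem (inter_mem hev' (Ioc_mem_nhdsGT one_pos))
    have heq : Φ u = γ ε := hkinj (hΦB u hu) (hγB ε ⟨hε.1.le, hε.2⟩) huε
    have := congrFun heq v
    simp only [hΦ, gluedSimplices, hv, hvne, dif_neg, if_false, not_false_eq_true, γ, Pi.add_apply,
      Pi.smul_apply, hxs.2.2 v hv, Pi.single_eq_same, smul_eq_mul] at this
    linarith [hε.1]

/-- A `(d-1)`-simplex in the interior of the ball is a facet of exactly two of its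
`d`-simplices. -/
theorem ncard_insert_eq_two [DecidableEq V] (H : IsSimplicialBall d h) {x : X} (hx : ‖x‖ < 1)
    {s : Finset V} (hs : s.card = d) (hxs : h x ∈ stdFace s) (hpos : ∀ v ∈ s, 0 < h x v) :
    {v | v ∉ s ∧ stdFace (insert v s) ⊆ h '' closedBall 0 1}.ncard = 2 := by
  obtain ⟨v₁, hv₁, v₂, hv₂, hne, h₁, h₂⟩ := H.exists_two_insert hx hs hxs hpos
  rw [Set.ncard_eq_two]
  refine ⟨v₁, v₂, hne, Set.ext fun v => ⟨fun hv => ?_, ?_⟩⟩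
  · exact (H.norm_lt_one_and_eq_or_eq (mem_closedBall_of_norm_lt hx) hs hxs hpos hv₁ hv₂ hne
      h₁ h₂).2 v hv.1 hv.2
  · rintro (rfl | rfl)
    exacts [⟨hv₁, h₁⟩, ⟨hv₂, h₂⟩]

/-- A `(d-1)`-simplex in the boundary of the ball is a facet of exactly one of its
`d`-simplices. -/
theorem ncard_insert_eq_one [DecidableEq V] (H : IsSimplicialBall d h) {x : X} (hx : ‖x‖ = 1)
    {s : Finset V} (hs : s.card = d) (hxs : h x ∈ stdFace s) (hpos : ∀ v ∈ s, 0 < h x v) :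
    {v | v ∉ s ∧ stdFace (insert v s) ⊆ h '' closedBall 0 1}.ncard = 1 := by
  have hxB : x ∈ closedBall (0 : X) 1 := by simp [hx]
  obtain ⟨v₁, hv₁, h₁⟩ : ∃ v ∉ s, stdFace (insert v s) ⊆ h '' closedBall 0 1 := by
    -- move from the boundary point slightly into the interior of the ball
    let γ : ℝ → X := fun ε => (1 - ε) • x
    have hγB : ∀ ε ∈ Icc (0 : ℝ) 1, γ ε ∈ closedBall (0 : X) 1 := by
      intro ε hε
      simp only [γ, mem_closedBall, dist_zero_right, norm_smul, hx, mul_one, Real.norm_eq_abs]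
      rw [abs_of_nonneg (by linarith [hε.2])]
      linarith [hε.1]
    have hγc : Continuous γ := by fun_prop
    have hc : ContinuousWithinAt (h ∘ γ) (Icc 0 1) 0 :=
      (H.continuousOn.comp hγc.continuousOn hγB) 0 (by simp)
    have hev := hc.preimage_mem_nhdsWithin (t := {w | ∀ v ∈ s, 0 < w v})
      ((isOpen_openStar s).mem_nhds (by simpa [γ] using hpos))
    have hev' : (h ∘ γ) ⁻¹' {w | ∀ v ∈ s, 0 < w v} ∈ 𝓝[>] (0 : ℝ) := by
      rw [← nhdsWithin_Ioc_eq_nhdsGT one_pos]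
      exact nhdsWithin_mono _ Ioc_subset_Icc_self hev
    obtain ⟨ε, hpos', hε⟩ :=
      Filter.nonempty_of_mem (inter_mem hev' (Ioc_mem_nhdsGT one_pos))
    have hlt : ‖γ ε‖ < 1 := by
      simp only [γ, norm_smul, hx, mul_one, Real.norm_eq_abs]
      rw [abs_of_nonneg (by linarith [hε.2])]
      linarith [hε.1]
    rcases H.eq_or_exists_insert (mem_closedBall_of_norm_lt hlt) hs hpos' with h1 | ⟨v, hv, -, h1⟩
    · obtain ⟨v, hv, -, -, -, h2, -⟩ := H.exists_two_insert hlt hs h1 hpos'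
      exact ⟨v, hv, h2⟩
    · exact ⟨v, hv, h1⟩
  rw [Set.ncard_eq_one]
  refine ⟨v₁, Set.ext fun v => ⟨fun hv => ?_, ?_⟩⟩
  · by_contra hne
    exact (H.norm_lt_one_and_eq_or_eq hxB hs hxs hpos hv.1 hv₁ hne hv.2 h₁).1.ne hx
  · rintro rfl
    exact ⟨hv₁, h₁⟩

end IsSimplicialBall

end SimplicialBall

/-! ### Barycentric coordinates on a triangulated sphere -/

section Barycentric

open Metric Set

variable {n : ℕ} {E : Type*} [NormedAddCommGroup E] [NormedSpace ℝ E] {V : Type*} [Fintype V]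

lemma isCompact_stdFace (t : Finset V) : IsCompact (stdFace t) := by
  have : stdFace t = stdSimplex ℝ V ∩ ⋂ v ∈ {v | v ∉ t}, {w | w v = 0} := by
    ext w; simp [stdFace, stdSimplex, and_assoc]
  rw [this]
  refine (isCompact_stdSimplex ℝ V).inter_right (isClosed_biInter fun v _ => ?_)
  exact isClosed_eq (continuous_apply v) continuous_const

lemma single_mem_stdFace [DecidableEq V] {t : Finset V} {v : V} :
    (Pi.single v 1 : V → ℝ) ∈ stdFace t ↔ v ∈ t := by
  refine ⟨fun h => ?_, fun h => ⟨fun u => ?_, by simp, fun u hu => ?_⟩⟩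
  · by_contra hv
    simpa using h.2.2 v hv
  · by_cases huv : u = v
    · subst huv; simp
    · simp [huv]
  · have : u ≠ v := fun h' => hu (h' ▸ h)
    simp [this]

lemma exists_pos_mem_stdFace {t : Finset V} (ht : t.Nonempty) :
    ∃ w ∈ stdFace t, ∀ v ∈ t, 0 < w v := by
  classical
  have hcard : (0 : ℝ) < t.card := by exact_mod_cast ht.card_pos
  refine ⟨fun v => if v ∈ t then (t.card : ℝ)⁻¹ else 0, ⟨fun v => ?_, ?_, fun v hv => ?_⟩,
    fun v hv => ?_⟩
  · dsimp only
    split_ifs <;> positivity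
  · rw [Finset.sum_ite_mem, Finset.univ_inter, Finset.sum_const, nsmul_eq_mul,
      mul_inv_cancel₀ hcard.ne']
  · simp [hv]
  · simp [hv, hcard]

lemma mem_convexHull_map_iff {e : V ↪ E} {t : Finset V} {p : E} :
    p ∈ convexHull ℝ ((t.map e : Finset E) : Set E) ↔ ∃ w ∈ stdFace t, ∑ v, w v • e v = p := by
  classical
  rw [Finset.mem_convexHull']
  constructor
  · rintro ⟨w, hw0, hw1, hwp⟩
    rw [Finset.sum_map] at hw1 hwp
    refine ⟨fun v => if v ∈ t then w (e v) else 0, ⟨fun v => ?_, ?_, fun v hv => by simp [hv]⟩, ?_⟩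
    · dsimp only
      split_ifs with hv
      exacts [hw0 _ (Finset.mem_map_of_mem e hv), le_rfl]
    · rw [Finset.sum_ite_mem, Finset.univ_inter, hw1]
    · simp_rw [ite_smul, zero_smul]
      rw [Finset.sum_ite_mem, Finset.univ_inter, hwp]
  · rintro ⟨w, hw, rfl⟩
    have hinv : ∀ v, Function.extend e w 0 (e v) = w v := fun v => e.injective.extend_apply w 0 v
    refine ⟨Function.extend e w 0, ?_, ?_, ?_⟩
    · intro y hy
      obtain ⟨v, -, rfl⟩ := Finset.mem_map.1 hy
      rw [hinv]
      exact hw.1 v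
    · simp_rw [Finset.sum_map, hinv]
      exact sum_eq_one_of_mem_stdFace hw
    · simp_rw [Finset.sum_map, hinv]
      exact Finset.sum_subset (Finset.subset_univ t) fun v _ hv => by rw [hw.2.2 v hv, zero_smul]

lemma eq_of_affineIndependent {e : V ↪ E} {t : Finset V}
    (hind : AffineIndependent ℝ fun x : ↥(t.map e) => (x : E)) {w w' : V → ℝ}
    (hw : w ∈ stdFace t) (hw' : w' ∈ stdFace t)
    (h : ∑ v, w v • e v = ∑ v, w' v • e v) : w = w' := by
  have hind' : AffineIndependent ℝ fun v : t => e v := by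
    let i : t → ↥(t.map e) := fun v => ⟨e v, Finset.mem_map_of_mem e v.2⟩
    exact hind.comp_embedding ⟨i, fun v v' hv => Subtype.ext (e.injective (Subtype.ext_iff.1 hv))⟩
  have hsum : ∀ u : V → ℝ, u ∈ stdFace t → ∑ v : t, u v • e v = ∑ v, u v • e v := by
    intro u hu
    rw [Finset.sum_coe_sort t fun v => u v • e v]
    exact Finset.sum_subset (Finset.subset_univ t) fun v _ hv => by rw [hu.2.2 v hv, zero_smul]
  have hone : ∀ u : V → ℝ, u ∈ stdFace t → ∑ v : t, u v = 1 := by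
    intro u hu
    rw [Finset.sum_coe_sort t u, sum_eq_one_of_mem_stdFace hu]
  have key := affineIndependent_iff.1 hind' Finset.univ (fun v => w v - w' v)
    (by rw [Finset.sum_sub_distrib, hone w hw, hone w' hw', sub_self])
    (by simp_rw [sub_smul]; rw [Finset.sum_sub_distrib, hsum w hw, hsum w' hw', h, sub_self])
  ext v
  by_cases hv : v ∈ t
  · exact sub_eq_zero.1 (key ⟨v, hv⟩ (Finset.mem_univ _))
  · rw [hw.2.2 v hv, hw'.2.2 v hv]

/-- `ψ` gives the barycentric coordinates of the points of the triangulated sphere, with respect to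
the enumeration `e` of the vertices. -/
structure IsBarycentric (K : Triangulation n E) (e : V ↪ E) (ψ : Sphere n → V → ℝ) : Prop where
  range_eq : Set.range e = K.complex.vertices
  continuous : Continuous ψ
  injective : Function.Injective ψ
  exists_face : ∀ y, ∃ t, t.map e ∈ K.complex.faces ∧ ψ y ∈ stdFace t
  mem_simplex_iff : ∀ t, t.map e ∈ K.complex.faces → ∀ y, y ∈ K.simplex (t.map e) ↔
    ψ y ∈ stdFace t
  stdFace_subset_range : ∀ t, t.map e ∈ K.complex.faces → stdFace t ⊆ Set.range ψ

lemma exists_map_eq_of_mem_faces {K : Triangulation n E} {e : V ↪ E}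
    (he : Set.range e = K.complex.vertices) {s : Finset E} (hs : s ∈ K.complex.faces) :
    ∃ t : Finset V, t.map e = s := by
  classical
  have hsub : (s : Set E) ⊆ Set.range e := by
    intro x hx
    rw [he]
    exact K.complex.down_closed hs (Finset.singleton_subset_iff.2 hx) (Finset.singleton_nonempty x)
  refine ⟨s.preimage e e.injective.injOn, ?_⟩
  rw [Finset.map_eq_image, Finset.image_preimage]
  exact Finset.filter_true_of_mem fun x hx => hsub hx

lemma exists_isBarycentric (K : Triangulation n E) (e : V ↪ E)
    (he : Set.range e = K.complex.vertices) : ∃ ψ : Sphere n → V → ℝ, IsBarycentric K e ψ := by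
  classical
  let R : Set (V → ℝ) := {w | ∃ t, t.map e ∈ K.complex.faces ∧ w ∈ stdFace t}
  let pt : (V → ℝ) → E := fun w => ∑ v, w v • e v
  have hRc : IsCompact R := by
    have : R = ⋃ t ∈ {t : Finset V | t.map e ∈ K.complex.faces}, stdFace t := by
      ext w; simp [R]
    rw [this]
    exact (Set.toFinite _).isCompact_biUnion fun t _ => isCompact_stdFace t
  have hpt : ∀ t w, w ∈ stdFace t → pt w ∈ convexHull ℝ ((t.map e : Finset E) : Set E) :=
    fun t w hw => mem_convexHull_map_iff.2 ⟨w, hw, rfl⟩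
  -- a point of two simplices has its coordinates supported on the common face
  have huniq : ∀ t t', t.map e ∈ K.complex.faces → t'.map e ∈ K.complex.faces →
      ∀ w ∈ stdFace t, ∀ w' ∈ stdFace t', pt w = pt w' → w = w' := by
    intro t t' ht ht' w hw w' hw' hww
    have h1 := K.complex.inter_subset_convexHull ht ht' ⟨hpt t w hw, hww ▸ hpt t' w' hw'⟩
    rw [← Finset.coe_inter, ← Finset.map_inter] at h1
    obtain ⟨u, hu, hup⟩ := mem_convexHull_map_iff.1 h1
    have h2 := eq_of_affineIndependent (K.complex.indep ht)
      (stdFace_mono Finset.inter_subset_left hu) hw hup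
    have h3 := eq_of_affineIndependent (K.complex.indep ht')
      (stdFace_mono Finset.inter_subset_right hu) hw' (hup.trans hww)
    exact h2.symm.trans h3
  have hRspace : ∀ w ∈ R, pt w ∈ K.complex.space := by
    rintro w ⟨t, ht, hw⟩
    exact K.complex.convexHull_subset_space ht (hpt t w hw)
  let f : R → Sphere n := fun w => K.homeo ⟨pt w, hRspace w w.2⟩
  have hfc : Continuous f := K.homeo.continuous.comp
    (Continuous.subtype_mk (by fun_prop) _)
  have hfb : Function.Bijective f := by
    constructor
    · rintro ⟨w, t, ht, hw⟩ ⟨w', t', ht', hw'⟩ h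
      exact Subtype.ext (huniq t t' ht ht' w hw w' hw' (Subtype.ext_iff.1 (K.homeo.injective h)))
    · intro y
      obtain ⟨s, hs, hy⟩ := K.complex.mem_space_iff.1 (K.homeo.symm y).2
      obtain ⟨t, rfl⟩ := exists_map_eq_of_mem_faces he hs
      obtain ⟨w, hw, hwy⟩ := mem_convexHull_map_iff.1 hy
      refine ⟨⟨w, t, hs, hw⟩, ?_⟩
      simp only [f]
      rw [← K.homeo.apply_symm_apply y]
      congr 1
      exact Subtype.ext hwy
  have : CompactSpace R := isCompact_iff_compactSpace.1 hRc
  let g : R ≃ₜ Sphere n := Continuous.homeoOfEquivCompactToT2 (f := Equiv.ofBijective f hfb) hfc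
  have hg : ∀ y, (K.homeo.symm y : E) = pt (g.symm y) := by
    intro y
    obtain ⟨w, rfl⟩ := g.surjective y
    rw [g.symm_apply_apply]
    change (K.homeo.symm (K.homeo _) : E) = _
    rw [K.homeo.symm_apply_apply]
  refine ⟨fun y => g.symm y, he, continuous_subtype_val.comp g.symm.continuous,
    Subtype.val_injective.comp g.symm.injective, fun y => (g.symm y).2, fun t ht y => ?_,
    fun t ht w hw => ⟨g ⟨w, t, ht, hw⟩, by simp⟩⟩
  rw [Triangulation.simplex, mem_ofPred_eq, hg, mem_convexHull_map_iff]
  constructor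
  · rintro ⟨w, hw, hwp⟩
    obtain ⟨t', ht', hy⟩ := (g.symm y).2
    rwa [← huniq t t' ht ht' w hw _ hy hwp]
  · exact fun h => ⟨_, h, rfl⟩

namespace IsBarycentric

variable {K : Triangulation n E} {e : V ↪ E} {ψ : Sphere n → V → ℝ}

lemma singleton_mem (B : IsBarycentric K e ψ) (v : V) :
    ({v} : Finset V).map e ∈ K.complex.faces := by
  rw [Finset.map_singleton]
  have : e v ∈ K.complex.vertices := B.range_eq ▸ Set.mem_range_self v
  exact this

lemma face_mono (_ : IsBarycentric K e ψ) {s t : Finset V} (ht : t.map e ∈ K.complex.faces)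
    (hst : s ⊆ t) (hs : s.Nonempty) : s.map e ∈ K.complex.faces :=
  K.complex.down_closed ht (Finset.map_subset_map.2 hst) (hs.map)

lemma nonempty_of_face (_ : IsBarycentric K e ψ) {t : Finset V} (ht : t.map e ∈ K.complex.faces) :
    t.Nonempty :=
  Finset.map_nonempty.1 (K.complex.nonempty_of_mem_faces ht)

/-- A point in the relative interior of a face. -/
lemma exists_pos (B : IsBarycentric K e ψ) {t : Finset V} (ht : t.map e ∈ K.complex.faces) :
    ∃ y, ψ y ∈ stdFace t ∧ ∀ v ∈ t, 0 < ψ y v := by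
  obtain ⟨w, hw, hpos⟩ := exists_pos_mem_stdFace (B.nonempty_of_face ht)
  obtain ⟨y, rfl⟩ := B.stdFace_subset_range t ht hw
  exact ⟨y, hw, hpos⟩

lemma simplex_subset_iff (B : IsBarycentric K e ψ) {s : Finset V} (hs : s.Nonempty)
    (S : Set (Sphere n)) :
    s.map e ∈ K.complex.faces ∧ K.simplex (s.map e) ⊆ S ↔ stdFace s ⊆ ψ '' S := by
  constructor
  · rintro ⟨hf, hsub⟩ w hw
    obtain ⟨y, rfl⟩ := B.stdFace_subset_range s hf hw
    exact ⟨y, hsub ((B.mem_simplex_iff s hf y).2 hw), rfl⟩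
  · intro h
    have hf : s.map e ∈ K.complex.faces := by
      obtain ⟨w, hw, hpos⟩ := exists_pos_mem_stdFace hs
      obtain ⟨y, -, rfl⟩ := h hw
      obtain ⟨t, ht, hyt⟩ := B.exists_face y
      exact B.face_mono ht (subset_of_pos_of_mem_stdFace hyt hpos) hs
    refine ⟨hf, fun y hy => ?_⟩
    obtain ⟨y', hy', heq⟩ := h ((B.mem_simplex_iff s hf y).1 hy)
    exact B.injective heq ▸ hy'

lemma simplex_singleton_subset_iff (B : IsBarycentric K e ψ) {t : Finset V}
    (ht : t.map e ∈ K.complex.faces) {v : V} :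
    K.simplex {e v} ⊆ K.simplex (t.map e) ↔ v ∈ t := by
  classical
  rw [← Finset.map_singleton]
  constructor
  · intro h
    obtain ⟨y, hy⟩ := B.stdFace_subset_range {v} (B.singleton_mem v)
      (single_mem_stdFace.2 (Finset.mem_singleton_self v))
    have h1 : y ∈ K.simplex (({v} : Finset V).map e) := by
      rw [B.mem_simplex_iff _ (B.singleton_mem v), hy]
      exact single_mem_stdFace.2 (Finset.mem_singleton_self v)
    have h2 := (B.mem_simplex_iff t ht y).1 (h h1)
    rw [hy] at h2
    exact single_mem_stdFace.1 h2
  · intro hv y hy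
    rw [B.mem_simplex_iff _ (B.singleton_mem v)] at hy
    rw [B.mem_simplex_iff t ht]
    exact stdFace_mono (by simpa using hv) hy

lemma simplex_singleton_subset_simplex (B : IsBarycentric K e ψ) {v w : V}
    (h : K.simplex {e v} ⊆ K.simplex {e w}) : v = w := by
  have h1 := B.singleton_mem w
  have h2 : K.simplex {e v} ⊆ K.simplex (({w} : Finset V).map e) := by
    rwa [Finset.map_singleton]
  simpa using (B.simplex_singleton_subset_iff h1).1 h2

lemma exists_antipode (B : IsBarycentric K e ψ) (hK : K.IsSymmetric) (v : V) :
    ∃ w, K.simplex {e w} = -K.simplex {e v} := by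
  classical
  have hsing : ∀ w, ∃ y, K.simplex {e w} = {y} := by
    intro w
    refine ⟨K.homeo ⟨e w, K.complex.convexHull_subset_space (B.singleton_mem w) (by simp)⟩, ?_⟩
    ext y
    simp only [Triangulation.simplex, Finset.coe_singleton, convexHull_singleton, mem_ofPred_eq,
      mem_singleton_iff]
    constructor
    · intro h
      rw [← K.homeo.apply_symm_apply y]
      congr 1
      exact Subtype.ext h
    · rintro rfl
      simp
  obtain ⟨T, hT, hTv⟩ := hK _ (B.singleton_mem v)
  rw [Finset.map_singleton] at hTv
  obtain ⟨t, rfl⟩ := exists_map_eq_of_mem_faces B.range_eq hT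
  obtain ⟨w, hw⟩ := B.nonempty_of_face hT
  refine ⟨w, ?_⟩
  have h1 := (B.simplex_singleton_subset_iff hT).2 hw
  rw [hTv] at h1
  obtain ⟨y, hy⟩ := hsing w
  obtain ⟨z, hz⟩ := hsing v
  rw [hy, hz, Set.neg_singleton] at h1 ⊢
  rw [Set.singleton_subset_singleton.1 h1]

variable {a : V → V}

lemma involutive_antipode (B : IsBarycentric K e ψ)
    (ha : ∀ v, K.simplex {e (a v)} = -K.simplex {e v}) : Function.Involutive a := fun v =>
  B.simplex_singleton_subset_simplex (by rw [ha, ha, neg_neg])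

variable [DecidableEq V]

lemma image_antipode (B : IsBarycentric K e ψ) (hK : K.IsSymmetric)
    (ha : ∀ v, K.simplex {e (a v)} = -K.simplex {e v}) {s : Finset V}
    (hs : s.map e ∈ K.complex.faces) : (s.image a).map e ∈ K.complex.faces ∧
      K.simplex ((s.image a).map e) = -K.simplex (s.map e) := by
  obtain ⟨T, hT, hTs⟩ := hK _ hs
  obtain ⟨t, rfl⟩ := exists_map_eq_of_mem_faces B.range_eq hT
  have hinv := B.involutive_antipode ha
  have h1 : s.image a ⊆ t := by
    refine Finset.image_subset_iff.2 fun v hv => ?_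
    rw [← B.simplex_singleton_subset_iff hT, hTs, ha, Set.neg_subset_neg]
    exact (B.simplex_singleton_subset_iff hs).2 hv
  have h2 : t.image a ⊆ s := by
    refine Finset.image_subset_iff.2 fun v hv => ?_
    rw [← B.simplex_singleton_subset_iff hs, ha, ← Set.neg_subset_neg, neg_neg, ← hTs]
    exact (B.simplex_singleton_subset_iff hT).2 hv
  have h3 : s.image a = t := by
    refine Finset.Subset.antisymm h1 fun v hv => ?_
    rw [← hinv v]
    exact Finset.mem_image_of_mem a (h2 (Finset.mem_image_of_mem a hv))
  rw [h3]
  exact ⟨hT, hTs⟩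

lemma neg_mem_stdFace (B : IsBarycentric K e ψ) (hK : K.IsSymmetric)
    (ha : ∀ v, K.simplex {e (a v)} = -K.simplex {e v}) {s : Finset V}
    (hs : s.map e ∈ K.complex.faces) {y : Sphere n} (hy : ψ y ∈ stdFace s) :
    ψ (-y) ∈ stdFace (s.image a) := by
  obtain ⟨h1, h2⟩ := B.image_antipode hK ha hs
  rw [← B.mem_simplex_iff _ h1, h2, Set.mem_neg, neg_neg, B.mem_simplex_iff _ hs]
  exact hy

lemma neg_pos (B : IsBarycentric K e ψ) (hK : K.IsSymmetric)
    (ha : ∀ v, K.simplex {e (a v)} = -K.simplex {e v}) {s : Finset V}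
    (hs : s.map e ∈ K.complex.faces) {y : Sphere n} (hy : ψ y ∈ stdFace s)
    (hpos : ∀ v ∈ s, 0 < ψ y v) : ∀ v ∈ s.image a, 0 < ψ (-y) v := by
  have hinv := B.involutive_antipode ha
  have hmem := B.neg_mem_stdFace hK ha hs hy
  intro v hv
  refine lt_of_le_of_ne (hmem.1 v) fun h0 => ?_
  have h1 : ψ (-y) ∈ stdFace ((s.image a).erase v) := by
    refine ⟨hmem.1, hmem.2.1, fun u hu => ?_⟩
    by_cases huv : u = v
    · rw [huv, ← h0]
    · exact hmem.2.2 u fun h => hu (Finset.mem_erase.2 ⟨huv, h⟩)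
  have hne : ((s.image a).erase v).Nonempty := by
    by_contra hne
    have := sum_eq_one_of_mem_stdFace h1
    simp [Finset.not_nonempty_iff_eq_empty.1 hne] at this
  have h2 := B.neg_mem_stdFace hK ha
    (B.face_mono (B.image_antipode hK ha hs).1 (Finset.erase_subset _ _) hne) h1
  rw [neg_neg] at h2
  have h3 : a v ∈ s := by
    obtain ⟨u, hu, rfl⟩ := Finset.mem_image.1 hv
    rwa [hinv u]
  refine (hpos _ h3).ne' (h2.2.2 _ fun h => ?_)
  obtain ⟨u, hu, huv⟩ := Finset.mem_image.1 h
  exact (Finset.mem_erase.1 hu).1 (hinv.injective huv)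

end IsBarycentric

end Barycentric

/-! ### The combinatorial structure of an aligned triangulation -/

/-- The combinatorial content of a labelled symmetric triangulation of `S^n` with a flag of
hemispheres. The last two fields say that the `d`-simplices in `H d` triangulate it as a
pseudomanifold with boundary `H (d-1) ∪ -H (d-1)`. -/
structure Input.IsFlagged {V : Type*} [DecidableEq V] (D : Input V) (n : ℕ) : Prop where
  nonempty : ∀ s ∈ D.faces, s.Nonempty
  down_closed : ∀ s ∈ D.faces, ∀ t ⊆ s, t.Nonempty → t ∈ D.faces
  involutive : Function.Involutive D.antipode
  image_mem : ∀ s ∈ D.faces, s.image D.antipode ∈ D.faces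
  label_antipode : ∀ v, D.label (D.antipode v) = -D.label v
  label_add_ne_zero : ∀ s ∈ D.faces, ∀ v ∈ s, ∀ w ∈ s, D.label v + D.label w ≠ 0
  mem_faces : ∀ d ≤ n, ∀ s ∈ D.hemi d, s ∈ D.faces
  hemi_mono : ∀ d ≤ n, ∀ s ∈ D.hemi d, ∀ t ⊆ s, t.Nonempty → t ∈ D.hemi d
  hemi_succ : ∀ d, d + 1 ≤ n → ∀ s ∈ D.hemi d, s ∈ D.hemi (d + 1)
  antipode_hemi_succ : ∀ d, d + 1 ≤ n → ∀ s ∈ D.hemi d, s.image D.antipode ∈ D.hemi (d + 1)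
  card_le : ∀ d ≤ n, ∀ s ∈ D.hemi d, s.card ≤ d + 1
  card_le_of_antipode : ∀ d ≤ n, ∀ s ∈ D.hemi d, s.image D.antipode ∈ D.hemi d → s.card ≤ d
  boundary : ∀ d, d + 1 ≤ n → ∀ s ∈ D.hemi (d + 1), s.image D.antipode ∈ D.hemi (d + 1) →
    s.card = d + 1 → s ∈ D.hemi d ∨ s.image D.antipode ∈ D.hemi d
  cover : ∀ s ∈ D.faces, s.card = n + 1 → s ∈ D.hemi n ∨ s.image D.antipode ∈ D.hemi n
  hemi_zero : ∃ v, ∀ s, s ∈ D.hemi 0 ↔ s = {v}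
  ncard_eq_two : ∀ d, d + 1 ≤ n → ∀ s ∈ D.hemi (d + 1), s.card = d + 1 → s ∉ D.hemi d →
    s.image D.antipode ∉ D.hemi d → {v | v ∉ s ∧ insert v s ∈ D.hemi (d + 1)}.ncard = 2
  ncard_eq_one : ∀ d, d + 1 ≤ n → ∀ s ∈ D.hemi (d + 1), s.card = d + 1 →
    (s ∈ D.hemi d ∨ s.image D.antipode ∈ D.hemi d) →
    {v | v ∉ s ∧ insert v s ∈ D.hemi (d + 1)}.ncard = 1

section Geometry

open Metric Set

variable {n : ℕ} {E : Type*} [NormedAddCommGroup E] [NormedSpace ℝ E] {V : Type*}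
  {K : Triangulation n E} {H : ℕ → Set (Sphere n)} {e : V ↪ E}
  {ψ : Sphere n → V → ℝ} {a : V → V}

/-- A hemisphere of the flag, in barycentric coordinates. -/
lemma exists_isSimplicialBall [Fintype V] [DecidableEq V] (B : IsBarycentric K e ψ)
    (hK : K.IsSymmetric)
    (ha : ∀ v, K.simplex {e (a v)} = -K.simplex {e v}) (hH : K.IsAlignedWith H) {d : ℕ}
    (hd : d ≤ n) : ∃ h : EuclideanSpace ℝ (Fin d) → V → ℝ, IsSimplicialBall d h ∧
      h '' closedBall 0 1 = ψ '' H d ∧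
      ∀ x ∈ closedBall (0 : EuclideanSpace ℝ (Fin d)) 1, 1 ≤ d →
        (‖x‖ = 1 ↔ h x ∈ ψ '' (H d ∩ -H d)) := by
  classical
  obtain ⟨g, hg⟩ := hH.1.ball d hd
  let h : EuclideanSpace ℝ (Fin d) → V → ℝ := fun x =>
    if hx : x ∈ closedBall (0 : EuclideanSpace ℝ (Fin d)) 1 then ψ (g ⟨x, hx⟩) else 0
  have hval : ∀ x (hx : x ∈ closedBall (0 : EuclideanSpace ℝ (Fin d)) 1),
      h x = ψ (g ⟨x, hx⟩) := fun x hx => dif_pos hx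
  have hinj : InjOn h (closedBall 0 1) := by
    intro x hx y hy hxy
    rw [hval x hx, hval y hy] at hxy
    exact Subtype.ext_iff.1 (g.injective (Subtype.ext (B.injective hxy)))
  have hskel : ∀ c ≤ n, ∀ y ∈ H c, ∃ t : Finset V, t.map e ∈ K.complex.faces ∧ t.card ≤ c + 1 ∧
      ψ y ∈ stdFace t := by
    intro c hc y hy
    obtain ⟨s, hs, hcard, hys⟩ := hH.2 c hc hy
    obtain ⟨t, rfl⟩ := exists_map_eq_of_mem_faces B.range_eq hs
    exact ⟨t, hs, by simpa using hcard, (B.mem_simplex_iff t hs y).1 hys⟩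
  have hbd : ∀ x ∈ closedBall (0 : EuclideanSpace ℝ (Fin d)) 1, 1 ≤ d →
      (‖x‖ = 1 ↔ h x ∈ ψ '' (H d ∩ -H d)) := by
    intro x hx hd1
    rw [hval x hx, B.injective.mem_set_image, ← hg hd1]
    constructor
    · exact fun h1 => ⟨⟨x, hx⟩, h1, rfl⟩
    · rintro ⟨x', hx', heq⟩
      obtain rfl : x' = ⟨x, hx⟩ := g.injective (Subtype.ext heq)
      exact hx'
  refine ⟨h, ⟨by simp, ?_, hinj, fun x hx => ?_, fun x hx => ?_⟩, ?_, hbd⟩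
  · rw [continuousOn_iff_continuous_domRestrict]
    have : (closedBall 0 1).domRestrict h = fun x => ψ (g x) := by
      ext1 x
      exact hval x x.2
    rw [this]
    exact B.continuous.comp (continuous_subtype_val.comp g.continuous)
  · obtain ⟨t, -, ht⟩ := hskel d hd _ (g ⟨x, hx⟩).2
    rw [hval x hx]
    exact ⟨t, ht⟩
  · have hxB : x ∈ closedBall (0 : EuclideanSpace ℝ (Fin d)) 1 := by simp [hx]
    cases d with
    | zero => simp [Subsingleton.elim x 0] at hx
    | succ d =>
      have := (hbd x hxB (by omega)).1 hx
      rw [hH.1.inter d hd] at this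
      obtain ⟨y, hy | hy, hyx⟩ := this
      · obtain ⟨t, -, ht⟩ := hskel d (by omega) y hy
        exact ⟨t, hyx ▸ ht⟩
      · obtain ⟨t, hf, hcard, ht⟩ := hskel d (by omega) (-y) hy
        refine ⟨t.image a, Finset.card_image_le.trans hcard, ?_⟩
        have := B.neg_mem_stdFace hK ha hf ht
        rwa [neg_neg, hyx] at this
  · ext w
    constructor
    · rintro ⟨x, hx, rfl⟩
      exact ⟨_, (g ⟨x, hx⟩).2, (hval x hx).symm⟩
    · rintro ⟨y, hy, rfl⟩
      obtain ⟨⟨x, hx⟩, hxy⟩ := g.surjective ⟨y, hy⟩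
      exact ⟨x, hx, by rw [hval x hx, hxy]⟩

/-- A hemisphere contains every simplex of its dimension of which it contains an interior point. -/
lemma stdFace_subset_hemisphere [Fintype V] [DecidableEq V] (B : IsBarycentric K e ψ)
    (hK : K.IsSymmetric)
    (ha : ∀ v, K.simplex {e (a v)} = -K.simplex {e v}) (hH : K.IsAlignedWith H) {d : ℕ}
    (hd : d ≤ n) {s : Finset V} (hs : s.card = d + 1) {y : Sphere n} (hy : y ∈ H d)
    (hys : ψ y ∈ stdFace s) (hpos : ∀ v ∈ s, 0 < ψ y v) : stdFace s ⊆ ψ '' H d := by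
  obtain ⟨h, hball, himg, -⟩ := exists_isSimplicialBall B hK ha hH hd
  obtain ⟨x, hx, hxy⟩ : ψ y ∈ h '' closedBall 0 1 := himg ▸ mem_image_of_mem ψ hy
  rw [← himg]
  exact hball.stdFace_subset hx hs (hxy ▸ hys) (hxy ▸ hpos)

lemma hemisphere_subset (hH : IsHemisphereFlag H) {d : ℕ} (hd : d + 1 ≤ n) :
    -H d ⊆ H (d + 1) := by
  have h1 := hH.inter d hd
  exact fun y hy => (h1.symm ▸ (Or.inr hy : y ∈ H d ∪ -H d) : y ∈ H (d + 1) ∩ -H (d + 1)).1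

lemma Input.Describes.finite {D : Input V} {label : E → ℤ}
    (hD : D.Describes K H label e) : Finite V := by
  have hfin : K.complex.vertices.Finite := by
    rw [K.complex.vertices_eq]
    exact K.finite.biUnion fun s _ => s.finite_toSet
  rw [← hD.range_eq] at hfin
  have : Finite (Set.range e) := hfin
  exact Finite.of_injective_finite_range e.injective

/-- The fields are read off at interior points of simplices, in barycentric coordinates: a simplex
of dimension `d` lies in `H d` as soon as one of its interior points does. -/
theorem Input.Describes.isFlagged [DecidableEq V] {D : Input V} {label : E → ℤ} {m : ℕ}
    (hD : D.Describes K H label e) (hK : K.IsSymmetric) (hH : K.IsAlignedWith H)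
    (hm : K.HasLabelsUpTo label m) (hanti : K.IsAntisymmetric label)
    (hcompl : K.NoComplementaryEdge label) : D.IsFlagged n := by
  have := hD.finite
  have := Fintype.ofFinite V
  obtain ⟨ψ, B⟩ := exists_isBarycentric K e hD.range_eq
  set a := D.antipode with ha_def
  have ha : ∀ v, K.simplex {e (a v)} = -K.simplex {e v} := hD.antipode_eq
  have hvert : ∀ v, e v ∈ K.complex.vertices := fun v => hD.range_eq ▸ Set.mem_range_self v
  have hinv := B.involutive_antipode ha
  have hne : ∀ s ∈ D.faces, s.Nonempty := fun s hs => B.nonempty_of_face ((hD.faces_iff s).1 hs)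
  have himage : ∀ s : Finset V, (s.image a).image a = s := fun s => by
    rw [Finset.image_image, hinv.comp_self, Finset.image_id]
  have hcardim : ∀ s : Finset V, (s.image a).card = s.card := fun s =>
    Finset.card_image_of_injective s hinv.injective
  -- membership in the lists, in barycentric coordinates
  have hL : ∀ d ≤ n, ∀ s : Finset V, s.Nonempty → (s ∈ D.hemi d ↔ stdFace s ⊆ ψ '' H d) := by
    intro d hd s hs
    rw [hD.hemi_iff d hd, hD.faces_iff, B.simplex_subset_iff hs]
  have hLa : ∀ d ≤ n, ∀ s ∈ D.faces, s.image a ∈ D.hemi d ↔ K.simplex (s.map e) ⊆ -H d := by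
    intro d hd s hs
    obtain ⟨h1, h2⟩ := B.image_antipode hK ha ((hD.faces_iff s).1 hs)
    rw [hD.hemi_iff d hd, hD.faces_iff, h2, and_iff_right h1]
    nth_rewrite 1 [← neg_neg (H d)]
    rw [Set.neg_subset_neg]
  have hint : ∀ s ∈ D.faces, ∃ y, y ∈ K.simplex (s.map e) ∧ ψ y ∈ stdFace s ∧
      ∀ v ∈ s, 0 < ψ y v := by
    intro s hs
    obtain ⟨y, hy, hpos⟩ := B.exists_pos ((hD.faces_iff s).1 hs)
    exact ⟨y, (B.mem_simplex_iff s ((hD.faces_iff s).1 hs) y).2 hy, hy, hpos⟩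
  -- a `d`-simplex with an interior point in `H d` or `-H d` lies there
  have hfull : ∀ d ≤ n, ∀ s ∈ D.faces, s.card = d + 1 → ∀ y, ψ y ∈ stdFace s →
      (∀ v ∈ s, 0 < ψ y v) → y ∈ H d ∪ -H d → s ∈ D.hemi d ∨ s.image a ∈ D.hemi d := by
    rintro d hd s hs hcard y hys hpos (hy | hy)
    · exact Or.inl ((hL d hd s (hne s hs)).2
        (stdFace_subset_hemisphere B hK ha hH hd hcard hy hys hpos))
    · right
      have hf := (hD.faces_iff s).1 hs
      exact (hL d hd _ ((hne s hs).image a)).2 (stdFace_subset_hemisphere B hK ha hH hd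
        ((hcardim s).trans hcard) hy (B.neg_mem_stdFace hK ha hf hys) (B.neg_pos hK ha hf hys hpos))
  have hcard : ∀ d ≤ n, ∀ s ∈ D.faces, ∀ y, (∀ v ∈ s, 0 < ψ y v) → y ∈ H d → s.card ≤ d + 1 := by
    intro d hd s hs y hpos hy
    obtain ⟨t', ht', hcard, hyt⟩ := hH.2 d hd hy
    obtain ⟨t, rfl⟩ := exists_map_eq_of_mem_faces hD.range_eq ht'
    rw [B.mem_simplex_iff t ht'] at hyt
    rw [Finset.card_map] at hcard
    exact (Finset.card_le_card (subset_of_pos_of_mem_stdFace hyt hpos)).trans hcard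
  have hmemH : ∀ d ≤ n, ∀ s ∈ D.hemi d, s ∈ D.faces ∧ K.simplex (s.map e) ⊆ H d :=
    fun d hd s hs => (hD.hemi_iff d hd s).1 hs
  -- the point of a face of `H (d + 1)` at which its facet relations are read off
  have hkey : ∀ d, d + 1 ≤ n → ∀ s ∈ D.hemi (d + 1), s.card = d + 1 →
      ∃ (h : EuclideanSpace ℝ (Fin (d + 1)) → V → ℝ) (x : EuclideanSpace ℝ (Fin (d + 1))),
        IsSimplicialBall (d + 1) h ∧ x ∈ closedBall 0 1 ∧ h x ∈ stdFace s ∧ (∀ v ∈ s, 0 < h x v) ∧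
        (‖x‖ = 1 ↔ (s ∈ D.hemi d ∨ s.image a ∈ D.hemi d)) ∧
        {v | v ∉ s ∧ insert v s ∈ D.hemi (d + 1)} =
          {v | v ∉ s ∧ stdFace (insert v s) ⊆ h '' closedBall 0 1} := by
    intro d hd s hs hcs
    obtain ⟨hsf, hsH⟩ := hmemH _ hd s hs
    obtain ⟨y, hy, hys, hpos⟩ := hint s hsf
    obtain ⟨h, hball, himg, hbd⟩ := exists_isSimplicialBall B hK ha hH hd
    obtain ⟨x, hx, hxy⟩ : ψ y ∈ h '' closedBall 0 1 := himg ▸ mem_image_of_mem ψ (hsH hy)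
    refine ⟨h, x, hball, hx, hxy ▸ hys, hxy ▸ hpos, ?_, ?_⟩
    · rw [hbd x hx (by omega), hxy, B.injective.mem_set_image, hH.1.inter d hd]
      refine ⟨hfull d (by omega) s hsf hcs y hys hpos, ?_⟩
      rintro (h1 | h1)
      · exact Or.inl ((hmemH d (by omega) s h1).2 hy)
      · exact Or.inr ((hLa d (by omega) s hsf).1 h1 hy)
    · ext v
      simp only [mem_ofPred_eq, and_congr_right_iff]
      intro _
      rw [hL _ hd _ (Finset.insert_nonempty v s), himg]
  refine ⟨hne, ?_, hinv, ?_, ?_, ?_, fun d hd s hs => (hmemH d hd s hs).1, ?_, ?_, ?_, ?_, ?_, ?_,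
    ?_, ?_, ?_, ?_⟩
  · intro s hs t hts ht
    rw [hD.faces_iff] at hs ⊢
    exact B.face_mono hs hts ht
  · intro s hs
    rw [hD.faces_iff] at hs ⊢
    exact (B.image_antipode hK ha hs).1
  · intro v
    have := hanti (e v) (hvert v) (e (a v)) (hvert _) (ha v)
    rw [hD.label_eq, hD.label_eq]
    linarith
  · intro s hs v hv w hw
    rw [hD.label_eq, hD.label_eq]
    by_cases hvw : v = w
    · subst hvw
      have := (hm (e v) (hvert v)).1
      intro h0
      have h1 : label (e v) = 0 := by omega
      simp [h1] at this
    · exact hcompl _ ((hD.faces_iff s).1 hs) _ (Finset.mem_map_of_mem e hv) _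
        (Finset.mem_map_of_mem e hw) fun h => hvw (e.injective h)
  · intro d hd s hs t hts ht
    have hsne := ht.mono hts
    rw [hL d hd s hsne] at hs
    rw [hL d hd t ht]
    exact (stdFace_mono hts).trans hs
  · intro d hd s hs
    have hsf := hmemH d (by omega) s hs
    exact (hD.hemi_iff _ hd s).2 ⟨hsf.1, hsf.2.trans (hH.1.mono d hd)⟩
  · intro d hd s hs
    have hsf := hmemH d (by omega) s hs
    rw [hLa _ hd s hsf.1]
    refine hsf.2.trans ?_
    rw [← neg_neg (H d), Set.neg_subset_neg]
    exact hemisphere_subset hH.1 hd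
  · intro d hd s hs
    obtain ⟨hsf, hsH⟩ := hmemH d hd s hs
    obtain ⟨y, hy, -, hpos⟩ := hint s hsf
    exact hcard d hd s hsf y hpos (hsH hy)
  · intro d hd s hs hsa
    obtain ⟨hsf, hsH⟩ := hmemH d hd s hs
    obtain ⟨y, hy, hys, hpos⟩ := hint s hsf
    have hyH := hsH hy
    have hyH' := (hLa d hd s hsf).1 hsa hy
    cases d with
    | zero =>
      exfalso
      obtain ⟨g, -⟩ := hH.1.ball 0 hd
      have hsub : Subsingleton (H 0) := g.symm.injective.subsingleton
      have : y = -y := Subtype.ext_iff.1 (Subsingleton.elim (⟨y, hyH⟩ : H 0) ⟨-y, hyH'⟩)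
      exact ne_neg_of_mem_unit_sphere ℝ y this
    | succ d =>
      have : y ∈ H d ∪ -H d := by rw [← hH.1.inter d hd]; exact ⟨hyH, hyH'⟩
      rcases this with h | h
      · exact hcard d (by omega) s hsf y hpos h
      · rw [← hcardim s]
        have hf := (hD.faces_iff s).1 hsf
        exact hcard d (by omega) _ ((hD.faces_iff _).2 (B.image_antipode hK ha hf).1) (-y)
          (B.neg_pos hK ha hf hys hpos) h
  · intro d hd s hs hsa hcs
    obtain ⟨hsf, hsH⟩ := hmemH _ hd s hs
    obtain ⟨y, hy, hys, hpos⟩ := hint s hsf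
    refine hfull d (by omega) s hsf hcs y hys hpos ?_
    rw [← hH.1.inter d hd]
    exact ⟨hsH hy, (hLa _ hd s hsf).1 hsa hy⟩
  · intro s hs hcs
    obtain ⟨y, -, hys, hpos⟩ := hint s hs
    exact hfull n le_rfl s hs hcs y hys hpos (by rw [hH.1.cover]; trivial)
  · obtain ⟨g, -⟩ := hH.1.ball 0 (Nat.zero_le n)
    have hsub : Subsingleton (H 0) := g.symm.injective.subsingleton
    obtain ⟨y, hy⟩ := g ⟨0, by simp⟩
    obtain ⟨T, hT, hTcard, hyT⟩ := hH.2 0 (Nat.zero_le n) hy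
    obtain ⟨t, rfl⟩ := exists_map_eq_of_mem_faces hD.range_eq hT
    rw [B.mem_simplex_iff t hT] at hyT
    obtain ⟨v, hv⟩ : ∃ v, t = {v} := by
      rw [← Finset.card_eq_one]
      have := (B.nonempty_of_face hT).card_pos
      rw [Finset.card_map] at hTcard
      omega
    subst hv
    have hyv : 0 < ψ y v := by
      have := sum_eq_one_of_mem_stdFace hyT
      rw [Finset.sum_singleton] at this
      rw [this]; exact one_pos
    have hv0 : {v} ∈ D.hemi 0 := by
      rw [hL 0 (Nat.zero_le n) _ (Finset.singleton_nonempty v)]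
      exact stdFace_subset_hemisphere B hK ha hH (Nat.zero_le n) (by simp) hy hyT (by simpa)
    refine ⟨v, fun s => ⟨fun hs => ?_, fun hs => hs ▸ hv0⟩⟩
    obtain ⟨hsf, hsH⟩ := hmemH 0 (Nat.zero_le n) s hs
    obtain ⟨z, hz, hzs, hpos⟩ := hint s hsf
    have hzy : z = y := Subtype.ext_iff.1 (Subsingleton.elim (⟨z, hsH hz⟩ : H 0) ⟨y, hy⟩)
    subst hzy
    exact ((Finset.subset_singleton_iff.1 (subset_of_pos_of_mem_stdFace hyT hpos))).resolve_left
      (hne s hsf).ne_empty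
  · intro d hd s hs hcs h1 h2
    obtain ⟨h, x, hball, hx, hxs, hpos, hiff, hset⟩ := hkey d hd s hs hcs
    rw [hset]
    refine hball.ncard_insert_eq_two (lt_of_le_of_ne (by simpa using hx) fun h3 => ?_) hcs hxs hpos
    exact (hiff.1 h3).elim h1 h2
  · intro d hd s hs hcs h1
    obtain ⟨h, x, hball, hx, hxs, hpos, hiff, hset⟩ := hkey d hd s hs hcs
    rw [hset]
    exact hball.ncard_insert_eq_one (hiff.2 h1) hcs hxs hpos

/-- The vertices are enumerated by an initial segment of the natural numbers. -/
lemma exists_describes (hK : K.IsSymmetric) (H : ℕ → Set (Sphere n)) (label : E → ℤ) :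
    ∃ (N : ℕ) (D : Input (Fin N)) (e : Fin N ↪ E), D.Describes K H label e := by
  classical
  have hfin : K.complex.vertices.Finite := by
    rw [K.complex.vertices_eq]
    exact K.finite.biUnion fun s _ => s.finite_toSet
  let f := hfin.toFinset.equivFin.symm
  let e : Fin hfin.toFinset.card ↪ E := f.toEmbedding.trans (Function.Embedding.subtype _)
  have he : Set.range e = K.complex.vertices := by
    have : (e : _ → E) = Subtype.val ∘ f := rfl
    rw [this, f.surjective.range_comp]
    simp
  obtain ⟨ψ, B⟩ := exists_isBarycentric K e he
  choose a ha using fun v => B.exists_antipode hK v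
  refine ⟨_, ⟨(Finset.univ.filter fun s => s.map e ∈ K.complex.faces).toList,
    fun d => (Finset.univ.filter fun s =>
      s.map e ∈ K.complex.faces ∧ K.simplex (s.map e) ⊆ H d).toList, a, label ∘ e⟩, e,
    he, by simp, by simp, ha, fun _ => rfl⟩

end Geometry

/-! ### Alternating facets -/

section Alternating

variable {V : Type*} {label : V → ℤ} {ε δ : ℤˣ} {s t : Finset V}

/-- The number of vertices of `s` whose label is smaller in magnitude than that of `v`. -/
def rank (label : V → ℤ) (s : Finset V) (v : V) : ℕ :=
  (s.filter fun w => |label w| < |label v|).card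

lemma isAlternating_iff_rank : IsAlternating label ε s ↔ s.Nonempty ∧
    (∀ v ∈ s, ∀ w ∈ s, |label v| = |label w| → v = w) ∧
    ∀ v ∈ s, (label v).sign = (ε : ℤ) * (-1) ^ rank label s v := Iff.rfl

lemma IsAlternating.sign_unique (h : IsAlternating label ε s) (h' : IsAlternating label δ s) :
    ε = δ := by
  obtain ⟨v, hv⟩ := h.1
  have h1 := (h.2.2 v hv).symm.trans (h'.2.2 v hv)
  exact Units.ext (mul_right_cancel₀ (pow_ne_zero _ (by norm_num)) h1)

lemma isAlternating_map {W : Type*} (e : V ↪ W) {label : W → ℤ} :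
    IsAlternating label ε (s.map e) ↔ IsAlternating (fun v => label (e v)) ε s := by
  simp [IsAlternating, Finset.filter_map]

variable [DecidableEq V]

lemma IsAlternating.image_neg {a : V → V} (ha : Function.Injective a)
    (hlabel : ∀ v, label (a v) = -label v) (h : IsAlternating label ε s) :
    IsAlternating label (-ε) (s.image a) := by
  have h1 : s.image a = s.map ⟨a, ha⟩ := by rw [Finset.map_eq_image]; rfl
  rw [h1, isAlternating_map]
  simp only [Function.Embedding.coeFn_mk, hlabel]
  refine ⟨h.1, by simpa using h.2.1, fun v hv => ?_⟩
  simp only [abs_neg, Int.sign_neg, Units.val_neg, neg_mul]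
  rw [h.2.2 v hv]

lemma rank_insert {v : V} (hv : v ∉ t) (x : V) :
    rank label (insert v t) x = rank label t x + if |label v| < |label x| then 1 else 0 := by
  unfold rank
  rw [Finset.filter_insert]
  split_ifs
  · rw [Finset.card_insert_of_notMem (by simp [hv])]
  · rfl

lemma rank_erase {u : V} (hu : u ∈ t) (x : V) :
    rank label (t.erase u) x + (if |label u| < |label x| then 1 else 0) = rank label t x := by
  have := rank_insert (label := label) (Finset.notMem_erase u t) x
  rw [Finset.insert_erase hu] at this
  exact this.symm

lemma neg_one_pow_add_ite (k : ℕ) (p : Prop) [Decidable p] :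
    (-1 : ℤ) ^ (k + if p then 1 else 0) = if p then -(-1) ^ k else (-1) ^ k := by
  split_ifs
  · rw [pow_succ]; ring
  · rfl

lemma unit_mul_pow_ne_zero (ε : ℤˣ) (k : ℕ) : (ε : ℤ) * (-1) ^ k ≠ 0 :=
  mul_ne_zero ε.ne_zero (pow_ne_zero _ (by norm_num))

/-- Deleting a vertex from an alternating simplex flips the signs of the vertices above it. -/
lemma IsAlternating.erase_iff (h : IsAlternating label δ s) {v : V} (hv : v ∈ s)
    (hs : 2 ≤ s.card) : IsAlternating label ε (s.erase v) ↔
      ∀ x ∈ s, x ≠ v → (ε : ℤ) = if |label v| < |label x| then -(δ : ℤ) else δ := by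
  have hkey : ∀ x ∈ s, ((label x).sign = (ε : ℤ) * (-1) ^ rank label (s.erase v) x ↔
      (ε : ℤ) = if |label v| < |label x| then -(δ : ℤ) else δ) := by
    intro x hx
    rw [h.2.2 x hx, ← rank, ← rank_erase hv x, neg_one_pow_add_ite]
    have hne : (-1 : ℤ) ^ rank label (s.erase v) x ≠ 0 := pow_ne_zero _ (by norm_num)
    split_ifs
    · rw [mul_neg, ← neg_mul, mul_left_inj' hne, eq_comm]
    · rw [mul_left_inj' hne, eq_comm]
  rw [isAlternating_iff_rank]
  constructor
  · rintro ⟨-, -, h3⟩ x hx hxv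
    exact (hkey x hx).1 (h3 x (Finset.mem_erase.2 ⟨hxv, hx⟩))
  · intro h3
    refine ⟨Finset.card_pos.1 (by rw [Finset.card_erase_of_mem hv]; omega), ?_, ?_⟩
    · intro x hx y hy hxy
      exact h.2.1 x (Finset.mem_of_mem_erase hx) y (Finset.mem_of_mem_erase hy) hxy
    · intro x hx
      exact (hkey x (Finset.mem_of_mem_erase hx)).2
        (h3 x (Finset.mem_of_mem_erase hx) (Finset.ne_of_mem_erase hx))

/-- An alternating simplex of positive dimension has one alternating facet of each sign: the facet
opposite to its largest label has the same sign, the one opposite to its smallest label has the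
other sign. -/
lemma IsAlternating.card_facets (h : IsAlternating label δ s) (hs : 2 ≤ s.card) (ε : ℤˣ) :
    (s.filter fun v => IsAlternating label ε (s.erase v)).card = 1 := by
  rw [Finset.card_eq_one]
  have hδ0 : (δ : ℤ) ≠ 0 := δ.ne_zero
  have hlt : ∀ x ∈ s, ∀ y ∈ s, x ≠ y → |label x| ≠ |label y| := fun x hx y hy hne he =>
    hne (h.2.1 x hx y hy he)
  rcases Int.units_eq_one_or (ε * δ) with hεδ | hεδ
  · have hε : ε = δ := by rw [← mul_inv_eq_one, Int.units_inv_eq_self, hεδ]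
    subst hε
    obtain ⟨v, hv, hmax⟩ := s.exists_max_image (fun v => |label v|) h.1
    refine ⟨v, Finset.ext fun u => ?_⟩
    rw [Finset.mem_filter, Finset.mem_singleton]
    constructor
    · rintro ⟨hu, hau⟩
      by_contra hne
      have h1 := (h.erase_iff hu hs).1 hau v hv (Ne.symm hne)
      have h2 := hmax u hu
      rw [if_pos (lt_of_le_of_ne h2 (hlt u hu v hv hne))] at h1
      omega
    · rintro rfl
      refine ⟨hv, (h.erase_iff hv hs).2 fun x hx _ => ?_⟩
      rw [if_neg (not_lt.2 (hmax x hx))]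
  · have hε : (ε : ℤ) = -(δ : ℤ) := by
      have : ε = -δ := by
        rw [← mul_one ε, ← Int.units_mul_self δ, ← mul_assoc, hεδ, neg_one_mul]
      rw [this, Units.val_neg]
    obtain ⟨v, hv, hmin⟩ := s.exists_min_image (fun v => |label v|) h.1
    refine ⟨v, Finset.ext fun u => ?_⟩
    rw [Finset.mem_filter, Finset.mem_singleton]
    constructor
    · rintro ⟨hu, hau⟩
      by_contra hne
      have h1 := (h.erase_iff hu hs).1 hau v hv (Ne.symm hne)
      rw [if_neg (not_lt.2 (hmin u hu))] at h1
      omega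
    · rintro rfl
      refine ⟨hv, (h.erase_iff hv hs).2 fun x hx hxv => ?_⟩
      rw [if_pos (lt_of_le_of_ne (hmin x hx) (hlt u hv x hx hxv.symm)), hε]

/-- Replacing the vertex `u` of an alternating simplex by `v` gives an alternating simplex of the
same sign if and only if `v` has the sign that its place requires and no other vertex separates `v`
from `u`. -/
lemma IsAlternating.exchange_iff (h : IsAlternating label ε t) {u v : V} (hu : u ∈ t)
    (hv : v ∉ t) : IsAlternating label ε (insert v (t.erase u)) ↔
      (label v).sign = (ε : ℤ) * (-1) ^ rank label (t.erase u) v ∧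
      ∀ x ∈ t, x ≠ u → |label x| ≠ |label v| ∧ (|label u| < |label x| ↔ |label v| < |label x|) := by
  have hv' : v ∉ t.erase u := fun h' => hv (Finset.mem_of_mem_erase h')
  have hself : rank label (insert v (t.erase u)) v = rank label (t.erase u) v := by
    rw [rank_insert hv', if_neg (lt_irrefl _), add_zero]
  have hkey : ∀ x ∈ t, ((label x).sign = (ε : ℤ) * (-1) ^ rank label (insert v (t.erase u)) x ↔
      (|label u| < |label x| ↔ |label v| < |label x|)) := by
    intro x hx
    rw [h.2.2 x hx, ← rank, ← rank_erase hu x, rank_insert hv', neg_one_pow_add_ite,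
      neg_one_pow_add_ite]
    have hne := unit_mul_pow_ne_zero ε (rank label (t.erase u) x)
    split_ifs with h1 h2 h2 <;> simp only [h1, h2, mul_neg] <;> simp <;> omega
  rw [isAlternating_iff_rank]
  constructor
  · rintro ⟨-, h2, h3⟩
    refine ⟨hself ▸ h3 v (Finset.mem_insert_self _ _), fun x hx hxu => ⟨fun heq => ?_, ?_⟩⟩
    · have := h2 x (Finset.mem_insert_of_mem (Finset.mem_erase.2 ⟨hxu, hx⟩)) v
        (Finset.mem_insert_self _ _) heq
      exact hv (this ▸ hx)
    · exact (hkey x hx).1 (h3 x (Finset.mem_insert_of_mem (Finset.mem_erase.2 ⟨hxu, hx⟩)))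
  · rintro ⟨h1, h2⟩
    refine ⟨Finset.insert_nonempty _ _, ?_, ?_⟩
    · intro x hx y hy hxy
      rcases Finset.mem_insert.1 hx with rfl | hx' <;> rcases Finset.mem_insert.1 hy with rfl | hy'
      · rfl
      · exact absurd hxy.symm (h2 y (Finset.mem_of_mem_erase hy') (Finset.ne_of_mem_erase hy')).1
      · exact absurd hxy (h2 x (Finset.mem_of_mem_erase hx') (Finset.ne_of_mem_erase hx')).1
      · exact h.2.1 x (Finset.mem_of_mem_erase hx') y (Finset.mem_of_mem_erase hy') hxy
    · intro x hx
      rcases Finset.mem_insert.1 hx with rfl | hx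
      · rw [hself, h1]
      · exact (hkey x (Finset.mem_of_mem_erase hx)).2
          (h2 x (Finset.mem_of_mem_erase hx) (Finset.ne_of_mem_erase hx)).2

lemma IsAlternating.insert_above (h : IsAlternating label ε t) {v : V} (hv : v ∉ t)
    (habove : ∀ x ∈ t, |label x| < |label v|)
    (hsign : (label v).sign = (ε : ℤ) * (-1) ^ rank label t v) :
    IsAlternating label ε (insert v t) := by
  refine isAlternating_iff_rank.2 ⟨Finset.insert_nonempty _ _, ?_, ?_⟩
  · intro x hx y hy hxy
    rcases Finset.mem_insert.1 hx with rfl | hx' <;> rcases Finset.mem_insert.1 hy with rfl | hy'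
    · rfl
    · exact absurd hxy.symm (habove y hy').ne
    · exact absurd hxy (habove x hx').ne
    · exact h.2.1 x hx' y hy' hxy
  · intro x hx
    rw [rank_insert hv]
    rcases Finset.mem_insert.1 hx with rfl | hx
    · simpa using hsign
    · rw [if_neg (habove x hx).not_gt, add_zero]
      exact h.2.2 x hx

lemma IsAlternating.insert_below (h : IsAlternating label ε t) {v : V} (hv : v ∉ t)
    (hbelow : ∀ x ∈ t, |label v| < |label x|) (hsign : (label v).sign = -(ε : ℤ)) :
    IsAlternating label (-ε) (insert v t) := by
  refine isAlternating_iff_rank.2 ⟨Finset.insert_nonempty _ _, ?_, ?_⟩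
  · intro x hx y hy hxy
    rcases Finset.mem_insert.1 hx with rfl | hx' <;> rcases Finset.mem_insert.1 hy with rfl | hy'
    · rfl
    · exact absurd hxy (hbelow y hy').ne
    · exact absurd hxy.symm (hbelow x hx').ne
    · exact h.2.1 x hx' y hy' hxy
  · intro x hx
    rw [rank_insert hv, neg_one_pow_add_ite]
    rcases Finset.mem_insert.1 hx with rfl | hx
    · have : rank label t x = 0 := by
        rw [rank, Finset.card_eq_zero, Finset.filter_eq_empty_iff]
        exact fun y hy => (hbelow y hy).not_gt
      simp [this, hsign]
    · rw [if_pos (hbelow x hx), h.2.2 x hx, ← rank, Units.val_neg]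
      ring

/-- A simplex that is not alternating, but has an alternating facet of sign `ε`, has exactly two
such facets: the second one is opposite to the neighbour, in the order of magnitudes, whose label
has the same sign as the vertex opposite to the first one. -/
lemma card_facets_of_not_isAlternating (hnot : ∀ δ : ℤˣ, ¬ IsAlternating label δ s)
    (hcompl : ∀ v ∈ s, ∀ w ∈ s, label v + label w ≠ 0) {v : V} (hv : v ∈ s)
    (h : IsAlternating label ε (s.erase v)) :
    (s.filter fun v => IsAlternating label ε (s.erase v)).card = 2 := by
  set t := s.erase v with ht
  have hvt : v ∉ t := Finset.notMem_erase v s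
  have hst : s = insert v t := (Finset.insert_erase hv).symm
  have hsub : ∀ x ∈ t, x ∈ s := fun x hx => Finset.mem_of_mem_erase hx
  have herase : ∀ u ∈ t, s.erase u = insert v (t.erase u) := by
    intro u hu
    have : v ≠ u := fun h => hvt (h ▸ hu)
    rw [hst, Finset.erase_insert_of_ne this]
  have hε0 : (ε : ℤ) ≠ 0 := ε.ne_zero
  have hsign : (label v).sign = (ε : ℤ) * (-1) ^ rank label t v ∨
      (label v).sign = -((ε : ℤ) * (-1) ^ rank label t v) := by
    have h0 : label v ≠ 0 := by
      have := hcompl v hv v hv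
      omega
    have h1 : (ε : ℤ) * (-1) ^ rank label t v = 1 ∨ (ε : ℤ) * (-1) ^ rank label t v = -1 := by
      rcases Int.units_eq_one_or ε with rfl | rfl <;>
        rcases neg_one_pow_eq_or ℤ (rank label t v) with h | h <;> simp [h]
    rcases lt_or_gt_of_ne h0 with h2 | h2
    · rw [Int.sign_eq_neg_one_of_neg h2]; omega
    · rw [Int.sign_eq_one_of_pos h2]; omega
  -- the vertex opposite to the second facet
  obtain ⟨u, hu, huv⟩ : ∃ u ∈ t, IsAlternating label ε (insert v (t.erase u)) := by
    by_cases htie : ∃ u ∈ t, |label u| = |label v|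
    · obtain ⟨u, hu, heq⟩ := htie
      have hluv : label u = label v := by
        rcases abs_eq_abs.1 heq with h1 | h1
        · exact h1
        · exact absurd (by omega) (hcompl u (hsub u hu) v hv)
      refine ⟨u, hu, (h.exchange_iff hu hvt).2 ⟨?_, fun x hx hxu => ⟨fun hxv => ?_, ?_⟩⟩⟩
      · have h1 := rank_erase (label := label) hu v
        rw [heq, if_neg (lt_irrefl _), add_zero] at h1
        have h2 : rank label t u = rank label t v := by simp only [rank, heq]
        rw [h1, ← h2, ← hluv]
        exact h.2.2 u hu
      · exact hxu (h.2.1 x hx u hu (hxv.trans heq.symm))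
      · rw [heq]
    push Not at htie
    rcases hsign with hsign | hsign
    · have hne : (t.filter fun x => |label v| < |label x|).Nonempty := by
        by_contra hemp
        rw [Finset.not_nonempty_iff_eq_empty, Finset.filter_eq_empty_iff] at hemp
        refine hnot ε (hst ▸ h.insert_above hvt (fun x hx => ?_) hsign)
        exact lt_of_le_of_ne (not_lt.1 (hemp hx)) (htie x hx)
      obtain ⟨u, hu, hmin⟩ := Finset.exists_min_image _ (fun x => |label x|) hne
      obtain ⟨hut, hvu⟩ := Finset.mem_filter.1 hu
      refine ⟨u, hut, (h.exchange_iff hut hvt).2 ⟨?_, fun x hx hxu => ⟨htie x hx, ?_⟩⟩⟩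
      · have h1 := rank_erase (label := label) hut v
        rw [if_neg hvu.not_gt, add_zero] at h1
        rw [h1, hsign]
      · refine ⟨fun h1 => hvu.trans h1, fun h1 => lt_of_le_of_ne
          (hmin x (Finset.mem_filter.2 ⟨hx, h1⟩)) fun h2 => hxu (h.2.1 x hx u hut h2.symm)⟩
    · have hne : (t.filter fun x => |label x| < |label v|).Nonempty := by
        by_contra hemp
        rw [Finset.not_nonempty_iff_eq_empty] at hemp
        have h0 : rank label t v = 0 := by rw [rank, hemp, Finset.card_empty]
        rw [Finset.filter_eq_empty_iff] at hemp
        refine hnot (-ε) (hst ▸ h.insert_below hvt (fun x hx => ?_) (by simpa [h0] using hsign))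
        exact lt_of_le_of_ne (not_lt.1 (hemp hx)) (htie x hx).symm
      obtain ⟨u, hu, hmax⟩ := Finset.exists_max_image _ (fun x => |label x|) hne
      obtain ⟨hut, hvu⟩ := Finset.mem_filter.1 hu
      refine ⟨u, hut, (h.exchange_iff hut hvt).2 ⟨?_, fun x hx hxu => ⟨htie x hx, ?_⟩⟩⟩
      · have h1 := rank_erase (label := label) hut v
        rw [if_pos hvu] at h1
        rw [hsign, ← h1, pow_succ]
        ring
      · refine ⟨fun h1 => ?_, fun h1 => hvu.trans h1⟩
        by_contra h2
        have h3 := hmax x (Finset.mem_filter.2 ⟨hx, lt_of_le_of_ne (not_lt.1 h2) (htie x hx)⟩)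
        exact absurd h1 (not_lt.2 h3)
  have huniq : ∀ u' ∈ t, IsAlternating label ε (insert v (t.erase u')) → u' = u := by
    intro u' hu' hu'v
    by_contra hne
    obtain ⟨h1, h2⟩ := (h.exchange_iff hu hvt).1 huv
    obtain ⟨h1', h2'⟩ := (h.exchange_iff hu' hvt).1 hu'v
    obtain ⟨h3, h4⟩ := h2 u' hu' hne
    obtain ⟨h3', h4'⟩ := h2' u hu (Ne.symm hne)
    have h5 := rank_erase (label := label) hu v
    have h5' := rank_erase (label := label) hu' v
    -- the vertex `v` lies strictly between `u` and `u'`, so that the two signs required differ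
    have h6 : (|label u| < |label v|) ↔ ¬ (|label u'| < |label v|) := by
      have h8 : |label u| ≠ |label u'| := fun h8 => hne (h.2.1 u hu u' hu' h8).symm
      omega
    have h7 := h1.symm.trans h1'
    have h0 := unit_mul_pow_ne_zero ε (rank label (t.erase u) v)
    have h0' := unit_mul_pow_ne_zero ε (rank label (t.erase u') v)
    by_cases h9 : |label u| < |label v|
    · rw [if_pos h9] at h5
      rw [if_neg (h6.1 h9)] at h5'
      rw [show rank label (t.erase u') v = rank label (t.erase u) v + 1 by omega, pow_succ] at h7
      apply h0
      linarith
    · rw [if_neg h9] at h5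
      rw [if_pos (not_not.1 fun h10 => h9 (h6.2 h10))] at h5'
      rw [show rank label (t.erase u) v = rank label (t.erase u') v + 1 by omega, pow_succ] at h7
      apply h0'
      linarith
  rw [Finset.card_eq_two]
  refine ⟨v, u, fun h => hvt (h ▸ hu), Finset.ext fun x => ?_⟩
  rw [Finset.mem_filter, Finset.mem_insert, Finset.mem_singleton]
  constructor
  · rintro ⟨hx, hax⟩
    by_cases hxv : x = v
    · exact Or.inl hxv
    · have hxt : x ∈ t := Finset.mem_erase.2 ⟨hxv, hx⟩
      exact Or.inr (huniq x hxt (herase x hxt ▸ hax))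
  · rintro (rfl | rfl)
    · exact ⟨hv, h⟩
    · exact ⟨hsub _ hu, herase _ hu ▸ huv⟩

end Alternating

/-! ### The degrees of the graph -/

namespace Input

variable {V : Type*} [DecidableEq V] {D : Input V} {n : ℕ} {s t : Finset V} {ε δ : ℤˣ} {d c : ℕ}

lemma liesIn_one : D.LiesIn 1 d s ↔ s ∈ D.hemi d := by simp [LiesIn]

lemma liesIn_neg_one : D.LiesIn (-1) d s ↔ s.image D.antipode ∈ D.hemi d := by
  simp [LiesIn, show (-1 : ℤˣ) ≠ 1 by decide]

namespace IsFlagged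

lemma image_image (hF : D.IsFlagged n) (s : Finset V) :
    (s.image D.antipode).image D.antipode = s := by
  rw [Finset.image_image, hF.involutive.comp_self, Finset.image_id]

lemma card_image (hF : D.IsFlagged n) (s : Finset V) : (s.image D.antipode).card = s.card :=
  Finset.card_image_of_injective s hF.involutive.injective

lemma liesIn_image (hF : D.IsFlagged n) :
    D.LiesIn ε d (s.image D.antipode) ↔ D.LiesIn (-ε) d s := by
  rcases Int.units_eq_one_or ε with rfl | rfl
  · rw [liesIn_one, liesIn_neg_one]
  · rw [neg_neg, liesIn_one, liesIn_neg_one, hF.image_image]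

lemma hasCarrier_image (hF : D.IsFlagged n) :
    D.HasCarrier ε d (s.image D.antipode) ↔ D.HasCarrier (-ε) d s := by
  simp only [HasCarrier, hF.liesIn_image]
  refine and_congr_right fun _ => ⟨fun h c hc δ => ?_, fun h c hc δ => h c hc (-δ)⟩
  have := h c hc (-δ)
  rwa [neg_neg] at this

lemma isAlternating_image (hF : D.IsFlagged n) :
    IsAlternating D.label ε (s.image D.antipode) ↔ IsAlternating D.label (-ε) s := by
  constructor
  · intro h
    have := h.image_neg hF.involutive.injective hF.label_antipode
    rwa [hF.image_image] at this
  · intro h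
    have := h.image_neg hF.involutive.injective hF.label_antipode
    rwa [neg_neg] at this

lemma mem_faces_of_liesIn (hF : D.IsFlagged n) (hd : d ≤ n) (h : D.LiesIn ε d s) :
    s ∈ D.faces := by
  rcases Int.units_eq_one_or ε with rfl | rfl
  · exact hF.mem_faces d hd s (liesIn_one.1 h)
  · rw [← hF.image_image s]
    exact hF.image_mem _ (hF.mem_faces d hd _ (liesIn_neg_one.1 h))

lemma card_le_of_liesIn (hF : D.IsFlagged n) (hd : d ≤ n) (h : D.LiesIn ε d s) :
    s.card ≤ d + 1 := by
  rcases Int.units_eq_one_or ε with rfl | rfl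
  · exact hF.card_le d hd s (liesIn_one.1 h)
  · rw [← hF.card_image s]
    exact hF.card_le d hd _ (liesIn_neg_one.1 h)

lemma liesIn_mono (hF : D.IsFlagged n) (hd : d ≤ n) (h : D.LiesIn ε d s) (hts : t ⊆ s)
    (ht : t.Nonempty) : D.LiesIn ε d t := by
  rcases Int.units_eq_one_or ε with rfl | rfl
  · exact liesIn_one.2 (hF.hemi_mono d hd s (liesIn_one.1 h) t hts ht)
  · exact liesIn_neg_one.2 (hF.hemi_mono d hd _ (liesIn_neg_one.1 h) _
      (Finset.image_subset_image hts) (ht.image _))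

lemma liesIn_succ (hF : D.IsFlagged n) (hd : d + 1 ≤ n) (h : D.LiesIn δ d s) (ε : ℤˣ) :
    D.LiesIn ε (d + 1) s := by
  rcases Int.units_eq_one_or ε with rfl | rfl <;> rcases Int.units_eq_one_or δ with rfl | rfl <;>
    simp only [liesIn_one, liesIn_neg_one] at h ⊢
  · exact hF.hemi_succ d hd s h
  · have := hF.antipode_hemi_succ d hd _ h
    rwa [hF.image_image] at this
  · exact hF.antipode_hemi_succ d hd s h
  · exact hF.hemi_succ d hd _ h

/-- A simplex whose dimension is that of a hemisphere containing it has that hemisphere as its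
carrier. -/
lemma hasCarrier_of_card (hF : D.IsFlagged n) (hd : d ≤ n) (h : D.LiesIn ε d s)
    (hs : s.card = d + 1) : D.HasCarrier ε d s := by
  refine ⟨h, fun c hc δ hcs => ?_⟩
  have := hF.card_le_of_liesIn (by omega) hcs
  omega

lemma eq_of_hasCarrier_of_liesIn (hF : D.IsFlagged n) (hd : d ≤ n) (h : D.HasCarrier ε d s)
    (hs : d ≤ s.card) (h' : D.LiesIn δ d s) : δ = ε := by
  by_contra hne
  have hboth : s ∈ D.hemi d ∧ s.image D.antipode ∈ D.hemi d := by
    have h1 := h.1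
    rcases Int.units_eq_one_or ε with rfl | rfl <;> rcases Int.units_eq_one_or δ with rfl | rfl <;>
      simp only [liesIn_one, liesIn_neg_one] at h1 h'
    · exact absurd rfl hne
    · exact ⟨h1, h'⟩
    · exact ⟨h', h1⟩
    · exact absurd rfl hne
  have hcard := hF.card_le_of_antipode d hd s hboth.1 hboth.2
  have hpos := (hF.nonempty s (hF.mem_faces d hd s hboth.1)).card_pos
  obtain ⟨d, rfl⟩ : ∃ c, d = c + 1 := ⟨d - 1, by omega⟩
  rcases hF.boundary d hd s hboth.1 hboth.2 (by omega) with h1 | h1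
  · exact h.2 d (by omega) 1 (liesIn_one.2 h1)
  · exact h.2 d (by omega) (-1) (liesIn_neg_one.2 h1)

lemma hasCarrier_unique (hF : D.IsFlagged n) (hd : d ≤ n) (h : D.HasCarrier ε d s)
    (hs : d ≤ s.card) (h' : D.HasCarrier δ c s) : c = d ∧ δ = ε := by
  have hcd : c = d := by
    rcases lt_trichotomy c d with h1 | h1 | h1
    · exact absurd h'.1 (h.2 c h1 δ)
    · exact h1
    · exact absurd h.1 (h'.2 d h1 ε)
  subst hcd
  exact ⟨rfl, hF.eq_of_hasCarrier_of_liesIn hd h hs h'.1⟩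

lemma ncard_insert (hF : D.IsFlagged n) (hd : d + 1 ≤ n) (h : D.LiesIn ε (d + 1) s)
    (hs : s.card = d + 1) :
    ((∃ δ, D.LiesIn δ d s) → {v | v ∉ s ∧ D.LiesIn ε (d + 1) (insert v s)}.ncard = 1) ∧
    ((∀ δ, ¬ D.LiesIn δ d s) → {v | v ∉ s ∧ D.LiesIn ε (d + 1) (insert v s)}.ncard = 2) := by
  have hbd : ∀ s : Finset V, (∃ δ, D.LiesIn δ d s) ↔
      (s ∈ D.hemi d ∨ s.image D.antipode ∈ D.hemi d) := by
    intro s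
    constructor
    · rintro ⟨δ, hδ⟩
      rcases Int.units_eq_one_or δ with rfl | rfl
      · exact Or.inl (liesIn_one.1 hδ)
      · exact Or.inr (liesIn_neg_one.1 hδ)
    · rintro (h | h)
      · exact ⟨1, liesIn_one.2 h⟩
      · exact ⟨-1, liesIn_neg_one.2 h⟩
  rw [← not_exists, hbd]
  rcases Int.units_eq_one_or ε with rfl | rfl
  · simp only [liesIn_one] at h ⊢
    exact ⟨fun h1 => hF.ncard_eq_one d hd s h hs h1, fun h1 => hF.ncard_eq_two d hd s h hs
      (fun h2 => h1 (Or.inl h2)) fun h2 => h1 (Or.inr h2)⟩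
  · rw [liesIn_neg_one] at h
    have hset : {v | v ∉ s ∧ D.LiesIn (-1) (d + 1) (insert v s)} =
        D.antipode '' {v | v ∉ s.image D.antipode ∧
          insert v (s.image D.antipode) ∈ D.hemi (d + 1)} := by
      ext v
      rw [hF.involutive.image_eq_preimage_symm]
      simp only [Set.mem_ofPred_eq, Set.mem_preimage, liesIn_neg_one, Finset.image_insert,
        Finset.mem_image, hF.involutive.injective.eq_iff, exists_eq_right]
    rw [hset, Set.ncard_image_of_injective _ hF.involutive.injective]
    have hs' := (hF.card_image s).trans hs
    have hswap : (s ∈ D.hemi d ∨ s.image D.antipode ∈ D.hemi d) ↔ (s.image D.antipode ∈ D.hemi d ∨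
        (s.image D.antipode).image D.antipode ∈ D.hemi d) := by rw [hF.image_image, or_comm]
    rw [hswap]
    exact ⟨fun h1 => hF.ncard_eq_one d hd _ h hs' h1, fun h1 => hF.ncard_eq_two d hd _ h hs'
      (fun h2 => h1 (Or.inl h2)) fun h2 => h1 (Or.inr h2)⟩

end IsFlagged

/-- The edge of the graph that leads from `s` up to the simplex `insert v s`. -/
def IsUp (D : Input V) (n : ℕ) (s : Finset V) (v : V) : Prop :=
  v ∉ s ∧ s.card ≤ n ∧ ∃ ε : ℤˣ, IsAlternating D.label ε s ∧ D.LiesIn ε s.card (insert v s)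

lemma Adj.symm (h : D.Adj n s t) : D.Adj n t s := by
  obtain ⟨h1, h2, h3, h4⟩ := h
  refine ⟨h2, h1, h3.symm, ?_⟩
  rwa [Finset.inter_comm, Finset.union_comm]

lemma Adj.card_ne (h : D.Adj n s t) : s.card ≠ t.card := by
  rcases h.2.2.1 with h | h <;> omega

namespace IsFlagged

lemma isNode_of_isUp (hF : D.IsFlagged n) {v : V} (h : D.IsUp n s v) : D.IsNode n s := by
  obtain ⟨hv, hn, ε, halt, hlies⟩ := h
  have hs := hF.liesIn_mono hn hlies (Finset.subset_insert v s) halt.1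
  refine ⟨hF.mem_faces_of_liesIn hn hs, ?_⟩
  by_cases hc : D.HasCarrier ε s.card s
  · exact ⟨s.card, by omega, ε, hc, Or.inl ⟨rfl, halt⟩⟩
  · obtain ⟨c, hcs, δ, hδ⟩ : ∃ c < s.card, ∃ δ, D.LiesIn δ c s := by
      by_contra! hcon
      exact hc ⟨hs, hcon⟩
    have hcard : s.card = c + 1 := by
      have := hF.card_le_of_liesIn (by omega) hδ
      omega
    exact ⟨c, by omega, δ, hF.hasCarrier_of_card (by omega) hδ hcard,
      Or.inr (Or.inr ⟨hcard, ε, halt⟩)⟩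

lemma isNode_insert_of_isUp (hF : D.IsFlagged n) {v : V} (h : D.IsUp n s v) :
    D.IsNode n (insert v s) := by
  obtain ⟨hv, hn, ε, halt, hlies⟩ := h
  have hcard := Finset.card_insert_of_notMem hv
  refine ⟨hF.mem_faces_of_liesIn hn hlies, s.card, by omega, ε,
    hF.hasCarrier_of_card hn hlies hcard, Or.inr ?_⟩
  by_cases hδ : ∃ δ, IsAlternating D.label δ (insert v s)
  · exact Or.inr ⟨hcard, hδ⟩
  · refine Or.inl ⟨hcard, not_exists.1 hδ, v, Finset.mem_insert_self v s, ?_⟩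
    rwa [Finset.erase_insert hv]

lemma adj_insert (hF : D.IsFlagged n) {v : V} (h : D.IsUp n s v) : D.Adj n s (insert v s) := by
  refine ⟨hF.isNode_of_isUp h, hF.isNode_insert_of_isUp h, ?_⟩
  obtain ⟨hv, hn, ε, halt, hlies⟩ := h
  have hcard := Finset.card_insert_of_notMem hv
  refine ⟨Or.inl ⟨Finset.subset_insert v s, hcard⟩, s.card, by omega, ε, ?_⟩
  rw [Finset.inter_eq_left.2 (Finset.subset_insert v s),
    Finset.union_eq_right.2 (Finset.subset_insert v s)]
  exact ⟨halt, hcard, hF.hasCarrier_of_card hn hlies hcard⟩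

lemma adj_iff (hF : D.IsFlagged n) : D.Adj n s t ↔
    (∃ v, D.IsUp n s v ∧ insert v s = t) ∨ ∃ v ∈ s, D.IsUp n (s.erase v) v ∧ s.erase v = t := by
  have hup : ∀ {s t : Finset V}, D.Adj n s t → s ⊆ t → t.card = s.card + 1 →
      ∃ v, D.IsUp n s v ∧ insert v s = t := by
    rintro s t ⟨-, -, -, d, hd, ε, halt, hcard, hcar⟩ hst hts
    obtain ⟨v, hv, rfl⟩ := Finset.exists_eq_insert_iff.2 ⟨hst, hts.symm⟩
    rw [Finset.inter_eq_left.2 hst] at halt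
    rw [Finset.union_eq_right.2 hst] at hcard hcar
    obtain rfl : d = s.card := by omega
    exact ⟨v, ⟨hv, by omega, ε, halt, hcar.1⟩, rfl⟩
  constructor
  · intro h
    rcases h.2.2.1 with ⟨hst, hts⟩ | ⟨hts, hst⟩
    · exact Or.inl (hup h hst hts)
    · obtain ⟨v, hv, rfl⟩ := hup h.symm hts hst
      refine Or.inr ⟨v, Finset.mem_insert_self v t, ?_⟩
      rw [Finset.erase_insert hv.1]
      exact ⟨hv, rfl⟩
  · rintro (⟨v, hv, rfl⟩ | ⟨v, hvs, hv, rfl⟩)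
    · exact hF.adj_insert hv
    · have := (hF.adj_insert hv).symm
      rwa [Finset.insert_erase hvs] at this

lemma ncard_adj [Finite V] (hF : D.IsFlagged n) (s : Finset V) : {t | D.Adj n s t}.ncard =
    {v | D.IsUp n s v}.ncard + {v | v ∈ s ∧ D.IsUp n (s.erase v) v}.ncard := by
  have hset : {t | D.Adj n s t} = (fun v => insert v s) '' {v | D.IsUp n s v} ∪
      (fun v => s.erase v) '' {v | v ∈ s ∧ D.IsUp n (s.erase v) v} := by
    ext t
    rw [Set.mem_ofPred_eq, hF.adj_iff]
    simp [and_assoc]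
  rw [hset, Set.ncard_union_eq]
  · congr 1
    · refine Set.InjOn.ncard_image fun v hv w hw h => ?_
      have h1 : v ∈ insert w s := by
        rw [← show insert v s = insert w s from h]
        exact Finset.mem_insert_self v s
      exact (Finset.mem_insert.1 h1).resolve_right hv.1
    · exact Set.InjOn.ncard_image fun v hv w hw h => Finset.erase_injOn s hv.1 hw.1 h
  · rw [Set.disjoint_left]
    rintro _ ⟨v, -, rfl⟩ ⟨w, hw, h⟩
    have h1 : v ∈ s.erase w := by
      rw [show s.erase w = insert v s from h]
      exact Finset.mem_insert_self v s
    have h2 : w ∈ s.erase w := by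
      rw [show s.erase w = insert v s from h]
      exact Finset.mem_insert_of_mem hw.1
    exact absurd h2 (Finset.notMem_erase w s)

lemma setOf_isUp_of_isAlternating (_ : D.IsFlagged n) (halt : IsAlternating D.label ε s)
    (hn : s.card ≤ n) :
    {v | D.IsUp n s v} = {v | v ∉ s ∧ D.LiesIn ε s.card (insert v s)} := by
  ext v
  constructor
  · rintro ⟨hv, -, δ, hδ, h⟩
    rw [halt.sign_unique hδ]
    exact ⟨hv, h⟩
  · rintro ⟨hv, h⟩
    exact ⟨hv, hn, ε, halt, h⟩

/-- If the carrier of the `d`-simplex `s` is `ε H d`, the downward edges at `s` lead to its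
alternating facets of sign `ε`. -/
lemma ncard_isUp_erase (hF : D.IsFlagged n) (hd : d ≤ n) (hcar : D.HasCarrier ε d s)
    (hs : s.card = d + 1) : {v | v ∈ s ∧ D.IsUp n (s.erase v) v}.ncard =
      (s.filter fun v => IsAlternating D.label ε (s.erase v)).card := by
  rw [← Set.ncard_coe_finset]
  congr 1
  ext v
  simp only [Set.mem_ofPred_eq, Finset.coe_filter]
  refine and_congr_right fun hv => ?_
  have hcard : (s.erase v).card = d := by rw [Finset.card_erase_of_mem hv, hs]; rfl
  constructor
  · rintro ⟨-, -, δ, hδ, hlies⟩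
    rw [Finset.insert_erase hv, hcard] at hlies
    rwa [← hF.eq_of_hasCarrier_of_liesIn hd hcar (by omega) hlies]
  · intro halt
    refine ⟨Finset.notMem_erase v s, by omega, ε, halt, ?_⟩
    rw [Finset.insert_erase hv, hcard]
    exact hcar.1

lemma not_liesIn_zero (_ : D.IsFlagged n) (hcar : D.HasCarrier ε d s) (hd : 0 < d) :
    ¬ ∃ δ, D.LiesIn δ 0 s := fun ⟨δ, hδ⟩ => hcar.2 0 hd δ hδ

/-- Each kind of node has its own two neighbours. An alternating `(d-1)`-simplex with a
`d`-dimensional carrier lies in two `d`-simplices of it. An almost-alternating simplex has two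
alternating facets of its sign. An alternating `d`-simplex with a `d`-dimensional carrier has one
alternating facet of the sign of the carrier, and is a facet of one `(d+1)`-simplex of the
hemisphere with its own sign. The last two fail only for `d = 0` and `d = n`, respectively. -/
theorem degree [Finite V] (hF : D.IsFlagged n) (hn : 1 ≤ n) (hs : D.IsNode n s) :
    ({t | D.Adj n s t}.ncard = 1 ∨ {t | D.Adj n s t}.ncard = 2) ∧
      ({t | D.Adj n s t}.ncard = 1 ↔ (∃ ε : ℤˣ, D.LiesIn ε 0 s) ∨ D.IsGoal n s) := by
  obtain ⟨hface, d, hdn, ε, hcar, hcase⟩ := hs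
  have hd : d ≤ n := by omega
  have hpos := (hF.nonempty s hface).card_pos
  rw [hF.ncard_adj]
  rcases hcase with ⟨hcard, halt⟩ | ⟨hcard, hnot, v, hv, halt⟩ | ⟨hcard, δ, halt⟩
  · obtain ⟨c, rfl⟩ : ∃ c, d = c + 1 := ⟨d - 1, by omega⟩
    have hA : {v | D.IsUp n s v}.ncard = 2 := by
      rw [hF.setOf_isUp_of_isAlternating halt (by omega), hcard]
      exact (hF.ncard_insert hd hcar.1 hcard).2 fun δ => hcar.2 c (by omega) δ
    have hB : {v | v ∈ s ∧ D.IsUp n (s.erase v) v} = ∅ := by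
      rw [Set.eq_empty_iff_forall_notMem]
      rintro v ⟨hv, -, -, δ, -, hlies⟩
      rw [Finset.insert_erase hv, Finset.card_erase_of_mem hv, hcard] at hlies
      exact hcar.2 _ (by omega) δ hlies
    have hgoal : ¬ D.IsGoal n s := fun h => by have := h.1; omega
    have := hF.not_liesIn_zero hcar (by omega)
    simp [hA, hB, hgoal, not_exists.1 this]
  · have hA : {v | D.IsUp n s v} = ∅ := by
      rw [Set.eq_empty_iff_forall_notMem]
      rintro v ⟨-, -, δ, hδ, -⟩
      exact hnot δ hδ
    have hB : {v | v ∈ s ∧ D.IsUp n (s.erase v) v}.ncard = 2 := by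
      rw [hF.ncard_isUp_erase hd hcar hcard]
      exact card_facets_of_not_isAlternating hnot (hF.label_add_ne_zero s hface) hv halt
    have hd0 : 0 < d := by
      have := halt.1.card_pos
      rw [Finset.card_erase_of_mem hv] at this
      omega
    have hgoal : ¬ D.IsGoal n s := fun h => h.2.elim hnot
    have := hF.not_liesIn_zero hcar hd0
    simp [hA, hB, hgoal, not_exists.1 this]
  · have hA : {v | D.IsUp n s v}.ncard = if d = n then 0 else 1 := by
      split_ifs with hdn'
      · have : {v | D.IsUp n s v} = ∅ := by
          rw [Set.eq_empty_iff_forall_notMem]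
          rintro v ⟨-, h, -⟩
          omega
        rw [this, Set.ncard_empty]
      · rw [hF.setOf_isUp_of_isAlternating halt (by omega), hcard]
        exact (hF.ncard_insert (by omega) (hF.liesIn_succ (by omega) hcar.1 δ) hcard).1
          ⟨ε, hcar.1⟩
    have hB : {v | v ∈ s ∧ D.IsUp n (s.erase v) v}.ncard = if d = 0 then 0 else 1 := by
      rw [hF.ncard_isUp_erase hd hcar hcard]
      split_ifs with hd0
      · rw [Finset.card_eq_zero, Finset.filter_eq_empty_iff]
        intro v hv h
        have := h.1.card_pos
        rw [Finset.card_erase_of_mem hv] at this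
        omega
      · exact halt.card_facets (by omega) ε
    have hgoal : D.IsGoal n s ↔ d = n :=
      ⟨fun h => by have := h.1; omega, fun h => ⟨by omega, δ, halt⟩⟩
    have hzero : (∃ ε, D.LiesIn ε 0 s) ↔ d = 0 := by
      constructor
      · intro h
        by_contra hd0
        exact hF.not_liesIn_zero hcar (by omega) h
      · rintro rfl
        exact ⟨ε, hcar.1⟩
    rw [hA, hB, hgoal, hzero]
    split_ifs <;> omega

end IsFlagged

end Input

/-! ### Following the path -/

section Trail

variable {α : Type*} {adj : α → α → Prop} {p q : ℕ → α} {j : ℕ} {a : α}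

/-- `p 0, …, p j` is a walk that never turns back. -/
structure IsTrail (adj : α → α → Prop) (p : ℕ → α) (j : ℕ) : Prop where
  adj : ∀ i < j, adj (p i) (p (i + 1))
  ne : ∀ i, i + 2 ≤ j → p (i + 2) ≠ p i

/-- In a graph of degrees at most two, a walk from an endpoint that never turns back does not
return to a node visited before. -/
lemma IsTrail.injective (hp : IsTrail adj p j) (hsymm : ∀ x y, adj x y → adj y x)
    (hirr : ∀ x, ¬ adj x x)
    (hdeg : ∀ x y z w, adj x y → adj x z → adj x w → y = z ∨ y = w ∨ z = w)
    (hend : ∀ y z, adj (p 0) y → adj (p 0) z → y = z) :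
    ∀ k ≤ j, ∀ i < k, p i ≠ p k := by
  intro k
  induction k using Nat.strong_induction_on with
  | _ k ih =>
    intro hk i hi heq
    obtain ⟨k, rfl⟩ : ∃ l, k = l + 1 := ⟨k - 1, by omega⟩
    have hback : adj (p i) (p k) := by rw [heq]; exact hsymm _ _ (hp.adj k (by omega))
    have hnext := hp.adj i (by omega)
    -- the walk cannot reach `p i` again through the edge `p i`, `p (i + 1)`
    have hnot : p k ≠ p (i + 1) := by
      intro h
      rcases lt_trichotomy (i + 1) k with h1 | h1 | h1
      · exact ih k (by omega) (by omega) (i + 1) h1 h.symm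
      · subst h1
        exact hp.ne i hk heq.symm
      · have : i = k := by omega
        subst this
        rw [← heq] at hnext
        exact hirr _ hnext
    cases i with
    | zero => exact hnot (hend _ _ hback hnext)
    | succ i =>
      have hprev := hsymm _ _ (hp.adj i (by omega))
      rcases hdeg _ _ _ _ hprev hnext hback with h | h | h
      · exact hp.ne i (by omega) h.symm
      · exact ih k (by omega) (by omega) i (by omega) h
      · exact hnot h.symm

lemma IsTrail.eq_of_start_eq (hp : IsTrail adj p j) (hq : IsTrail adj q j)
    (hsymm : ∀ x y, adj x y → adj y x)
    (hdeg : ∀ x y z w, adj x y → adj x z → adj x w → y = z ∨ y = w ∨ z = w)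
    (hend : ∀ y z, adj (p 0) y → adj (p 0) z → y = z) (h0 : p 0 = q 0) :
    ∀ i ≤ j, p i = q i := by
  intro i
  induction i using Nat.strong_induction_on with
  | _ i ih =>
    intro hi
    match i with
    | 0 => exact h0
    | 1 => exact hend _ _ (hp.adj 0 hi) (h0 ▸ hq.adj 0 hi)
    | i + 2 =>
      have h1 := ih i (by omega) (by omega)
      have h2 := ih (i + 1) (by omega) (by omega)
      have h3 := hsymm _ _ (hp.adj i (by omega))
      have h4 := hp.adj (i + 1) (by omega)
      have h5 := hq.adj (i + 1) (by omega)
      rw [← h2] at h5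
      rcases hdeg _ _ _ _ h3 h4 h5 with h | h | h
      · exact absurd h.symm (hp.ne i hi)
      · exact absurd (h.symm.trans h1) (hq.ne i hi)
      · exact h

/-- An involution of the graph would reverse a path from an endpoint to its image, and therefore
fix the middle node or swap the ends of the middle edge. -/
lemma IsTrail.ne_image_start (hp : IsTrail adj p j) (hsymm : ∀ x y, adj x y → adj y x)
    (hdeg : ∀ x y z w, adj x y → adj x z → adj x w → y = z ∨ y = w ∨ z = w)
    (hend : ∀ y z, adj (p 0) y → adj (p 0) z → y = z) {φ : α → α}
    (hφ : Function.Involutive φ) (hφadj : ∀ x y, adj x y → adj (φ x) (φ y))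
    (hnode : ∀ i ≤ j, φ (p i) ≠ p i) (hedge : ∀ x, ¬ adj (φ x) x) : p j ≠ φ (p 0) := by
  intro h
  have hq : IsTrail adj (fun i => φ (p (j - i))) j := by
    refine ⟨fun i hi => hφadj _ _ (hsymm _ _ ?_), fun i hi heq => ?_⟩
    · have := hp.adj (j - (i + 1)) (by omega)
      rwa [show j - (i + 1) + 1 = j - i by omega] at this
    · have := hp.ne (j - (i + 2)) (by omega)
      rw [show j - (i + 2) + 2 = j - i by omega] at this
      exact this (hφ.injective heq.symm)
  have heq := hp.eq_of_start_eq hq hsymm hdeg hend (by simp only [Nat.sub_zero]; rw [h, hφ])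
  rcases Nat.even_or_odd' j with ⟨i, hi | hi⟩
  · have := heq i (by omega)
    simp only [show j - i = i by omega] at this
    exact hnode i (by omega) this.symm
  · have := heq i (by omega)
    simp only [show j - i = i + 1 by omega] at this
    have h1 := hp.adj i (by omega)
    rw [this] at h1
    exact hedge _ h1

end Trail

namespace Input

variable {V : Type*} [DecidableEq V] {D : Input V} {n : ℕ} {s t : Finset V} {ε δ : ℤˣ} {d c : ℕ}

namespace IsFlagged

lemma isNode_image (hF : D.IsFlagged n) (hs : D.IsNode n s) :
    D.IsNode n (s.image D.antipode) := by
  obtain ⟨hface, d, hd, ε, hcar, hcase⟩ := hs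
  refine ⟨hF.image_mem s hface, d, hd, -ε, hF.hasCarrier_image.2 (by rwa [neg_neg]), ?_⟩
  have halt : ∀ {ε : ℤˣ} {s : Finset V}, IsAlternating D.label ε s →
      IsAlternating D.label (-ε) (s.image D.antipode) := fun h =>
    h.image_neg hF.involutive.injective hF.label_antipode
  rw [hF.card_image]
  rcases hcase with ⟨hcard, h⟩ | ⟨hcard, hnot, v, hv, h⟩ | ⟨hcard, δ, h⟩
  · exact Or.inl ⟨hcard, halt h⟩
  · refine Or.inr (Or.inl ⟨hcard, fun δ hδ => hnot (-δ) (hF.isAlternating_image.1 hδ),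
      D.antipode v, Finset.mem_image_of_mem _ hv, ?_⟩)
    rw [← Finset.image_erase hF.involutive.injective]
    exact halt h
  · exact Or.inr (Or.inr ⟨hcard, -δ, halt h⟩)

lemma adj_image (hF : D.IsFlagged n) (h : D.Adj n s t) :
    D.Adj n (s.image D.antipode) (t.image D.antipode) := by
  obtain ⟨h1, h2, h3, d, hd, ε, h4, h5, h6⟩ := h
  refine ⟨hF.isNode_image h1, hF.isNode_image h2, ?_, d, hd, -ε, ?_⟩
  · rw [hF.card_image, hF.card_image,
      Finset.image_subset_image_iff hF.involutive.injective,
      Finset.image_subset_image_iff hF.involutive.injective]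
    exact h3
  · rw [← Finset.image_inter _ _ hF.involutive.injective, ← Finset.image_union, hF.card_image,
      hF.hasCarrier_image, hF.isAlternating_image, neg_neg]
    exact ⟨h4, h5, h6⟩

/-- The carriers of a node and of its antipode have opposite signs. -/
lemma image_ne_of_isNode (hF : D.IsFlagged n) (hs : D.IsNode n s) : s.image D.antipode ≠ s := by
  intro heq
  obtain ⟨hface, d, hd, ε, hcar, hcase⟩ := hs
  have hcard : d ≤ s.card := by
    rcases hcase with h | h | h <;> omega
  have h1 := hF.hasCarrier_image.1 (heq.symm ▸ hcar : D.HasCarrier ε d (s.image D.antipode))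
  have h2 := (hF.hasCarrier_unique (by omega) hcar hcard h1).2
  rcases Int.units_eq_one_or ε with rfl | rfl <;> exact absurd h2 (by decide)

lemma isAlternating_singleton (hF : D.IsFlagged n) {v : V} (hv : {v} ∈ D.faces) :
    ∃ ε, IsAlternating D.label ε {v} := by
  have h0 : D.label v ≠ 0 := by
    have := hF.label_add_ne_zero _ hv v (by simp) v (by simp)
    omega
  rcases lt_or_gt_of_ne h0 with h | h
  · exact ⟨-1, by simp, by simp, by simp [Int.sign_eq_neg_one_of_neg h, Finset.filter_singleton]⟩
  · exact ⟨1, by simp, by simp, by simp [Int.sign_eq_one_of_pos h, Finset.filter_singleton]⟩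

lemma eq_or_eq_or_eq_of_adj [Finite V] (hF : D.IsFlagged n) (hn : 1 ≤ n) (s t u w : Finset V)
    (ht : D.Adj n s t) (hu : D.Adj n s u) (hw : D.Adj n s w) : t = u ∨ t = w ∨ u = w := by
  rcases (hF.degree hn ht.1).1 with h | h
  · obtain ⟨x, hx⟩ := Set.ncard_eq_one.1 h
    have h1 : t ∈ ({x} : Set (Finset V)) := hx ▸ ht
    have h2 : u ∈ ({x} : Set (Finset V)) := hx ▸ hu
    exact Or.inl ((Set.mem_singleton_iff.1 h1).trans (Set.mem_singleton_iff.1 h2).symm)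
  · obtain ⟨x, y, -, hxy⟩ := Set.ncard_eq_two.1 h
    have h1 : t ∈ ({x, y} : Set (Finset V)) := hxy ▸ ht
    have h2 : u ∈ ({x, y} : Set (Finset V)) := hxy ▸ hu
    have h3 : w ∈ ({x, y} : Set (Finset V)) := hxy ▸ hw
    simp only [Set.mem_insert_iff, Set.mem_singleton_iff] at h1 h2 h3
    grind

/-- The path from `H 0` reaches an alternating `n`-simplex: it visits no node twice, and it does
not end at `-H 0`. -/
theorem exists_follow_eq_some [Finite V] (hF : D.IsFlagged n) (hn : 1 ≤ n) {v : V}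
    (hv : ∀ s, s ∈ D.hemi 0 ↔ s = {v}) (k j : ℕ) (hkj : D.faces.length ≤ k + j)
    (p : ℕ → Finset V) (hp0 : p 0 = {v}) (hp : IsTrail (D.Adj n) p j)
    (hgoal : ∀ i < j, ¬ D.IsGoal n (p i)) :
    ∃ s, D.follow n k (if j = 0 then none else some (p (j - 1))) (p j) = some s ∧
      s ∈ D.faces ∧ D.IsGoal n s := by
  have hsymm : ∀ s t, D.Adj n s t → D.Adj n t s := fun s t h => h.symm
  have hirr : ∀ s, ¬ D.Adj n s s := fun s h => h.card_ne rfl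
  have hdeg := hF.eq_or_eq_or_eq_of_adj hn
  have h0lies : D.LiesIn 1 0 {v} := liesIn_one.2 ((hv _).2 rfl)
  have h0face : {v} ∈ D.faces := hF.mem_faces_of_liesIn (Nat.zero_le n) h0lies
  have hnode0 : D.IsNode n {v} := ⟨h0face, 0, by omega, 1,
    hF.hasCarrier_of_card (Nat.zero_le n) h0lies (by simp),
    Or.inr (Or.inr ⟨by simp, hF.isAlternating_singleton h0face⟩)⟩
  have hdeg0 : {t | D.Adj n {v} t}.ncard = 1 := (hF.degree hn hnode0).2.2 (Or.inl ⟨1, h0lies⟩)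
  have hend : ∀ p : ℕ → Finset V, p 0 = {v} → ∀ y z, D.Adj n (p 0) y → D.Adj n (p 0) z → y = z := by
    intro p hp0
    rw [hp0]
    obtain ⟨x, hx⟩ := Set.ncard_eq_one.1 hdeg0
    intro y z hy hz
    have h1 : y ∈ ({x} : Set (Finset V)) := hx ▸ hy
    have h2 : z ∈ ({x} : Set (Finset V)) := hx ▸ hz
    exact (Set.mem_singleton_iff.1 h1).trans (Set.mem_singleton_iff.1 h2).symm
  -- the nodes of a trail are different simplices, so that there is room for them in the list
  have htrail : ∀ (j : ℕ) (p : ℕ → Finset V), p 0 = {v} → IsTrail (D.Adj n) p j →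
      (∀ i ≤ j, D.IsNode n (p i)) ∧ (∀ k ≤ j, ∀ i < k, p i ≠ p k) ∧ j + 1 ≤ D.faces.length := by
    intro j p hp0 hp
    have hnode : ∀ i ≤ j, D.IsNode n (p i) := by
      intro i hi
      cases i with
      | zero => rwa [hp0]
      | succ i => exact (hp.adj i hi).2.1
    have hinj := hp.injective hsymm hirr hdeg (hend p hp0)
    refine ⟨hnode, hinj, ?_⟩
    have h1 : (Finset.range (j + 1)).card ≤ D.faces.toFinset.card := by
      refine Finset.card_le_card_of_injOn p (fun i hi => ?_) fun i hi i' hi' heq => ?_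
      · have := (hnode i (by simpa [Nat.lt_succ_iff] using hi)).1
        simpa using this
      · simp only [Finset.coe_range, Set.mem_Iio] at hi hi'
        rcases lt_trichotomy i i' with h | h | h
        · exact absurd heq (hinj i' (by omega) i h)
        · exact h
        · exact absurd heq.symm (hinj i (by omega) i' h)
    rw [Finset.card_range] at h1
    exact h1.trans (List.toFinset_card_le _)
  induction k generalizing j p with
  | zero =>
    have := (htrail j p hp0 hp).2.2
    omega
  | succ k ih =>
    obtain ⟨hnode, hinj, -⟩ := htrail j p hp0 hp
    rw [follow]
    by_cases hg : D.IsGoal n (p j)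
    · exact ⟨p j, by rw [if_pos hg], (hnode j le_rfl).1, hg⟩
    rw [if_neg hg]
    have hne : p j ≠ ({v} : Finset V).image D.antipode := by
      rw [← hp0]
      exact hp.ne_image_start hsymm hdeg (hend p hp0) (φ := fun s => s.image D.antipode)
        hF.image_image (fun _ _ h => hF.adj_image h)
        (fun i hi => hF.image_ne_of_isNode (hnode i hi)) fun s h => h.card_ne (hF.card_image s)
    obtain ⟨t, ht, htp⟩ : ∃ t, D.Adj n (p j) t ∧
        (if j = 0 then none else some (p (j - 1))) ≠ some t := by
      by_cases hj : j = 0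
      · subst hj
        obtain ⟨x, hx⟩ := Set.ncard_eq_one.1 hdeg0
        have : x ∈ {t | D.Adj n {v} t} := by rw [hx]; rfl
        exact ⟨x, by rw [hp0]; exact this, by simp⟩
      · have hzero : ¬ ∃ ε, D.LiesIn ε 0 (p j) := by
          rintro ⟨ε, hε⟩
          rcases Int.units_eq_one_or ε with rfl | rfl
          · rw [liesIn_one, hv, ← hp0] at hε
            exact hinj j le_rfl 0 (by omega) hε.symm
          · rw [liesIn_neg_one, hv] at hε
            exact hne (by rw [← hε, hF.image_image])
        have hd := hF.degree hn (hnode j le_rfl)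
        have h2 := hd.1.resolve_left fun h1 => (hd.2.1 h1).elim hzero hg
        obtain ⟨x, y, hxy, hset⟩ := Set.ncard_eq_two.1 h2
        have hx : x ∈ {t | D.Adj n (p j) t} := by rw [hset]; exact Or.inl rfl
        have hy : y ∈ {t | D.Adj n (p j) t} := by rw [hset]; exact Or.inr rfl
        rw [if_neg hj]
        by_cases h : p (j - 1) = x
        · exact ⟨y, hy, fun h' => hxy (h.symm.trans (Option.some.inj h'))⟩
        · exact ⟨x, hx, fun h' => h (Option.some.inj h')⟩
    cases hfind : D.faces.find? fun t => decide (D.Adj n (p j) t ∧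
        (if j = 0 then none else some (p (j - 1))) ≠ some t) with
    | none =>
      have := List.find?_eq_none.1 hfind t ht.2.1.1
      exact absurd (decide_eq_true ⟨ht, htp⟩) this
    | some u =>
      have hu := List.find?_some hfind
      rw [decide_eq_true_eq] at hu
      let q : ℕ → Finset V := fun i => if i ≤ j then p i else u
      have hqle : ∀ i ≤ j, q i = p i := fun i hi => if_pos hi
      have hqj : q (j + 1) = u := if_neg (by omega)
      have hq : IsTrail (D.Adj n) q (j + 1) := by
        refine ⟨fun i hi => ?_, fun i hi => ?_⟩
        · rw [hqle i (by omega)]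
          rcases (show i ≤ j by omega).lt_or_eq with h | rfl
          · rw [hqle (i + 1) h]
            exact hp.adj i h
          · rw [hqj]
            exact hu.1
        · rw [hqle i (by omega)]
          rcases (show i + 1 ≤ j by omega).lt_or_eq with h | rfl
          · rw [hqle (i + 2) h]
            exact hp.ne i h
          · rw [hqj]
            intro heq
            refine hu.2 ?_
            rw [if_neg (by omega), Nat.add_sub_cancel, heq]
      obtain ⟨s, hs, hs'⟩ := ih (j + 1) (by omega) q (by rw [hqle 0 (Nat.zero_le j), hp0]) hq (by
        intro i hi
        rw [hqle i (by omega)]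
        rcases (show i ≤ j by omega).lt_or_eq with h | rfl
        · exact hgoal i h
        · exact hg)
      refine ⟨s, ?_, hs'⟩
      rw [if_neg (by omega), Nat.add_sub_cancel, hqle j le_rfl, hqj] at hs
      exact hs

end IsFlagged

end Input

/-! ### Parity, and transfer to the triangulation -/

namespace Input

variable {V : Type*} [DecidableEq V] {D : Input V} {n : ℕ} {ε : ℤˣ} {d : ℕ}

/-- The alternating `d`-simplices of sign `ε` in the hemisphere `H d`. -/
def hemiAlternating [Fintype V] (D : Input V) (d : ℕ) (ε : ℤˣ) : Finset (Finset V) :=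
  Finset.univ.filter fun s => s ∈ D.hemi d ∧ s.card = d + 1 ∧ IsAlternating D.label ε s

namespace IsFlagged

/-- Modulo two, the number of positive alternating facets of a simplex is one if the simplex is
alternating, of either sign, and zero otherwise. -/
lemma card_facets_eq (hF : D.IsFlagged n) {s : Finset V} (hs : s ∈ D.faces) (hcard : 2 ≤ s.card) :
    ((s.filter fun v => IsAlternating D.label 1 (s.erase v)).card : ZMod 2) =
      (if IsAlternating D.label 1 s then 1 else 0) +
        if IsAlternating D.label (-1) s then 1 else 0 := by
  by_cases h : ∃ δ, IsAlternating D.label δ s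
  · obtain ⟨δ, hδ⟩ := h
    rw [hδ.card_facets hcard]
    rcases Int.units_eq_one_or δ with rfl | rfl
    · rw [if_pos hδ, if_neg fun h => absurd (hδ.sign_unique h) (by decide)]
      simp
    · rw [if_pos hδ, if_neg fun h => absurd (hδ.sign_unique h) (by decide)]
      simp
  · push Not at h
    rw [if_neg (h _), if_neg (h _), add_zero]
    by_cases hv : ∃ v ∈ s, IsAlternating D.label 1 (s.erase v)
    · obtain ⟨v, hv, halt⟩ := hv
      rw [card_facets_of_not_isAlternating h (hF.label_add_ne_zero s hs) hv halt]
      rfl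
    · push Not at hv
      rw [Finset.filter_eq_empty_iff.2 fun v hvs => hv v hvs]
      simp

/-- Modulo two, the number of `(d+1)`-simplices of `H (d+1)` around a `d`-simplex of it is one if
that lies in the boundary `H d ∪ -H d`, and zero otherwise. -/
lemma card_insert_eq [Fintype V] (hF : D.IsFlagged n) (hd : d + 1 ≤ n) {t : Finset V}
    (ht : t ∈ D.hemi (d + 1)) (hcard : t.card = d + 1) :
    ((Finset.univ.filter fun v => v ∉ t ∧ insert v t ∈ D.hemi (d + 1)).card : ZMod 2) =
      (if t ∈ D.hemi d then 1 else 0) + if t.image D.antipode ∈ D.hemi d then 1 else 0 := by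
  have h1 : (Finset.univ.filter fun v => v ∉ t ∧ insert v t ∈ D.hemi (d + 1)).card =
      {v | v ∉ t ∧ insert v t ∈ D.hemi (d + 1)}.ncard := by
    rw [← Set.ncard_coe_finset]
    simp
  rw [h1]
  by_cases h2 : t ∈ D.hemi d
  · have h3 : t.image D.antipode ∉ D.hemi d := fun h3 => by
      have := hF.card_le_of_antipode d (by omega) t h2 h3
      omega
    rw [hF.ncard_eq_one d hd t ht hcard (Or.inl h2), if_pos h2, if_neg h3]
    simp
  · by_cases h3 : t.image D.antipode ∈ D.hemi d
    · rw [hF.ncard_eq_one d hd t ht hcard (Or.inr h3), if_neg h2, if_pos h3]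
      simp
    · rw [hF.ncard_eq_two d hd t ht hcard h2 h3, if_neg h2, if_neg h3]
      rfl

/-- The alternating `d`-simplices of `-H d`, counted through their antipodes. -/
lemma card_filter_image [Fintype V] (hF : D.IsFlagged n) (d : ℕ) :
    (Finset.univ.filter fun s : Finset V => s.image D.antipode ∈ D.hemi d ∧ s.card = d + 1 ∧
      IsAlternating D.label 1 s).card = (D.hemiAlternating d (-1)).card := by
  refine Finset.card_nbij' (fun s => s.image D.antipode) (fun s => s.image D.antipode) ?_ ?_
    (fun s _ => hF.image_image s) fun s _ => hF.image_image s
  · intro s hs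
    simp only [hemiAlternating, Finset.coe_filter, Finset.mem_univ, true_and,
      Set.mem_ofPred_eq] at hs ⊢
    rw [hF.card_image, hF.isAlternating_image, neg_neg]
    exact hs
  · intro s hs
    simp only [hemiAlternating, Finset.coe_filter, Finset.mem_univ, true_and,
      Set.mem_ofPred_eq] at hs ⊢
    rw [hF.image_image, hF.card_image, hF.isAlternating_image]
    exact hs

/-- The alternating `d`-simplices of `H d` are odd in number. The induction step counts the pairs of
a `(d+1)`-simplex of `H (d+1)` and a positive alternating facet of it in two ways. -/
lemma odd_card_hemiAlternating [Fintype V] (hF : D.IsFlagged n) (hd : d ≤ n) :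
    Odd ((D.hemiAlternating d 1).card + (D.hemiAlternating d (-1)).card) := by
  induction d with
  | zero =>
    obtain ⟨v, hv⟩ := hF.hemi_zero
    have hface : {v} ∈ D.faces := hF.mem_faces 0 hd _ ((hv _).2 rfl)
    obtain ⟨δ, hδ⟩ := hF.isAlternating_singleton hface
    have hpos : D.hemiAlternating 0 δ = {{v}} := by
      ext s
      simp only [hemiAlternating, hv, Finset.mem_filter, Finset.mem_univ, true_and,
        Finset.mem_singleton]
      refine ⟨fun h => h.1, ?_⟩
      rintro rfl
      exact ⟨rfl, by simp, hδ⟩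
    have hneg : D.hemiAlternating 0 (-δ) = ∅ := by
      refine Finset.filter_eq_empty_iff.2 fun s _ hs => ?_
      have h1 := hs.2.2
      rw [(hv s).1 hs.1] at h1
      have h2 := hδ.sign_unique h1
      rcases Int.units_eq_one_or δ with rfl | rfl <;> exact absurd h2 (by decide)
    rcases Int.units_eq_one_or δ with rfl | rfl
    · rw [hpos, hneg]; simp
    · rw [neg_neg] at hneg
      rw [hpos, hneg]; simp
  | succ d ih =>
    have ih := ih (by omega)
    rw [← ZMod.natCast_eq_one_iff_odd] at ih ⊢
    rw [← ih]
    set F₂ := Finset.univ.filter fun s : Finset V => s ∈ D.hemi (d + 1) ∧ s.card = d + 1 + 1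
      with hF₂
    set F₁ := Finset.univ.filter fun t : Finset V => t ∈ D.hemi (d + 1) ∧ t.card = d + 1 ∧
      IsAlternating D.label 1 t with hF₁
    have hdouble : ∑ s ∈ F₂, (s.filter fun v => IsAlternating D.label 1 (s.erase v)).card =
        ∑ t ∈ F₁, (Finset.univ.filter fun v => v ∉ t ∧ insert v t ∈ D.hemi (d + 1)).card := by
      rw [← Finset.card_sigma, ← Finset.card_sigma]
      refine Finset.card_nbij' (fun x => ⟨x.1.erase x.2, x.2⟩) (fun x => ⟨insert x.2 x.1, x.2⟩)
        ?_ ?_ ?_ ?_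
      · rintro ⟨s, v⟩ h
        simp only [hF₂, hF₁, Finset.coe_sigma, Set.mem_sigma_iff, Finset.coe_filter,
          Finset.mem_univ, true_and, Set.mem_ofPred_eq] at h ⊢
        obtain ⟨⟨hs, hcard⟩, hv, halt⟩ := h
        rw [Finset.insert_erase hv, Finset.card_erase_of_mem hv]
        exact ⟨⟨hF.hemi_mono _ hd s hs _ (Finset.erase_subset v s) halt.1, by omega, halt⟩,
          Finset.notMem_erase v s, hs⟩
      · rintro ⟨t, v⟩ h
        simp only [hF₂, hF₁, Finset.coe_sigma, Set.mem_sigma_iff, Finset.coe_filter,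
          Finset.mem_univ, true_and, Set.mem_ofPred_eq] at h ⊢
        obtain ⟨⟨-, hcard, halt⟩, hv, ht⟩ := h
        rw [Finset.erase_insert hv, Finset.card_insert_of_notMem hv]
        exact ⟨⟨ht, by omega⟩, Finset.mem_insert_self v t, halt⟩
      · rintro ⟨s, v⟩ h
        simp only [Finset.coe_sigma, Set.mem_sigma_iff, Finset.coe_filter,
          Set.mem_ofPred_eq] at h
        simp [Finset.insert_erase h.2.1]
      · rintro ⟨t, v⟩ h
        simp only [Finset.coe_sigma, Set.mem_sigma_iff, Finset.coe_filter,
          Finset.mem_univ, true_and, Set.mem_ofPred_eq] at h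
        simp [Finset.erase_insert h.2.1]
    have hcast := congrArg (Nat.cast : ℕ → ZMod 2) hdouble
    rw [Nat.cast_sum, Nat.cast_sum] at hcast
    rw [Finset.sum_congr rfl fun s hs => hF.card_facets_eq (s := s)
        (hF.mem_faces _ hd s (Finset.mem_filter.1 hs).2.1)
        (by have := (Finset.mem_filter.1 hs).2.2; omega),
      Finset.sum_congr rfl fun t ht => hF.card_insert_eq hd (t := t)
        (Finset.mem_filter.1 ht).2.1 (Finset.mem_filter.1 ht).2.2.1,
      Finset.sum_add_distrib, Finset.sum_add_distrib, Finset.sum_boole, Finset.sum_boole,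
      Finset.sum_boole, Finset.sum_boole] at hcast
    have h1 : ∀ ε, F₂.filter (fun s => IsAlternating D.label ε s) =
        D.hemiAlternating (d + 1) ε := by
      intro ε
      ext s
      simp [hF₂, hemiAlternating, and_assoc]
    have h2 : F₁.filter (fun t => t ∈ D.hemi d) = D.hemiAlternating d 1 := by
      ext t
      simp only [hF₁, hemiAlternating, Finset.mem_filter, Finset.mem_univ, true_and]
      exact ⟨fun h => ⟨h.2, h.1.2⟩, fun h => ⟨⟨hF.hemi_succ d hd t h.1, h.2⟩, h.1⟩⟩
    have h3 : (F₁.filter (fun t => t.image D.antipode ∈ D.hemi d)).card =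
        (D.hemiAlternating d (-1)).card := by
      rw [← hF.card_filter_image d]
      congr 1
      ext t
      simp only [hF₁, Finset.mem_filter, Finset.mem_univ, true_and]
      refine ⟨fun h => ⟨h.2, h.1.2⟩, fun h => ⟨⟨?_, h.2⟩, h.1⟩⟩
      rw [← hF.image_image t]
      exact hF.antipode_hemi_succ d hd _ h.1
    rw [h1, h1, h2, h3] at hcast
    rw [Nat.cast_add, hcast, Nat.cast_add]

/-- A positive alternating `n`-simplex lies either in `H n` or in `-H n`; in the second case its
antipode is a negative one of `H n`. -/
lemma odd_ncard_alternating [Fintype V] (hF : D.IsFlagged n) :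
    Odd {s : Finset V | s ∈ D.faces ∧ s.card = n + 1 ∧ IsAlternating D.label 1 s}.ncard := by
  have h1 : {s : Finset V | s ∈ D.faces ∧ s.card = n + 1 ∧ IsAlternating D.label 1 s} =
      ((D.hemiAlternating n 1 ∪ Finset.univ.filter fun s : Finset V =>
        s.image D.antipode ∈ D.hemi n ∧ s.card = n + 1 ∧ IsAlternating D.label 1 s :
          Finset (Finset V)) : Set (Finset V)) := by
    ext s
    simp only [hemiAlternating, Finset.coe_union, Finset.coe_filter, Finset.mem_univ, true_and,
      Set.mem_union, Set.mem_ofPred_eq]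
    constructor
    · rintro ⟨hs, hcard, halt⟩
      exact (hF.cover s hs hcard).imp (fun h => ⟨h, hcard, halt⟩) fun h => ⟨h, hcard, halt⟩
    · rintro (⟨hs, h⟩ | ⟨hs, h⟩)
      · exact ⟨hF.mem_faces n le_rfl s hs, h⟩
      · exact ⟨hF.mem_faces_of_liesIn le_rfl (liesIn_neg_one.2 hs), h⟩
  rw [h1, Set.ncard_coe_finset, Finset.card_union_of_disjoint, hF.card_filter_image]
  · exact hF.odd_card_hemiAlternating le_rfl
  · refine Finset.disjoint_filter.2 fun s _ hs hs' => ?_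
    have := hF.card_le_of_antipode n le_rfl s hs.1 hs'.1
    omega

lemma ncard_neg_alternating (hF : D.IsFlagged n) :
    {s : Finset V | s ∈ D.faces ∧ s.card = n + 1 ∧ IsAlternating D.label (-1) s}.ncard =
      {s : Finset V | s ∈ D.faces ∧ s.card = n + 1 ∧ IsAlternating D.label 1 s}.ncard := by
  have hinv : Function.Involutive fun s : Finset V => s.image D.antipode := hF.image_image
  rw [← Set.ncard_image_of_injective _ hinv.injective]
  congr 1
  ext s
  rw [hinv.image_eq_preimage_symm]
  simp only [Set.mem_preimage, Set.mem_ofPred_eq, hF.card_image, hF.isAlternating_image, neg_neg]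
  refine and_congr_left fun _ => ⟨fun h => ?_, hF.image_mem s⟩
  rw [← hF.image_image s]
  exact hF.image_mem _ h

/-- The procedure finds an alternating `n`-simplex of each sign. -/
theorem exists_search_eq_some [Finite V] (hF : D.IsFlagged n) :
    ∃ s t : Finset V, D.search n = some (s, t) ∧
      (s ∈ D.faces ∧ s.card = n + 1 ∧ IsAlternating D.label 1 s) ∧
      (t ∈ D.faces ∧ t.card = n + 1 ∧ IsAlternating D.label (-1) t) := by
  obtain ⟨v, hv⟩ := hF.hemi_zero
  have hhead : (D.hemi 0).head? = some {v} := by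
    cases h : D.hemi 0 with
    | nil =>
      have := (hv {v}).2 rfl
      rw [h] at this
      simp at this
    | cons s l =>
      have : s ∈ D.hemi 0 := by rw [h]; simp
      simp [(hv s).1 this]
  obtain ⟨s, hs, hface, hcard, ε, halt⟩ : ∃ s, D.follow n D.faces.length none {v} = some s ∧
      s ∈ D.faces ∧ D.IsGoal n s := by
    rcases Nat.eq_zero_or_pos n with rfl | hn
    · have hface : {v} ∈ D.faces := hF.mem_faces 0 le_rfl _ ((hv _).2 rfl)
      have hgoal : D.IsGoal 0 {v} := ⟨by simp, hF.isAlternating_singleton hface⟩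
      refine ⟨{v}, ?_, hface, hgoal⟩
      cases D.faces.length <;> rw [follow, if_pos hgoal]
    · exact hF.exists_follow_eq_some hn hv D.faces.length 0 le_rfl (fun _ => {v}) rfl
        ⟨by simp, by simp⟩ (by simp)
  have hface' := hF.image_mem s hface
  have hcard' := (hF.card_image s).trans hcard
  rw [search, hhead]
  simp only [hs]
  rcases Int.units_eq_one_or ε with rfl | rfl
  · rw [if_pos halt]
    exact ⟨_, _, rfl, ⟨hface, hcard, halt⟩, hface', hcard',
      hF.isAlternating_image.2 (by rwa [neg_neg])⟩
  · rw [if_neg fun h => absurd (h.sign_unique halt) (by decide)]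
    exact ⟨_, _, rfl, ⟨hface', hcard', hF.isAlternating_image.2 halt⟩, hface, hcard, halt⟩

end IsFlagged

end Input

section Transfer

variable {n : ℕ} {V : Type*} {D : Input V} {ε : ℤˣ} {E : Type*} [NormedAddCommGroup E]
  [NormedSpace ℝ E]
  {K : Triangulation n E} {H : ℕ → Set (Sphere n)} {label : E → ℤ} {e : V ↪ E}

lemma Input.Describes.map_mem_alternating_iff (hD : D.Describes K H label e) {s : Finset V} :
    s.map e ∈ K.alternating label ε ↔
      s ∈ D.faces ∧ s.card = n + 1 ∧ IsAlternating D.label ε s := by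
  have hlabel : D.label = fun v => label (e v) := funext hD.label_eq
  simp only [Triangulation.alternating, Set.mem_ofPred_eq, hD.faces_iff, Finset.card_map,
    isAlternating_map, hlabel]

lemma Input.Describes.ncard_alternating (hD : D.Describes K H label e) (ε : ℤˣ) :
    (K.alternating label ε).ncard =
      {s : Finset V | s ∈ D.faces ∧ s.card = n + 1 ∧ IsAlternating D.label ε s}.ncard := by
  have := hD.finite
  have := Fintype.ofFinite V
  rw [← Set.ncard_image_of_injective _ (Finset.map_injective e)]
  congr 1
  ext s
  constructor
  · intro hs
    obtain ⟨t, rfl⟩ := exists_map_eq_of_mem_faces hD.range_eq hs.1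
    exact ⟨t, hD.map_mem_alternating_iff.1 hs, rfl⟩
  · rintro ⟨t, ht, rfl⟩
    exact hD.map_mem_alternating_iff.2 ht

end Transfer

/-- The labels of an alternating `n`-simplex have `n + 1` different magnitudes. -/
lemma Triangulation.le_of_mem_alternating {n m : ℕ} {E : Type*} [NormedAddCommGroup E]
    [NormedSpace ℝ E] {K : Triangulation n E} {label : E → ℤ} (hm : K.HasLabelsUpTo label m)
    {ε : ℤˣ} {s : Finset E} (hs : s ∈ K.alternating label ε) : n + 1 ≤ m := by
  obtain ⟨hface, hcard, halt⟩ := hs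
  have h1 : s.card ≤ (Finset.Icc (1 : ℤ) m).card := by
    refine Finset.card_le_card_of_injOn (fun v => |label v|) (fun v hv => ?_)
      fun v hv w hw h => halt.2.1 v hv w hw h
    rw [Finset.coe_Icc]
    exact hm v (K.complex.down_closed hface (Finset.singleton_subset_iff.2 hv)
      (Finset.singleton_nonempty v))
  rw [Int.card_Icc] at h1
  omega

end Fan

theorem mainTheorem1 {n m : ℕ} {E : Type*} [NormedAddCommGroup E] [NormedSpace ℝ E]
    (K : Fan.Triangulation n E) (hK : K.IsSymmetric)
    (H : ℕ → Set (Fan.Sphere n)) (hH : K.IsAlignedWith H)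
    (label : E → ℤ) (hm : K.HasLabelsUpTo label m) (hanti : K.IsAntisymmetric label)
    (hcompl : K.NoComplementaryEdge label) :
    -- the count of alternating simplices, and the bound on the number of labels
    Odd (K.alternating label 1).ncard ∧
    (K.alternating label (-1)).ncard = (K.alternating label 1).ncard ∧
    n + 1 ≤ m ∧
    -- the labelled triangulation has a finite description
    (∃ (N : ℕ) (D : Fan.Input (Fin N)) (e : Fin N ↪ E), D.Describes K H label e) ∧
    -- for each such description:
    ∀ (V : Type) [DecidableEq V] (D : Fan.Input V) (e : V ↪ E), D.Describes K H label e →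
      -- the procedure returns a positive and a negative alternating simplex
      (∃ s t : Finset V, D.search n = some (s, t) ∧
        s.map e ∈ K.alternating label 1 ∧ t.map e ∈ K.alternating label (-1)) ∧
      -- the nodes of the graph have degree one or two, and the endpoints are as claimed
      (1 ≤ n → ∀ s : Finset V, D.IsNode n s →
        ({t | D.Adj n s t}.ncard = 1 ∨ {t | D.Adj n s t}.ncard = 2) ∧
        ({t | D.Adj n s t}.ncard = 1 ↔ (∃ ε : ℤˣ, D.LiesIn ε 0 s) ∨ D.IsGoal n s)) := by
  obtain ⟨N, D, e, hD⟩ := Fan.exists_describes hK H label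
  have hF := hD.isFlagged hK hH hm hanti hcompl
  have hodd : Odd (K.alternating label 1).ncard := by
    rw [hD.ncard_alternating]
    exact hF.odd_ncard_alternating
  obtain ⟨s, hs⟩ := Set.nonempty_of_ncard_ne_zero hodd.pos.ne'
  refine ⟨hodd, ?_, Fan.Triangulation.le_of_mem_alternating hm hs, ⟨N, D, e, hD⟩, ?_⟩
  · rw [hD.ncard_alternating, hD.ncard_alternating]
    exact hF.ncard_neg_alternating
  · intro V _ D e hD
    have hF := hD.isFlagged hK hH hm hanti hcompl
    have := hD.finite
    refine ⟨?_, fun hn s hs => hF.degree hn hs⟩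
    obtain ⟨s, t, hst, hs, ht⟩ := hF.exists_search_eq_some
    exact ⟨s, t, hst, hD.map_mem_alternating_iff.2 hs, hD.map_mem_alternating_iff.2 ht⟩
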